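/- Let $G=U(1)\rtimes\mathbb Z_2$, where the generator of $\mathbb Z_2$ acts on $U(1)$ by complex conjugation, and let $$H_d=\bigl(\operatorname{Spin}(d)\times G\bigr)/\langle(-1,(-1,1))\rangle .$$ It has the representations $\rho:H_d\to O(d)$, $[x,g]\mapsto(v\mapsto xvx^{-1})$, and $\tau:H_d\to O(2)$, $[x,(z,y)]\mapsto(z^2,y)\in U(1)\rtimes\mathbb Z_2\cong O(2)$. An $H_d$-structure on a smooth $d$-manifold $M$ with associated plane bundle $E\to M$ is a principal $H_d$-bundle $P\to M$ together with isomorphisms of vector bundles $P\times_\rho\mathbb R^d\cong TM$ and $P\times_\tau\mathbb R^2\cong E$. For a closed $3$-manifold $M$ with an $H_3$-structure with associated plane bundle $E$, put $$Z(M,E)=(-1)^{\int_M w_1(E)^3},$$ where $w_1(E)\in H^1(M;\mathbb Z_2)$ is the first Stiefel--Whitney class, the cube is the cup product in singular cohomology, and $\int_M:H^3(M;\mathbb Z_2)\to\mathbb Z_2$ is evaluation on the mod $2$ fundamental class. Let $\gamma\to\mathbb{RP}^3$ be the canonical line bundle and $E=\gamma\oplus\underline{\mathbb R}$. Then the classes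 $w_1(\gamma)$, $w_1(E)$, $w_1(\underline{\mathbb R}^2)$ and the mod $2$ fundamental class of $\mathbb{RP}^3$ exist and are unique, and: 1. $w_1(E)=w_1(\gamma)$, and $w_1(\gamma)^3\neq0$ in $H^3(\mathbb{RP}^3;\mathbb Z_2)$. 2. $\mathbb{RP}^3$ admits an $H_3$-structure with associated plane bundle $E$, and $Z(\mathbb{RP}^3,E)=-1$ for every such $H_3$-structure. 3. $\mathbb{RP}^3$ admits an $H_3$-structure with trivial associated plane bundle $\underline{\mathbb R}^2$, and $Z(\mathbb{RP}^3,\underline{\mathbb R}^2)=1$ for every such $H_3$-structure. In particular, the $\mathbb Z_2$-valued invariant $Z$ of $H_3$-manifolds is nontrivial, and it is detected by $(\mathbb{RP}^3,\gamma\oplus\underline{\mathbb R})$. -/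

import Mathlib

noncomputable section

/-! ### Cohomology with coefficients in `ℤ/2` -/

namespace ModTwo

open CategoryTheory Simplicial

/-- Simplicial `n`-cochains with coefficients in `ℤ/2`. -/
abbrev Cochain (S : SSet.{0}) (n : ℕ) : Type := S _⦋n⦌ → ZMod 2

/-- The coboundary (no signs are needed modulo `2`). -/
def coboundary (S : SSet.{0}) (n : ℕ) : Cochain S n →ₗ[ZMod 2] Cochain S (n + 1) where
  toFun φ := fun σ => ∑ i : Fin (n + 2), φ (S.δ i σ)
  map_add' φ ψ := by
    funext σ
    simp [Finset.sum_add_distrib]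
  map_smul' a φ := by
    funext σ
    simp [Finset.mul_sum]

def cocycles (S : SSet.{0}) (n : ℕ) : Submodule (ZMod 2) (Cochain S n) :=
  LinearMap.ker (coboundary S n)

def coboundaries (S : SSet.{0}) (n : ℕ) : Submodule (ZMod 2) (Cochain S n) :=
  match n with
  | 0 => ⊥
  | m + 1 => LinearMap.range (coboundary S m)

/-- `H^n(S; ℤ/2)`. -/
abbrev Cohomology (S : SSet.{0}) (n : ℕ) : Type :=
  cocycles S n ⧸ (coboundaries S n).submoduleOf (cocycles S n)

/-- The restriction of an `n`-simplex to its vertices `j, …, j + l`. -/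
def segment (S : SSet.{0}) (j l : ℕ) {n : ℕ} (h : j + l ≤ n) (σ : S _⦋n⦌) : S _⦋l⦌ :=
  S.map (SimplexCategory.subinterval j l h).op σ

/-- The cup product of cochains: front `p`-face times back `q`-face. -/
def cupCochain {S : SSet.{0}} {p q n : ℕ} (h : p + q = n) (φ : Cochain S p) (ψ : Cochain S q) :
    Cochain S n :=
  fun σ => φ (segment S 0 p (by omega) σ) * ψ (segment S p q h.le σ)

lemma subinterval_val {j l n : ℕ} (h : j + l ≤ n) (k : Fin (l + 1)) :
    ((SimplexCategory.subinterval j l h).toOrderHom k).val = k.val + j := rfl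

lemma δ_val {n : ℕ} (i : Fin (n + 2)) (k : Fin (n + 1)) :
    ((SimplexCategory.δ i).toOrderHom k).val = if k.val < i.val then k.val else k.val + 1 := by
  change (Fin.succAbove i k).val = _
  split_ifs with hk
  · rw [Fin.succAbove_of_castSucc_lt _ _ (by simpa [Fin.lt_def] using hk)]
    simp
  · rw [Fin.succAbove_of_le_castSucc _ _ (by simpa [Fin.le_def] using hk)]
    simp

lemma segment_zero_δ_of_le {S : SSet.{0}} {p n : ℕ} (h : p ≤ n) (i : Fin (n + 2)) (hi : p < i.val)
    (σ : S _⦋n + 1⦌) :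
    segment S 0 p (by omega) (S.δ i σ) = segment S 0 p (by omega) σ := by
  change S.map _ (S.map _ σ) = S.map _ σ
  rw [← Functor.map_comp_apply, ← op_comp]
  refine congrArg (fun f => S.map (Quiver.Hom.op f) σ) ?_
  ext k : 3
  apply Fin.ext
  have hk := k.isLt
  simp only [SimplexCategory.len_mk] at hk
  simp only [SimplexCategory.comp_toOrderHom, OrderHom.comp_coe, Function.comp]
  refine (δ_val i _).trans ?_
  refine Eq.trans ?_ (subinterval_val _ _).symm
  rw [subinterval_val _ k]
  split_ifs <;> omega

lemma segment_δ_of_lt {S : SSet.{0}} {p q n : ℕ} (h : p + q ≤ n) (i : Fin (n + 2)) (hi : i.val ≤ p)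
    (σ : S _⦋n + 1⦌) :
    segment S p q h (S.δ i σ) = segment S (p + 1) q (by omega) σ := by
  change S.map _ (S.map _ σ) = S.map _ σ
  rw [← Functor.map_comp_apply, ← op_comp]
  refine congrArg (fun f => S.map (Quiver.Hom.op f) σ) ?_
  ext k : 3
  apply Fin.ext
  have hk := k.isLt
  simp only [SimplexCategory.len_mk] at hk
  simp only [SimplexCategory.comp_toOrderHom, OrderHom.comp_coe, Function.comp]
  refine (δ_val i _).trans ?_
  refine Eq.trans ?_ (subinterval_val _ _).symm
  rw [subinterval_val _ k]
  split_ifs <;> omega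

lemma segment_δ_eq {S : SSet.{0}} {j l n : ℕ} (h : j + l ≤ n) (i : Fin (l + 2))
    (i' : Fin (n + 2)) (hi : i'.val = j + i.val) (σ : S _⦋n + 1⦌) :
    segment S j l h (S.δ i' σ) = S.δ i (segment S j (l + 1) (by omega) σ) := by
  change S.map _ (S.map _ σ) = S.map _ (S.map _ σ)
  rw [← Functor.map_comp_apply, ← Functor.map_comp_apply, ← op_comp, ← op_comp]
  refine congrArg (fun f => S.map (Quiver.Hom.op f) σ) ?_
  ext k : 3
  apply Fin.ext
  have hk := k.isLt
  simp only [SimplexCategory.len_mk] at hk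
  simp only [SimplexCategory.comp_toOrderHom, OrderHom.comp_coe, Function.comp]
  refine (δ_val i' _).trans ?_
  refine Eq.trans ?_ (subinterval_val _ _).symm
  rw [subinterval_val _ k, δ_val i k]
  split_ifs <;> omega

/-- The Leibniz rule modulo `2`. -/
lemma coboundary_cupCochain {S : SSet.{0}} {p q n : ℕ} (h : p + q = n)
    (φ : Cochain S p) (ψ : Cochain S q) :
    coboundary S n (cupCochain h φ ψ) =
      cupCochain (by omega) (coboundary S p φ) ψ + cupCochain (by omega) φ (coboundary S q ψ) := by
  subst h
  funext σ
  simp only [coboundary, cupCochain, LinearMap.coe_mk, AddHom.coe_mk, Pi.add_apply]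
  rw [Finset.sum_mul, Finset.mul_sum]
  rw [Fin.sum_univ_castSucc (n := p + 1), Fin.sum_univ_succ (n := q + 1)]
  set f : ℕ → ZMod 2 := fun k => if hk : k < p + q + 2 then
    φ (segment S 0 p (by omega) (S.δ ⟨k, hk⟩ σ)) * ψ (segment S p q le_rfl (S.δ ⟨k, hk⟩ σ))
    else 0 with hf
  have e0 : ∀ i : Fin (p + q + 2), φ (segment S 0 p (by omega) (S.δ i σ)) *
      ψ (segment S p q le_rfl (S.δ i σ)) = f i.val := by
    intro i
    simp only [hf, dif_pos i.isLt]
  have e1 : ∀ i : Fin (p + 1), φ (S.δ i.castSucc (segment S 0 (p + 1) (by omega) σ)) *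
      ψ (segment S (p + 1) q (by omega) σ) = f i.val := by
    intro i
    have hi : i.val < p + q + 2 := by omega
    simp only [hf, dif_pos hi]
    rw [segment_δ_eq (n := p + q) (j := 0) (l := p) (by omega) i.castSucc _ (by simp),
      segment_δ_of_lt _ _ (by simp; omega)]
  have e2 : ∀ i : Fin (q + 1), φ (segment S 0 p (by omega) σ) *
      ψ (S.δ i.succ (segment S p (q + 1) (by omega) σ)) = f (p + 1 + i.val) := by
    intro i
    have hi : p + 1 + i.val < p + q + 2 := by omega
    simp only [hf, dif_pos hi]
    rw [segment_δ_eq (n := p + q) (j := p) (l := q) (by omega) i.succ _ (by simp; omega),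
      segment_zero_δ_of_le (by omega) _ (by simp; omega)]
  rw [Finset.sum_congr rfl fun i _ => e0 i, Finset.sum_congr rfl fun i _ => e1 i,
    Finset.sum_congr rfl fun i _ => e2 i]
  have e3 : S.δ (Fin.last (p + 1)) (segment S 0 (p + 1) (by omega) σ) =
      segment S 0 p (by omega) σ := by
    rw [← segment_δ_eq (n := p + q) (j := 0) (l := p) (by omega) (Fin.last (p + 1))
      ⟨p + 1, by omega⟩ (by simp), segment_zero_δ_of_le (by omega) _ (by simp)]
  have e4 : S.δ 0 (segment S p (q + 1) (by omega) σ) = segment S (p + 1) q (by omega) σ := by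
    rw [← segment_δ_eq (n := p + q) (j := p) (l := q) (by omega) 0 ⟨p, by omega⟩ (by simp),
      segment_δ_of_lt _ _ (by simp)]
  have e5 : ∀ a b c : ZMod 2, a + b + (b + c) = a + c := by decide
  rw [e3, e4, e5, Fin.sum_univ_eq_sum_range, Fin.sum_univ_eq_sum_range,
    Fin.sum_univ_eq_sum_range (fun k => f (p + 1 + k)), ← Finset.sum_range_add]
  congr 2
  omega

lemma cupCochain_mem_cocycles {S : SSet.{0}} {p q n : ℕ} (h : p + q = n) {φ : Cochain S p}
    {ψ : Cochain S q} (hφ : φ ∈ cocycles S p) (hψ : ψ ∈ cocycles S q) :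
    cupCochain h φ ψ ∈ cocycles S n := by
  have hφ' : coboundary S p φ = 0 := hφ
  have hψ' : coboundary S q ψ = 0 := hψ
  change coboundary S n _ = 0
  rw [coboundary_cupCochain, hφ', hψ']
  funext σ
  simp [cupCochain]

lemma cupCochain_coboundary_left {S : SSet.{0}} {p q n : ℕ} (h : p + q = n) {φ : Cochain S p}
    {ψ : Cochain S q} (hφ : φ ∈ coboundaries S p) (hψ : ψ ∈ cocycles S q) :
    cupCochain h φ ψ ∈ coboundaries S n := by
  cases p with
  | zero =>
    have hφ' : φ = 0 := hφ
    have : cupCochain h φ ψ = 0 := by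
      funext σ
      simp [cupCochain, hφ']
    rw [this]
    exact zero_mem _
  | succ p =>
    obtain ⟨α, rfl⟩ : ∃ α, coboundary S p α = φ := hφ
    obtain ⟨m, rfl⟩ : ∃ m, n = m + 1 := ⟨p + q, by omega⟩
    have hψ' : coboundary S q ψ = 0 := hψ
    refine ⟨cupCochain (by omega) α ψ, ?_⟩
    rw [coboundary_cupCochain, hψ']
    funext σ
    simp [cupCochain]

lemma cupCochain_coboundary_right {S : SSet.{0}} {p q n : ℕ} (h : p + q = n) {φ : Cochain S p}
    {ψ : Cochain S q} (hφ : φ ∈ cocycles S p) (hψ : ψ ∈ coboundaries S q) :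
    cupCochain h φ ψ ∈ coboundaries S n := by
  cases q with
  | zero =>
    have hψ' : ψ = 0 := hψ
    have : cupCochain h φ ψ = 0 := by
      funext σ
      simp [cupCochain, hψ']
    rw [this]
    exact zero_mem _
  | succ q =>
    obtain ⟨α, rfl⟩ : ∃ α, coboundary S q α = ψ := hψ
    obtain ⟨m, rfl⟩ : ∃ m, n = m + 1 := ⟨p + q, by omega⟩
    have hφ' : coboundary S p φ = 0 := hφ
    refine ⟨cupCochain (by omega) φ α, ?_⟩
    rw [coboundary_cupCochain, hφ']
    funext σ
    simp [cupCochain]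

/-- The class of a cocycle. -/
def cohomologyClass {S : SSet.{0}} {n : ℕ} (φ : cocycles S n) : Cohomology S n :=
  Submodule.Quotient.mk φ

/-- The cup product `H^p × H^q → H^n`, where `p + q = n`. -/
def cup {S : SSet.{0}} {p q n : ℕ} (h : p + q = n) (x : Cohomology S p) (y : Cohomology S q) :
    Cohomology S n :=
  Quotient.map₂
    (fun (φ : cocycles S p) (ψ : cocycles S q) =>
      (⟨cupCochain h φ.1 ψ.1, cupCochain_mem_cocycles h φ.2 ψ.2⟩ : cocycles S n))
    (fun φ φ' hφ ψ ψ' hψ => by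
      rw [← Quotient.eq_iff_equiv, Quotient.eq, Submodule.quotientRel_def] at hφ hψ ⊢
      have h1 := cupCochain_coboundary_left (q := q) h (φ := φ.1 - φ'.1) (ψ := ψ.1) hφ ψ.2
      have h2 := cupCochain_coboundary_right h (φ := φ'.1) (ψ := ψ.1 - ψ'.1) φ'.2 hψ
      have h3 : cupCochain h φ.1 ψ.1 - cupCochain h φ'.1 ψ'.1 =
          cupCochain h (φ.1 - φ'.1) ψ.1 + cupCochain h φ'.1 (ψ.1 - ψ'.1) := by
        funext σ
        simp only [cupCochain, Pi.sub_apply, Pi.add_apply]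
        ring
      change cupCochain h φ.1 ψ.1 - cupCochain h φ'.1 ψ'.1 ∈ coboundaries S n
      rw [h3]
      exact add_mem h1 h2) x y

/-- `x³ ∈ H^3` for `x ∈ H^1`. -/
def cube {S : SSet.{0}} (x : Cohomology S 1) : Cohomology S 3 :=
  cup (p := 2) (q := 1) rfl (cup (p := 1) (q := 1) rfl x x) x

/-- The coefficient group `ℤ/2`. -/
abbrev coeff : ModuleCat.{0} (ZMod 2) := ModuleCat.of (ZMod 2) (ZMod 2)

/-- The `ℤ/2`-linear functional on chains that is given by a cochain. -/
def cochainHom {S : SSet.{0}} {n : ℕ} (φ : Cochain S n) : (S.chainComplex coeff).X n ⟶ coeff :=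
  (S.isColimitChainComplexXCofan coeff n).desc
    (Limits.Cofan.mk _ fun σ => ModuleCat.ofHom (φ σ • LinearMap.id))

lemma ι_cochainHom {S : SSet.{0}} {n : ℕ} (φ : Cochain S n) (σ : S _⦋n⦌) :
    S.ιChainComplex σ ≫ cochainHom φ = ModuleCat.ofHom (φ σ • LinearMap.id) :=
  (S.isColimitChainComplexXCofan coeff n).fac _ (Discrete.mk σ)

lemma d_cochainHom {S : SSet.{0}} {n : ℕ} (φ : Cochain S n) :
    (S.chainComplex coeff).d (n + 1) n ≫ cochainHom φ = cochainHom (coboundary S n φ) := by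
  refine SSet.chainComplex_hom_ext fun σ => ?_
  rw [SSet.ιChainComplex_d_assoc, ι_cochainHom, Preadditive.sum_comp]
  have hneg : ∀ (k : ℕ) (g : coeff ⟶ coeff), ((-1 : ℤ) ^ k) • g = g := by
    intro k g
    have hg : -g = g := by
      ext
      simp [ZMod.neg_eq_self_mod_two]
    rcases neg_one_pow_eq_or ℤ k with hk | hk
    · rw [hk, one_smul]
    · rw [hk, neg_smul, one_smul, hg]
  ext
  simp [ι_cochainHom, hneg, coboundary]

lemma cochainHom_add {S : SSet.{0}} {n : ℕ} (φ ψ : Cochain S n) :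
    cochainHom (φ + ψ) = cochainHom φ + cochainHom ψ := by
  refine SSet.chainComplex_hom_ext fun σ => ?_
  rw [Preadditive.comp_add, ι_cochainHom, ι_cochainHom, ι_cochainHom]
  ext
  simp

/-- `H_n(S; ℤ/2)`. -/
abbrev Homology (S : SSet.{0}) (n : ℕ) : ModuleCat.{0} (ZMod 2) := SSet.homology S coeff n

/-- Evaluation of a cocycle on homology classes. -/
def evalCocycle {S : SSet.{0}} {n : ℕ} (φ : cocycles S n) : Homology S n ⟶ coeff :=
  (S.chainComplex coeff).homologyι n ≫
    (S.chainComplex coeff).descOpcycles (cochainHom φ.1) (n + 1) (by simp) (by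
      have hφ : coboundary S n φ.1 = 0 := φ.2
      rw [d_cochainHom, hφ]
      refine SSet.chainComplex_hom_ext fun σ => ?_
      rw [ι_cochainHom]
      ext
      simp)

lemma evalCocycle_congr {S : SSet.{0}} {n : ℕ} (φ ψ : cocycles S n)
    (h : φ.1 - ψ.1 ∈ coboundaries S n) : evalCocycle φ = evalCocycle ψ := by
  cases n with
  | zero =>
    have h0 : φ.1 - ψ.1 = 0 := h
    rw [Subtype.ext (sub_eq_zero.mp h0)]
  | succ m =>
    obtain ⟨α, hα⟩ : ∃ α, coboundary S m α = φ.1 - ψ.1 := h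
    have e : cochainHom φ.1 =
        cochainHom ψ.1 + (S.chainComplex coeff).d (m + 1) m ≫ cochainHom α := by
      rw [d_cochainHom, hα, ← cochainHom_add, add_sub_cancel]
    have hz : (S.chainComplex coeff).d (m + 1 + 1) (m + 1) ≫
        (S.chainComplex coeff).d (m + 1) m ≫ cochainHom α = 0 := by simp
    have hb := (S.chainComplex coeff).homologyι_descOpcycles_eq_zero_of_boundary
      (i := m + 1) ((S.chainComplex coeff).d (m + 1) m ≫ cochainHom α) (m + 1 + 1) (by simp)
      (cochainHom α) rfl
    rw [← add_zero (evalCocycle ψ), ← hb, evalCocycle, evalCocycle, ← Preadditive.comp_add]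
    congr 1
    rw [← cancel_epi ((S.chainComplex coeff).pOpcycles (m + 1))]
    simp [e]

/-- The Kronecker pairing `H^n(S; ℤ/2) × H_n(S; ℤ/2) → ℤ/2`. -/
def pairing {S : SSet.{0}} {n : ℕ} (x : Cohomology S n) (c : Homology S n) : ZMod 2 :=
  Quotient.lift (fun φ : cocycles S n => (evalCocycle φ).hom c)
    (fun φ ψ h => by
      rw [← Quotient.eq_iff_equiv, Quotient.eq, Submodule.quotientRel_def] at h
      dsimp only
      rw [evalCocycle_congr φ ψ h]) x

/-- The singular simplicial set of a space. -/
abbrev sing (X : Type) [TopologicalSpace X] : SSet.{0} := TopCat.toSSet.obj (TopCat.of X)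

/-- The inclusion of `X ∖ {x}` in `X`, on singular simplices. -/
def puncturedIncl (X : Type) [TopologicalSpace X] (x : X) :
    sing ({x}ᶜ : Set X) ⟶ sing X :=
  TopCat.toSSet.map (TopCat.ofHom ⟨Subtype.val, continuous_subtype_val⟩)

/-- The relative singular chain complex `C(X, X ∖ {x}; ℤ/2) = C(X; ℤ/2) / C(X ∖ {x}; ℤ/2)`. -/
abbrev localChains (X : Type) [TopologicalSpace X] (x : X) : ChainComplex (ModuleCat.{0} (ZMod 2)) ℕ :=
  Limits.cokernel (SSet.chainComplexMap (puncturedIncl X x) coeff)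

/-- The restriction `H_n(X; ℤ/2) → H_n(X, X ∖ {x}; ℤ/2)`. -/
def localRestriction (X : Type) [TopologicalSpace X] (x : X) (n : ℕ) :
    Homology (sing X) n ⟶ (localChains X x).homology n :=
  HomologicalComplex.homologyMap
    (Limits.cokernel.π (SSet.chainComplexMap (puncturedIncl X x) coeff)) n

/-- A mod `2` fundamental class of a closed `n`-manifold `X`: a class in `H_n(X; ℤ/2)` whose
restriction to each local homology group `H_n(X, X ∖ {x}; ℤ/2) ≅ ℤ/2` is the generator. -/
def IsFundamentalClass (X : Type) [TopologicalSpace X] (n : ℕ) (c : Homology (sing X) n) : Prop :=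
  ∀ x : X, (localRestriction X x n).hom c ≠ 0

/-- The mod `2` fundamental class `[X]` (unique if `X` is a closed `n`-manifold). -/
def fundamentalClass (X : Type) [TopologicalSpace X] (n : ℕ) : Homology (sing X) n :=
  Classical.epsilon (IsFundamentalClass X n)

/-- `∫_X x = ⟨x, [X]⟩`. -/
def integral {X : Type} [TopologicalSpace X] {n : ℕ} (x : Cohomology (sing X) n) : ZMod 2 :=
  pairing x (fundamentalClass X n)

section StiefelWhitney

open Bundle

variable {X : Type} [TopologicalSpace X]

/-- A singular simplex as a continuous map. -/
def toMap {n : ℕ} (σ : (sing X) _⦋n⦌) : C(stdSimplex ℝ (Fin (n + 1)), X) :=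
  TopCat.toSSetObjEquiv (TopCat.of X) (.op ⦋n⦌) σ

variable (F : Type) [NormedAddCommGroup F] [NormedSpace ℝ F] (E : X → Type)
  [∀ x, AddCommMonoid (E x)] [∀ x, Module ℝ (E x)] [TopologicalSpace (TotalSpace F E)]

/-- Given a basis `b_x` of each fibre `E_x` (with no continuity in `x`), the path `σ` transports the
orientation of `b` at its start to the orientation of `b` at its end: along `σ` there is a
continuous frame of `E` that is positively oriented with respect to `b` at both ends. -/
def PreservesOrientation (b : ∀ x, Module.Basis (Fin (Module.finrank ℝ F)) ℝ (E x))
    (σ : C(stdSimplex ℝ (Fin 2), X)) : Prop :=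
  ∃ e : ∀ t, Module.Basis (Fin (Module.finrank ℝ F)) ℝ (E (σ t)),
    (∀ i, Continuous fun t => (⟨σ t, e t i⟩ : TotalSpace F E)) ∧
    ∀ k : Fin 2, 0 < ((b (σ (stdSimplex.vertex k))).toMatrix (e (stdSimplex.vertex k))).det

open Classical in
/-- The obstruction cochain to the orientability of `E`: it is `0` on the paths that preserve the
orientation of `b`, and `1` on the paths that reverse it. -/
def orientationCochain (b : ∀ x, Module.Basis (Fin (Module.finrank ℝ F)) ℝ (E x)) :
    Cochain (sing X) 1 :=
  fun σ => if PreservesOrientation F E b (toMap σ) then 0 else 1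

/-- `w` is the first Stiefel–Whitney class of `E`: the class of the obstruction cocycle to the
orientability of `E` for some choice of orientations of the fibres. -/
def IsFirstStiefelWhitneyClass (w : Cohomology (sing X) 1) : Prop :=
  ∃ (b : ∀ x, Module.Basis (Fin (Module.finrank ℝ F)) ℝ (E x))
    (h : orientationCochain F E b ∈ cocycles (sing X) 1), cohomologyClass ⟨_, h⟩ = w

/-- The first Stiefel–Whitney class `w₁(E)` of a real vector bundle. -/
def w₁ : Cohomology (sing X) 1 := Classical.epsilon (IsFirstStiefelWhitneyClass F E)

end StiefelWhitney

end ModTwo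

/-! ### Real projective space and its canonical line bundle -/

section ProjectiveSpace

open Bundle
open scoped LinearAlgebra.Projectivization Manifold ContDiff

/-- Real projective `n`-space: the lines through the origin of `ℝ^{n+1}`. -/
abbrev RP (n : ℕ) : Type := ℙ ℝ (Fin (n + 1) → ℝ)

namespace RP

variable {n : ℕ}

/-- The quotient topology from `ℝ^{n+1} ∖ {0}`. -/
instance : TopologicalSpace (RP n) := .coinduced (Projectivization.mk' ℝ) inferInstance

lemma isQuotientMap_mk' : Topology.IsQuotientMap
    (Projectivization.mk' ℝ : { v : Fin (n + 1) → ℝ // v ≠ 0 } → RP n) :=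
  ⟨⟨rfl⟩, fun x => ⟨⟨x.rep, x.rep_nonzero⟩, x.mk_rep⟩⟩

/-- The ratio `v_j / v_i` of the homogeneous coordinates of `ℓ = [v]`. -/
def ratio (i j : Fin (n + 1)) (ℓ : RP n) : ℝ := ℓ.rep j / ℓ.rep i

/-- The set of `[v]` with `v_i ≠ 0`. -/
def affineOpen (i : Fin (n + 1)) : Set (RP n) := {ℓ | ℓ.rep i ≠ 0}

lemma exists_smul_rep (v : Fin (n + 1) → ℝ) (hv : v ≠ 0) :
    ∃ a : ℝ, a ≠ 0 ∧ v = a • (Projectivization.mk ℝ v hv).rep := by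
  obtain ⟨a, ha⟩ := Projectivization.exists_smul_eq_mk_rep ℝ v hv
  refine ⟨(a⁻¹ : ℝˣ), (a⁻¹).ne_zero, ?_⟩
  rw [← ha]
  change v = (a⁻¹ : ℝˣ) • (a • v)
  simp

lemma ratio_mk (i j : Fin (n + 1)) (v : Fin (n + 1) → ℝ) (hv : v ≠ 0) :
    ratio i j (Projectivization.mk ℝ v hv) = v j / v i := by
  obtain ⟨a, ha, h⟩ := exists_smul_rep v hv
  rw [ratio]
  conv_rhs => rw [h]
  simp only [Pi.smul_apply, smul_eq_mul]
  rw [mul_div_mul_left _ _ ha]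

lemma mk_mem_affineOpen (i : Fin (n + 1)) (v : Fin (n + 1) → ℝ) (hv : v ≠ 0) :
    Projectivization.mk ℝ v hv ∈ affineOpen i ↔ v i ≠ 0 := by
  obtain ⟨a, ha, h⟩ := exists_smul_rep v hv
  rw [affineOpen, Set.mem_ofPred_eq]
  conv_rhs => rw [h]
  simp [ha]

lemma isOpen_affineOpen (i : Fin (n + 1)) : IsOpen (affineOpen (n := n) i) := by
  rw [← isQuotientMap_mk'.isOpen_preimage]
  have : (Projectivization.mk' ℝ) ⁻¹' affineOpen (n := n) i =
      {v : { v : Fin (n + 1) → ℝ // v ≠ 0 } | v.1 i ≠ 0} := by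
    ext v
    exact mk_mem_affineOpen i v.1 v.2
  rw [this]
  exact isOpen_ne_fun ((continuous_apply i).comp continuous_subtype_val) continuous_const

lemma continuousOn_ratio (i j : Fin (n + 1)) :
    ContinuousOn (ratio i j) (affineOpen (n := n) i) := by
  rw [isQuotientMap_mk'.continuousOn_isOpen_iff (isOpen_affineOpen i)]
  have : ratio i j ∘ Projectivization.mk' ℝ =
      fun v : { v : Fin (n + 1) → ℝ // v ≠ 0 } => v.1 j / v.1 i := by
    ext v
    exact ratio_mk i j v.1 v.2
  rw [this]
  refine ContinuousOn.div ((continuous_apply j).comp continuous_subtype_val).continuousOn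
    ((continuous_apply i).comp continuous_subtype_val).continuousOn fun v hv => ?_
  exact (mk_mem_affineOpen i v.1 v.2).mp hv

lemma insertNth_ne_zero (i : Fin (n + 1)) (y : Fin n → ℝ) :
    (i.insertNth (1 : ℝ) y : Fin (n + 1) → ℝ) ≠ 0 := fun h => by
  have := congrFun h i
  simp at this

/-- The affine chart `[v] ↦ (v_j / v_i)_{j ≠ i}`. -/
def chart (i : Fin (n + 1)) : OpenPartialHomeomorph (RP n) (EuclideanSpace ℝ (Fin n)) where
  toFun ℓ := WithLp.toLp 2 fun k => ratio i (i.succAbove k) ℓ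
  invFun y := Projectivization.mk ℝ (i.insertNth (1 : ℝ) y.ofLp) (insertNth_ne_zero i y.ofLp)
  source := affineOpen i
  target := Set.univ
  map_source' _ _ := trivial
  map_target' y _ := by
    rw [mk_mem_affineOpen]
    simp
  left_inv' ℓ hℓ := by
    conv_rhs => rw [← ℓ.mk_rep]
    rw [Projectivization.mk_eq_mk_iff']
    refine ⟨(ℓ.rep i)⁻¹, ?_⟩
    have hi : ℓ.rep i ≠ 0 := hℓ
    ext j
    refine Fin.succAboveCases i ?_ (fun k => ?_) j
    · simp [hi]
    · simp [ratio, div_eq_inv_mul]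
  right_inv' y _ := by
    ext k
    simp [ratio_mk]
  open_source := isOpen_affineOpen i
  open_target := isOpen_univ
  continuousOn_toFun := by
    refine (PiLp.continuous_toLp 2 _).comp_continuousOn ?_
    exact continuousOn_pi.mpr fun k => continuousOn_ratio i _
  continuousOn_invFun := by
    refine Continuous.continuousOn ?_
    refine isQuotientMap_mk'.continuous.comp (Continuous.subtype_mk ?_ _)
    refine continuous_pi fun j => ?_
    refine Fin.succAboveCases i ?_ (fun k => ?_) j
    · simpa using continuous_const
    · simp only [Fin.insertNth_apply_succAbove]
      fun_prop

lemma exists_mem_affineOpen (ℓ : RP n) : ∃ i, ℓ ∈ affineOpen i :=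
  Function.ne_iff.mp ℓ.rep_nonzero

instance : ChartedSpace (EuclideanSpace ℝ (Fin n)) (RP n) where
  atlas := Set.range chart
  chartAt ℓ := chart (exists_mem_affineOpen ℓ).choose
  mem_chart_source ℓ := (exists_mem_affineOpen ℓ).choose_spec
  chart_mem_atlas _ := ⟨_, rfl⟩

instance : IsManifold (𝓡 n) ∞ (RP n) := by
  refine isManifold_of_contDiffOn (𝓡 n) ∞ (RP n) ?_
  rintro _ _ ⟨i, rfl⟩ ⟨j, rfl⟩
  have hc : ∀ k : Fin (n + 1), ContDiff ℝ ∞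
      fun y : EuclideanSpace ℝ (Fin n) => (i.insertNth (1 : ℝ) y.ofLp : Fin (n + 1) → ℝ) k := by
    intro k
    refine Fin.succAboveCases i ?_ (fun l => ?_) k
    · simpa using contDiff_const
    · simp only [Fin.insertNth_apply_succAbove]
      fun_prop
  simp only [modelWithCornersSelf_coe, modelWithCornersSelf_coe_symm, Function.comp_id,
    Function.id_comp, Set.preimage_id, Set.range_id, Set.inter_univ]
  rw [contDiffOn_euclidean]
  intro k
  have he : ∀ y : EuclideanSpace ℝ (Fin n), ((chart i).symm ≫ₕ chart j) y k =
      (i.insertNth (1 : ℝ) y.ofLp : Fin (n + 1) → ℝ) (j.succAbove k) /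
        (i.insertNth (1 : ℝ) y.ofLp : Fin (n + 1) → ℝ) j :=
    fun y => ratio_mk j _ _ (insertNth_ne_zero i y.ofLp)
  refine ContDiffOn.congr (f₁ := _) (ContDiffOn.div (hc (j.succAbove k)).contDiffOn
    (hc j).contDiffOn fun y hy => ?_) fun y _ => he y
  have hy' : (chart i).symm y ∈ affineOpen j := by
    rw [OpenPartialHomeomorph.trans_source] at hy
    exact hy.2
  exact (mk_mem_affineOpen j _ (insertNth_ne_zero i y.ofLp)).mp hy'

/-- The canonical line bundle `γ`: the fibre over a line `ℓ` is `ℓ` itself. -/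
def Taut (n : ℕ) (ℓ : RP n) : Type := ℓ.submodule

instance (ℓ : RP n) : AddCommGroup (Taut n ℓ) := inferInstanceAs (AddCommGroup ℓ.submodule)
instance (ℓ : RP n) : Module ℝ (Taut n ℓ) := inferInstanceAs (Module ℝ ℓ.submodule)
instance (ℓ : RP n) : TopologicalSpace (Taut n ℓ) := inferInstanceAs (TopologicalSpace ℓ.submodule)

/-- The total space of `γ` is a subspace of `ℝP^n × ℝ^{n+1}`. -/
def tautIncl (p : TotalSpace ℝ (Taut n)) : RP n × (Fin (n + 1) → ℝ) :=
  (p.1, (show p.1.submodule from p.2).1)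

instance : TopologicalSpace (TotalSpace ℝ (Taut n)) := .induced tautIncl inferInstance

lemma isInducing_tautIncl : Topology.IsInducing (tautIncl (n := n)) := ⟨rfl⟩

lemma rep_mem (ℓ : RP n) : ℓ.rep ∈ ℓ.submodule := by
  rw [Projectivization.submodule_eq]
  exact Submodule.mem_span_singleton_self _

lemma ratio_mem (i : Fin (n + 1)) (ℓ : RP n) : (fun j => ratio i j ℓ) ∈ ℓ.submodule := by
  have : (fun j => ratio i j ℓ) = (ℓ.rep i)⁻¹ • ℓ.rep := by
    ext j
    simp [ratio, div_eq_inv_mul]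
  rw [this]
  exact Submodule.smul_mem _ _ (rep_mem ℓ)

lemma eq_smul_ratio (i : Fin (n + 1)) (ℓ : RP n) (h : ℓ ∈ affineOpen i) (v : Fin (n + 1) → ℝ)
    (hv : v ∈ ℓ.submodule) : v = v i • fun j => ratio i j ℓ := by
  rw [Projectivization.submodule_eq, Submodule.mem_span_singleton] at hv
  obtain ⟨a, rfl⟩ := hv
  have hi : ℓ.rep i ≠ 0 := h
  ext j
  simp only [ratio, Pi.smul_apply, smul_eq_mul]
  field_simp

/-- The trivialization `v ↦ v_i` of `γ` over `{v_i ≠ 0}`. -/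
def tautTriv (i : Fin (n + 1)) : Trivialization ℝ (TotalSpace.proj : TotalSpace ℝ (Taut n) → RP n) where
  toFun p := (p.1, (tautIncl p).2 i)
  invFun q := ⟨q.1, (⟨q.2 • fun j => ratio i j q.1, Submodule.smul_mem _ _ (ratio_mem i q.1)⟩ :
    q.1.submodule)⟩
  source := TotalSpace.proj ⁻¹' affineOpen i
  target := affineOpen i ×ˢ Set.univ
  map_source' p hp := ⟨hp, trivial⟩
  map_target' q hq := hq.1
  left_inv' p hp := by
    obtain ⟨ℓ, v⟩ := p
    congr 1
    exact Subtype.ext (eq_smul_ratio i ℓ hp v.1 v.2).symm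
  right_inv' q hq := by
    have hi : q.1.rep i ≠ 0 := hq.1
    refine Prod.ext rfl ?_
    simp [tautIncl, ratio, hi]
  open_source := (isOpen_affineOpen i).preimage
    (continuous_fst.comp isInducing_tautIncl.continuous)
  open_target := (isOpen_affineOpen i).prod isOpen_univ
  continuousOn_toFun := by
    refine Continuous.continuousOn ?_
    have h := isInducing_tautIncl (n := n) |>.continuous
    exact (continuous_fst.comp h).prodMk ((continuous_apply i).comp (continuous_snd.comp h))
  continuousOn_invFun := by
    rw [isInducing_tautIncl.continuousOn_iff]
    refine continuousOn_fst.prodMk ?_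
    refine continuousOn_pi.mpr fun j => ?_
    refine ContinuousOn.mul continuousOn_snd ?_
    exact (continuousOn_ratio i j).comp continuousOn_fst fun q hq => hq.1
  baseSet := affineOpen i
  open_baseSet := isOpen_affineOpen i
  source_eq := rfl
  target_eq := rfl
  proj_toFun _ _ := rfl

instance : FiberBundle ℝ (Taut n) where
  totalSpaceMk_isInducing' ℓ := by
    refine (isInducing_tautIncl.of_comp_iff).mp ?_
    have h : Topology.IsInducing (Subtype.val : ℓ.submodule → (Fin (n + 1) → ℝ)) := ⟨rfl⟩
    exact Topology.isInducing_const_prod.mpr h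
  trivializationAtlas' := Set.range tautTriv
  trivializationAt' ℓ := tautTriv (exists_mem_affineOpen ℓ).choose
  mem_baseSet_trivializationAt' ℓ := (exists_mem_affineOpen ℓ).choose_spec
  trivialization_mem_atlas' ℓ := ⟨_, rfl⟩

lemma tautTriv_isLinear (i : Fin (n + 1)) : (tautTriv (n := n) i).IsLinear ℝ where
  linear _ _ := { map_add := fun _ _ => rfl, map_smul := fun _ _ => rfl }

instance : VectorBundle ℝ ℝ (Taut n) where
  trivialization_linear' := by
    rintro _ ⟨i, rfl⟩
    exact tautTriv_isLinear i
  continuousOn_coordChange' := by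
    rintro _ _ ⟨i, rfl⟩ ⟨j, rfl⟩
    have := tautTriv_isLinear (n := n) i
    have := tautTriv_isLinear (n := n) j
    have hc : ContinuousOn (fun ℓ : RP n => (ratio i j ℓ) • ContinuousLinearMap.id ℝ ℝ)
        (affineOpen i ∩ affineOpen j) :=
      ((continuousOn_ratio i j).mono Set.inter_subset_left).smul continuousOn_const
    refine hc.congr fun ℓ hℓ => ?_
    ext
    change (Trivialization.coordChangeL ℝ (tautTriv i) (tautTriv j) ℓ) 1 = _
    rw [Trivialization.coordChangeL_apply' _ _ hℓ]
    change (1 : ℝ) • ratio i j ℓ = _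
    simp

end RP

end ProjectiveSpace

/-! ### The structure group `H_d` and `H_d`-structures -/

section StructureGroup

open CliffordAlgebra
open scoped ContDiff

/-- The quadratic form `v ↦ |v|²` on `ℝ^d`. -/
def normSqForm (d : ℕ) : QuadraticForm ℝ (EuclideanSpace ℝ (Fin d)) :=
  LinearMap.BilinMap.toQuadraticMap (innerₗ (EuclideanSpace ℝ (Fin d)))

lemma normSqForm_apply {d : ℕ} (v : EuclideanSpace ℝ (Fin d)) : normSqForm d v = ‖v‖ ^ 2 := by
  simp [normSqForm]

/-- The topology of `Cl(ℝ^d)` as a finite-dimensional real vector space. -/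
instance (d : ℕ) : TopologicalSpace (CliffordAlgebra (normSqForm d)) :=
  moduleTopology ℝ (CliffordAlgebra (normSqForm d))

/-- `Spin(d)`, with the topology as a subspace of the Clifford algebra. -/
abbrev Spin (d : ℕ) : Type := spinGroup (normSqForm d)

lemma ι_normSqForm_injective (d : ℕ) : Function.Injective (ι (normSqForm d)) := by
  rw [← LinearMap.ker_eq_bot, LinearMap.ker_eq_bot']
  intro v hv
  have h := ι_sq_scalar (normSqForm d) v
  rw [hv, mul_zero, eq_comm, map_eq_zero, normSqForm_apply] at h
  simpa using h

lemma spin_conj_mem {d : ℕ} (x : Spin d) (v : EuclideanSpace ℝ (Fin d)) :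
    x.1 * ι (normSqForm d) v * (x⁻¹).1 ∈ LinearMap.range (ι (normSqForm d)) := by
  have h := spinGroup.conjAct_smul_ι_mem_range_ι (x := spinGroup.toUnits x)
    (Q := normSqForm d) x.2 v
  rwa [ConjAct.units_smul_def] at h

/-- The vector `w` with `ι w = x (ι v) x⁻¹`. -/
def spinAct {d : ℕ} (x : Spin d) (v : EuclideanSpace ℝ (Fin d)) : EuclideanSpace ℝ (Fin d) :=
  (spin_conj_mem x v).choose

lemma ι_spinAct {d : ℕ} (x : Spin d) (v : EuclideanSpace ℝ (Fin d)) :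
    ι (normSqForm d) (spinAct x v) = x.1 * ι (normSqForm d) v * (x⁻¹).1 :=
  (spin_conj_mem x v).choose_spec

lemma spinAct_mul {d : ℕ} (x y : Spin d) (v : EuclideanSpace ℝ (Fin d)) :
    spinAct (x * y) v = spinAct x (spinAct y v) := by
  apply ι_normSqForm_injective
  simp only [ι_spinAct, mul_inv_rev, Submonoid.coe_mul, mul_assoc]

lemma spinAct_one {d : ℕ} (v : EuclideanSpace ℝ (Fin d)) : spinAct 1 v = v := by
  apply ι_normSqForm_injective
  simp [ι_spinAct]

lemma norm_spinAct {d : ℕ} (x : Spin d) (v : EuclideanSpace ℝ (Fin d)) :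
    ‖spinAct x v‖ = ‖v‖ := by
  have hx : (x⁻¹).1 * x.1 = 1 := congrArg Subtype.val (inv_mul_cancel x)
  have hx' : x.1 * (x⁻¹).1 = 1 := congrArg Subtype.val (mul_inv_cancel x)
  have h := ι_sq_scalar (normSqForm d) (spinAct x v)
  have e : ι (normSqForm d) (spinAct x v) * ι (normSqForm d) (spinAct x v) =
      algebraMap ℝ _ (normSqForm d v) := by
    rw [ι_spinAct]
    calc x.1 * ι (normSqForm d) v * (x⁻¹).1 * (x.1 * ι (normSqForm d) v * (x⁻¹).1)
        = x.1 * (ι (normSqForm d) v * ((x⁻¹).1 * x.1) * ι (normSqForm d) v) * (x⁻¹).1 := by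
          simp only [mul_assoc]
      _ = algebraMap ℝ _ (normSqForm d v) := by
          rw [hx, mul_one, ι_sq_scalar, ← Algebra.commutes, mul_assoc, hx', mul_one]
  rw [e] at h
  have h2 := (algebraMap ℝ (CliffordAlgebra (normSqForm d))).injective h
  rw [normSqForm_apply, normSqForm_apply] at h2
  exact ((sq_eq_sq₀ (norm_nonneg _) (norm_nonneg _)).mp h2).symm

/-- The double covering `Spin(d) → SO(d) ⊂ O(d)`, `x ↦ (v ↦ x v x⁻¹)`. -/
def spinRep (d : ℕ) :
    Spin d →* (EuclideanSpace ℝ (Fin d) ≃ₗᵢ[ℝ] EuclideanSpace ℝ (Fin d)) where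
  toFun x :=
    { toFun := spinAct x
      invFun := spinAct x⁻¹
      left_inv := fun v => by rw [← spinAct_mul, inv_mul_cancel, spinAct_one]
      right_inv := fun v => by rw [← spinAct_mul, mul_inv_cancel, spinAct_one]
      map_add' := fun v w => by
        apply ι_normSqForm_injective
        simp only [map_add, ι_spinAct, mul_add, add_mul]
      map_smul' := fun a v => by
        apply ι_normSqForm_injective
        simp [ι_spinAct]
      norm_map' := norm_spinAct x }
  map_one' := by
    ext1 v
    exact spinAct_one v
  map_mul' x y := by
    ext1 v
    exact spinAct_mul x y v

/-- The homomorphism from `ℤ/2` to a group that is given by an involution. -/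
def involutionHom {A : Type} [Group A] (a : A) (ha : a * a = 1) :
    Multiplicative (ZMod 2) →* A where
  toFun c := if c = 1 then 1 else a
  map_one' := by simp
  map_mul' c d := by
    have h : ∀ c : Multiplicative (ZMod 2), c = 1 ∨ c = Multiplicative.ofAdd 1 := by decide
    have h1 : (Multiplicative.ofAdd 1 : Multiplicative (ZMod 2)) ≠ 1 := by decide
    have h2 : (Multiplicative.ofAdd 1 * Multiplicative.ofAdd 1 : Multiplicative (ZMod 2)) = 1 := by
      decide
    rcases h c with rfl | rfl <;> rcases h d with rfl | rfl
    · simp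
    · simp
    · simp
    · rw [h2, if_pos rfl, if_neg h1, ha]

/-- Complex conjugation on `U(1)`. -/
def conjAut : MulAut Circle := MulEquiv.inv Circle

/-- The internal symmetry group `G = U(1) ⋊ ℤ/2`; the generator `C` of `ℤ/2` acts on `U(1)` by
complex conjugation. -/
abbrev ChargeGroup : Type :=
  Circle ⋊[involutionHom conjAut (by ext; simp [conjAut])] Multiplicative (ZMod 2)

/-- As a space, `U(1) ⋊ ℤ/2` is the product. -/
instance : TopologicalSpace ChargeGroup := .induced SemidirectProduct.equivProd inferInstance

/-- The homomorphism `U(1) ⋊ ℤ/2 → O(2)` that maps `(z, y)` to the rotation by `z²` composed with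
the `y`-th power of complex conjugation (which is applied first). -/
def chargeRep : ChargeGroup →* (ℂ ≃ₗᵢ[ℝ] ℂ) :=
  SemidirectProduct.lift (rotation.comp (powMonoidHom 2))
    (involutionHom Complex.conjLIE (by ext; simp)) (by
      intro g
      ext z
      by_cases hg : g = 1
      · subst hg
        simp
      · simp only [involutionHom, hg, conjAut, MonoidHom.coe_mk, OneHom.coe_mk, if_false,
          MonoidHom.comp_apply, MulEquiv.coe_toMonoidHom, MulEquiv.inv_apply, powMonoidHom_apply,
          MulAut.conj_apply, LinearIsometryEquiv.coe_mul, Function.comp_apply, rotation_apply,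
          Complex.conjLIE_apply, LinearIsometryEquiv.coe_inv, Complex.conjLIE_symm, map_mul,
          Complex.conj_conj, inv_pow, Circle.coe_inv_eq_conj])

/-- The central subgroup of order two generated by `(-1, (-1)^F)`, where `(-1)^F = (-1, 1)` in
`U(1) ⋊ ℤ/2`. -/
def parity (d : ℕ) : Subgroup (Spin d × ChargeGroup) where
  carrier := {p | (p.1.1 = 1 ∧ p.2 = 1) ∨ (p.1.1 = -1 ∧ p.2 = SemidirectProduct.inl (-1))}
  one_mem' := Or.inl ⟨rfl, rfl⟩
  mul_mem' {p q} hp hq := by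
    have hc : (SemidirectProduct.inl (-1) * SemidirectProduct.inl (-1) : ChargeGroup) = 1 := by
      rw [← map_mul]
      simp
    rcases hp with ⟨h1, h2⟩ | ⟨h1, h2⟩ <;> rcases hq with ⟨h3, h4⟩ | ⟨h3, h4⟩
    · exact Or.inl ⟨by simp [h1, h3], by simp [h2, h4]⟩
    · exact Or.inr ⟨by simp [h1, h3], by simp [h2, h4]⟩
    · exact Or.inr ⟨by simp [h1, h3], by simp [h2, h4]⟩
    · exact Or.inl ⟨by simp [h1, h3], by simp [h2, h4, hc]⟩
  inv_mem' {p} hp := by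
    have hc : (SemidirectProduct.inl (-1) : ChargeGroup)⁻¹ = SemidirectProduct.inl (-1) := by
      rw [← map_inv]
      simp
    rcases hp with ⟨h1, h2⟩ | ⟨h1, h2⟩
    · exact Or.inl ⟨by change star p.1.1 = 1; simp [h1], by simp [h2]⟩
    · exact Or.inr ⟨by change star p.1.1 = -1; simp [h1], by simp [h2, hc]⟩

instance (d : ℕ) : (parity d).Normal where
  conj_mem p hp q := by
    have hx : q.1.1 * (q.1⁻¹).1 = 1 := congrArg Subtype.val (mul_inv_cancel q.1)
    rcases hp with ⟨h1, h2⟩ | ⟨h1, h2⟩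
    · exact Or.inl ⟨by simp [h1, hx], by simp [h2]⟩
    · refine Or.inr ⟨by simp [h1, hx], ?_⟩
      change q.2 * p.2 * q.2⁻¹ = _
      rw [h2, mul_inv_eq_iff_eq_mul]
      refine SemidirectProduct.ext ?_ (by simp)
      have hq : ∀ c, involutionHom conjAut (by ext; simp [conjAut]) c (-1) = -1 := by
        intro c
        change (if c = 1 then (1 : MulAut Circle) else conjAut) (-1) = -1
        split_ifs
        · rfl
        · simp [conjAut]
      simp [hq]

/-- The space-time structure group `H_d = (Spin(d) × (U(1) ⋊ ℤ/2)) / (ℤ/2)^F`. -/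
abbrev HGroup (d : ℕ) : Type := (Spin d × ChargeGroup) ⧸ parity d

/-- The representation `ρ : H_d → O(d)`, `[x, g] ↦ (v ↦ x v x⁻¹)`. -/
def HGroup.rho (d : ℕ) :
    HGroup d →* (EuclideanSpace ℝ (Fin d) ≃ₗᵢ[ℝ] EuclideanSpace ℝ (Fin d)) :=
  QuotientGroup.lift (parity d) ((spinRep d).comp (MonoidHom.fst _ _)) (by
    rintro ⟨x, g⟩ hx
    ext1 v
    apply ι_normSqForm_injective
    have hxi : (x⁻¹).1 = star x.1 := rfl
    change ι _ (spinAct x v) = ι _ v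
    rw [ι_spinAct, hxi]
    rcases hx with ⟨h1, -⟩ | ⟨h1, -⟩
    · dsimp only at h1
      simp [h1]
    · dsimp only at h1
      simp [h1])

/-- The representation `H_d → O(2)`, `[x, (z, y)] ↦ (z², y)`. -/
def HGroup.tau (d : ℕ) : HGroup d →* (ℂ ≃ₗᵢ[ℝ] ℂ) :=
  QuotientGroup.lift (parity d) (chargeRep.comp (MonoidHom.snd _ _)) (by
    rintro ⟨x, g⟩ hx
    rcases hx with ⟨-, h2⟩ | ⟨-, h2⟩
    · dsimp only at h2
      simp [h2]
    · dsimp only at h2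
      simp [h2, chargeRep])

open Bundle Manifold

/-- An `H_d`-structure on a `d`-manifold `M` with associated plane bundle `E`: a principal
`H_d`-bundle `P → M` together with isomorphisms `P ×_ρ ℝ^d ≅ TM` and `P ×_τ ℝ² ≅ E`
(where `ℝ² = ℂ`), which are given here by the frames `ℝ^d ≅ T_xM` and `ℝ² ≅ E_x` that belong to
the points `p` of `P` over `x`. -/
structure HStructure (d : ℕ) (M : Type) [TopologicalSpace M]
    [ChartedSpace (EuclideanSpace ℝ (Fin d)) M] [IsManifold (𝓡 d) ∞ M]
    (F : Type) [NormedAddCommGroup F] [NormedSpace ℝ F] (E : M → Type)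
    [∀ x, AddCommMonoid (E x)] [∀ x, Module ℝ (E x)] [TopologicalSpace (TotalSpace F E)]
    [∀ x, TopologicalSpace (E x)] [FiberBundle F E] [VectorBundle ℝ F E] where
  /-- The total space of the principal bundle. -/
  P : Type
  [topologicalSpace : TopologicalSpace P]
  /-- The right action of `H_d`. -/
  [action : MulAction (HGroup d)ᵐᵒᵖ P]
  proj : P → M
  continuous_proj : Continuous proj
  /-- Local triviality; in particular `H_d` acts simply transitively on the fibres. -/
  locally_trivial : ∀ x : M, ∃ U : Set M, IsOpen U ∧ x ∈ U ∧
    ∃ φ : U × HGroup d ≃ₜ proj ⁻¹' U,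
      (∀ u h, proj (φ (u, h)) = u) ∧
      ∀ u h k, (φ (u, h * k) : P) = MulOpposite.op k • (φ (u, h) : P)
  tangentFrame : ∀ p : P, EuclideanSpace ℝ (Fin d) ≃ₗ[ℝ] TangentSpace (𝓡 d) (proj p)
  continuous_tangentFrame : Continuous fun q : P × EuclideanSpace ℝ (Fin d) =>
    (⟨proj q.1, tangentFrame q.1 q.2⟩ : TangentBundle (𝓡 d) M)
  tangentFrame_smul : ∀ (p : P) (h : HGroup d) (v : EuclideanSpace ℝ (Fin d)),
    (⟨proj (MulOpposite.op h • p), tangentFrame (MulOpposite.op h • p) v⟩ : TangentBundle (𝓡 d) M) =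
      ⟨proj p, tangentFrame p (HGroup.rho d h v)⟩
  chargeFrame : ∀ p : P, ℂ ≃ₗ[ℝ] E (proj p)
  continuous_chargeFrame : Continuous fun q : P × ℂ =>
    (⟨proj q.1, chargeFrame q.1 q.2⟩ : TotalSpace F E)
  chargeFrame_smul : ∀ (p : P) (h : HGroup d) (v : ℂ),
    (⟨proj (MulOpposite.op h • p), chargeFrame (MulOpposite.op h • p) v⟩ : TotalSpace F E) =
      ⟨proj p, chargeFrame p (HGroup.tau d h v)⟩

/-- The partition function `Z(M, E) = (-1)^{∫_M w₁(E)³}` of a closed `3`-manifold `M` with an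
`H_3`-structure with associated plane bundle `E`. -/
def HStructure.partitionFunction {M : Type} [TopologicalSpace M]
    [ChartedSpace (EuclideanSpace ℝ (Fin 3)) M] [IsManifold (𝓡 3) ∞ M]
    {F : Type} [NormedAddCommGroup F] [NormedSpace ℝ F] {E : M → Type}
    [∀ x, AddCommMonoid (E x)] [∀ x, Module ℝ (E x)] [TopologicalSpace (TotalSpace F E)]
    [∀ x, TopologicalSpace (E x)] [FiberBundle F E] [VectorBundle ℝ F E]
    (_ : HStructure 3 M F E) : ℂ :=
  (-1) ^ (ModTwo.integral (ModTwo.cube (ModTwo.w₁ F E))).val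

end StructureGroup

open Bundle in
/-- The plane bundle `γ ⊕ ℝ` over `ℝP^3`. -/
abbrev tautPlusTrivial : RP 3 → Type := RP.Taut 3 ×ᵇ Trivial (RP 3) ℝ

open Bundle in
/-- The trivial plane bundle over `ℝP^3`. -/
abbrev trivialPlane : RP 3 → Type := Trivial (RP 3) (EuclideanSpace ℝ (Fin 2))

end

noncomputable section

/-! ### Barycentric subdivision of cochains on tuples of points of a simplex -/

namespace ModTwo

/-! Topological input. Along a singular simplex of `ℝP^n` the canonical line bundle has a nowhere
zero section, because the simplex lifts to `ℝ^{n+1} ∖ {0}` (`RP.exists_lift`). Hence the orientation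
cochain of a path is computed from the two ends of a lift (`RP.tautCocycle_apply`). It is a cocycle
whose class does not depend on the chosen orientations, and adding a trivial line changes no
determinant, so `w₁(γ ⊕ ℝ) = w₁(γ)`.

Nonvanishing of the cube. The boundary of the cross-polytope triangulates `S³`. Modulo the antipode
its facets give eight singular simplices `t ↦ [±t₀, …, ±t₃]` of `ℝP³` whose sum is a cycle `c`
modulo `2`, and the cube of the orientation cocycle takes the value `1` on `c` (`RP.exists_cycle`).

Fundamental class. A point `x` is the intersection of three hyperplanes, and `γ` is trivial off a
hyperplane. So `w₁(γ)³` is represented by a product of three cocycles, each vanishing off one of the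
hyperplanes. On `ℝP³ ∖ {x}` this product vanishes on small simplices, hence by barycentric
subdivision (`ModTwo.exists_coboundary_of_small`) it can be corrected to a cocycle vanishing on `ℝP³
∖ {x}`. A homology class on which `w₁(γ)³` is nonzero therefore restricts nontrivially at every
point (`RP.isFundamentalClass_of_tautCube`).

Uniqueness needs `dim H³(ℝP³) ≤ 1`. The Čech–singular double complex of the four affine open sets
gives this: finite intersections have star-shaped components, so a `3`-cocycle is carried to a
function on the eight sign patterns of the fourfold intersection. If the sum of its values is zero,
the function is a Čech coboundary and the cocycle is a coboundary (`RP.Zigzag.mem_coboundaries`).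
Thus two classes that are not coboundaries have a sum that is one (`RP.add_mem_coboundaries`), and
every nonzero class of `H₃` pairs to `1` with `w₁(γ)³`.

`H`-structures. Quaternion multiplication parallelizes `ℝP³`. The element `a = [1, (i, C)]` of `H_3`
satisfies `a² = 1`, `ρ(a) = 1` and `τ(a)(z) = -z̄`. The principal bundle obtained from the double
covering `S³ → ℝP³` by sending the deck transformation to `a` thus has trivial associated tangent
data and associated plane bundle `γ ⊕ ℝ`; taking `a = 1` gives the trivial plane bundle
(`RP.twistedStructure`). `Z` depends only on `w₁(E)`, so its value is the same for every structure
with a given `E`. -/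

lemma zmodTwo_add_self (a : ZMod 2) : a + a = 0 := CharTwo.add_self_eq_zero a

/-- The standard topological `n`-simplex. -/
abbrev Simp (n : ℕ) : Type := stdSimplex ℝ (Fin (n + 1))

/-- The affine map of simplices with given values at the vertices. -/
def aff {m n : ℕ} (v : Fin (m + 1) → Simp n) : C(Simp m, Simp n) where
  toFun t := ⟨∑ j, t j • (v j).1, (convex_stdSimplex ℝ _).sum_mem (fun j _ => t.2.1 j) t.2.2
    fun j _ => (v j).2⟩
  continuous_toFun := by
    refine Continuous.subtype_mk ?_ _
    refine continuous_finsetSum _ fun j _ => ?_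
    exact ((continuous_apply j).comp continuous_subtype_val).smul continuous_const

lemma aff_coe {m n : ℕ} (v : Fin (m + 1) → Simp n) (t : Simp m) :
    (aff v t).1 = ∑ j, t j • (v j).1 := rfl

lemma aff_vertex {m n : ℕ} (v : Fin (m + 1) → Simp n) (j : Fin (m + 1)) :
    aff v (stdSimplex.vertex j) = v j := by
  apply Subtype.ext
  rw [aff_coe, Finset.sum_eq_single j]
  · simp
  · intro k _ hk
    simp [hk]
  · simp

lemma aff_aff {l m n : ℕ} (v : Fin (m + 1) → Simp n) (w : Fin (l + 1) → Simp m) (t : Simp l) :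
    aff v (aff w t) = aff (fun j => aff v (w j)) t := by
  apply Subtype.ext
  have h : ∀ j, (aff w t) j = ∑ k, t k * (w k) j := by
    intro j
    change (aff w t).1 j = _
    rw [aff_coe, Finset.sum_apply]
    rfl
  simp only [aff_coe, h, Finset.sum_smul, Finset.smul_sum, mul_smul]
  rw [Finset.sum_comm]

lemma aff_vertex_eq {n : ℕ} (t : Simp n) : aff stdSimplex.vertex t = t := by
  apply Subtype.ext
  rw [aff_coe]
  ext i
  rw [Finset.sum_apply, Finset.sum_eq_single i]
  · simp
    rfl
  · intro k _ hk
    simp [hk.symm]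
  · simp

lemma aff_vertex_comp {m n : ℕ} (f : Fin (m + 1) → Fin (n + 1)) (t : Simp m) :
    aff (fun j => stdSimplex.vertex (f j)) t = stdSimplex.map f t := by
  apply Subtype.ext
  rw [aff_coe]
  ext i
  change _ = (FunOnFinite.linearMap ℝ ℝ f t.1) i
  rw [FunOnFinite.linearMap_apply_apply, Finset.sum_apply, Finset.sum_filter]
  refine Finset.sum_congr rfl fun j _ => ?_
  by_cases h : f j = i
  · simp [h]; rfl
  · simp [h, Ne.symm h]

/-- The barycenter of a tuple. -/
def bary {m n : ℕ} (v : Fin (m + 1) → Simp n) : Simp n := aff v stdSimplex.barycenter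

lemma aff_bary {l m n : ℕ} (v : Fin (m + 1) → Simp n) (w : Fin (l + 1) → Simp m) :
    aff v (bary w) = bary (fun j => aff v (w j)) := aff_aff v w _

/-- Cochains on tuples of points of the simplex. -/
abbrev TupleCochain (n m : ℕ) : Type := (Fin (m + 1) → Simp n) → ZMod 2

variable {n : ℕ}

/-- The coboundary of a cochain on tuples. -/
def tupleδ {m : ℕ} (φ : TupleCochain n m) : TupleCochain n (m + 1) :=
  fun v => ∑ i : Fin (m + 2), φ (fun j => v (i.succAbove j))

/-- The evaluation on cones with vertex `b`. -/
def tupleCone {m : ℕ} (b : Simp n) (φ : TupleCochain n (m + 1)) : TupleCochain n m :=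
  fun w => φ (Fin.cons b w)

/-- The dual of the barycentric subdivision. -/
def sdC : ∀ m : ℕ, TupleCochain n m → TupleCochain n m
  | 0, φ => φ
  -- Dual to `Sd v = b · Sd(∂v)`, where `b` is the barycenter of `v` and the cone puts `b` in front.
  | m + 1, φ => fun v => ∑ i : Fin (m + 2), sdC m (tupleCone (bary v) φ) (fun j => v (i.succAbove j))

/-- The dual of the chain homotopy between the barycentric subdivision and the identity. -/
def htC : ∀ m : ℕ, TupleCochain n (m + 1) → TupleCochain n m
  | 0, φ => fun v => φ (Fin.cons (bary v) v)
  -- Dual to `T v = b · (v + T ∂v)`.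
  | m + 1, φ => fun v => φ (Fin.cons (bary v) v) +
      ∑ i : Fin (m + 2), htC m (tupleCone (bary v) φ) (fun j => v (i.succAbove j))

lemma tupleCone_add {m : ℕ} (b : Simp n) (φ ψ : TupleCochain n (m + 1)) :
    tupleCone b (φ + ψ) = tupleCone b φ + tupleCone b ψ := rfl

lemma sdC_zero (φ : TupleCochain n 0) : sdC 0 φ = φ := rfl

lemma sdC_succ {m : ℕ} (φ : TupleCochain n (m + 1)) (v : Fin (m + 2) → Simp n) :
    sdC (m + 1) φ v =
      ∑ i : Fin (m + 2), sdC m (tupleCone (bary v) φ) (fun j => v (i.succAbove j)) := rfl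

lemma htC_succ {m : ℕ} (φ : TupleCochain n (m + 2)) (v : Fin (m + 2) → Simp n) :
    htC (m + 1) φ v = tupleCone (bary v) φ v +
      ∑ i : Fin (m + 2), htC m (tupleCone (bary v) φ) (fun j => v (i.succAbove j)) := rfl

lemma tupleδ_apply {m : ℕ} (φ : TupleCochain n m) (v : Fin (m + 2) → Simp n) :
    tupleδ φ v = ∑ i : Fin (m + 2), φ (fun j => v (i.succAbove j)) := rfl

lemma sdC_add {m : ℕ} (φ ψ : TupleCochain n m) : sdC m (φ + ψ) = sdC m φ + sdC m ψ := by
  induction m with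
  | zero => rfl
  | succ m ih =>
    funext v
    simp only [sdC_succ, tupleCone_add, ih, Pi.add_apply, Finset.sum_add_distrib]

lemma htC_add {m : ℕ} (φ ψ : TupleCochain n (m + 1)) : htC m (φ + ψ) = htC m φ + htC m ψ := by
  induction m with
  | zero => rfl
  | succ m ih =>
    funext v
    simp only [htC_succ, tupleCone_add, ih, Pi.add_apply, Finset.sum_add_distrib]
    exact add_add_add_comm _ _ _ _

lemma tupleδ_tupleδ {m : ℕ} (φ : TupleCochain n m) : tupleδ (tupleδ φ) = 0 := by
  funext v
  simp only [tupleδ, Pi.zero_apply]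
  rw [← Finset.sum_product']
  -- The two orders in which the same two entries can be deleted cancel in pairs.
  refine Finset.sum_involution
    (fun p _ => (p.1.succAbove p.2, p.2.predAbove p.1)) ?_ ?_ ?_ ?_
  · rintro ⟨i, j⟩ -
    have : (fun k => v (i.succAbove (j.succAbove k))) =
        fun k => v ((i.succAbove j).succAbove ((j.predAbove i).succAbove k)) := by
      funext k
      rw [Fin.succAbove_succAbove_succAbove_predAbove]
    rw [this]
    exact zmodTwo_add_self _
  · rintro ⟨i, j⟩ - -
    simp
  · simp
  · rintro ⟨i, j⟩ -
    simp [Fin.succAbove_succAbove_predAbove, Fin.predAbove_predAbove_succAbove]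

/-- The lowest degree is exceptional: the boundary of a cone over a point contains the apex, `∂(b·w)
= w + b`. -/
lemma tupleCone_tupleδ_zero (b : Simp n) (φ : TupleCochain n 0) (v : Fin 1 → Simp n) :
    tupleCone b (tupleδ φ) v = φ v + φ (fun _ => b) := by
  change ∑ i : Fin 2, φ (fun j => (Fin.cons b v : Fin 2 → Simp n) (i.succAbove j)) = _
  rw [Fin.sum_univ_two]
  congr 2
  funext j
  fin_cases j
  simp

/-- Dual to `∂(b·w) = w + b·∂w`, the identity behind all inductions on `sdC` and `htC`. -/
lemma tupleCone_tupleδ {m : ℕ} (b : Simp n) (φ : TupleCochain n (m + 1)) :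
    tupleCone b (tupleδ φ) = φ + tupleδ (tupleCone b φ) := by
  funext v
  simp only [tupleCone, tupleδ, Pi.add_apply]
  rw [Fin.sum_univ_succ]
  congr 1
  refine Finset.sum_congr rfl fun i _ => congrArg φ ?_
  funext j
  refine Fin.cases ?_ (fun j => ?_) j <;> simp

/-- Dual to `∂ Sd = Sd ∂`. The boundary of `b · Sd(∂v)` is `Sd(∂v)` plus a cone over `Sd(∂∂v) = 0`;
in the lowest degree the apex occurs twice and cancels. -/
lemma sdC_tupleδ {m : ℕ} (φ : TupleCochain n m) :
    sdC (m + 1) (tupleδ φ) = tupleδ (sdC m φ) := by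
  induction m with
  | zero =>
    funext v
    rw [sdC_succ, tupleδ_apply]
    simp only [sdC_zero, tupleCone_tupleδ_zero, Finset.sum_add_distrib]
    have h : ∑ _i : Fin (0 + 2), φ (fun _ => bary v) = 0 :=
      (Fin.sum_univ_two _).trans (zmodTwo_add_self _)
    rw [h, add_zero]
  | succ m ih =>
    funext v
    rw [sdC_succ, tupleδ_apply]
    simp only [tupleCone_tupleδ, sdC_add, ih, Pi.add_apply, Finset.sum_add_distrib]
    have h := congrFun (tupleδ_tupleδ (sdC m (tupleCone (bary v) φ))) v
    rw [tupleδ_apply] at h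
    rw [h, Pi.zero_apply, add_zero]

lemma htC_tupleδ_zero (φ : TupleCochain n 0) : htC 0 (tupleδ φ) = φ + sdC 0 φ := by
  funext v
  have h : bary v = v 0 := by
    apply Subtype.ext
    simp [bary, aff_coe]
  change tupleCone (bary v) (tupleδ φ) v = φ v + φ v
  rw [tupleCone_tupleδ_zero, h]
  congr 2
  funext j
  exact congrArg v (Fin.fin_one_eq_zero j).symm

/-- Dual to `∂T + T∂ = 1 + Sd` modulo `2`. -/
lemma htC_tupleδ {m : ℕ} (φ : TupleCochain n (m + 1)) :
    htC (m + 1) (tupleδ φ) = φ + sdC (m + 1) φ + tupleδ (htC m φ) := by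
  induction m with
  | zero =>
    funext v
    simp only [Pi.add_apply]
    rw [htC_succ, sdC_succ, tupleδ_apply (htC 0 φ)]
    simp only [tupleCone_tupleδ, htC_add, htC_tupleδ_zero, Pi.add_apply, Finset.sum_add_distrib,
      tupleδ_apply]
    exact (by decide : ∀ a b c d : ZMod 2, a + b + (c + (b + d)) = a + d + c) _ _ _ _
  | succ m ih =>
    funext v
    simp only [Pi.add_apply]
    rw [htC_succ, sdC_succ, tupleδ_apply (htC (m + 1) φ)]
    have h := congrFun (tupleδ_tupleδ (htC m (tupleCone (bary v) φ))) v
    rw [tupleδ_apply, Pi.zero_apply] at h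
    simp only [tupleCone_tupleδ, htC_add, ih, Pi.add_apply, Finset.sum_add_distrib]
    rw [h, tupleδ_apply (tupleCone (bary v) φ)]
    exact (by decide : ∀ a b c d : ZMod 2, a + b + (c + (b + d + 0)) = a + d + c) _ _ _ _

/-! ### The size of the simplices of the subdivision. -/

/-- `w` lies in the convex hull of `v`. -/
def InHull {l m : ℕ} (w : Fin (l + 1) → Simp n) (v : Fin (m + 1) → Simp n) : Prop :=
  ∀ j, (w j).1 ∈ convexHull ℝ (Set.range fun i => (v i).1)

lemma InHull.trans {k l m : ℕ} {u : Fin (k + 1) → Simp n} {w : Fin (l + 1) → Simp n}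
    {v : Fin (m + 1) → Simp n} (h : InHull u w) (h' : InHull w v) : InHull u v := fun j =>
  convexHull_min (by rintro _ ⟨i, rfl⟩; exact h' i) (convex_convexHull ℝ _) (h j)

lemma inHull_refl {m : ℕ} (v : Fin (m + 1) → Simp n) : InHull v v := fun j =>
  subset_convexHull ℝ _ ⟨j, rfl⟩

lemma inHull_comp {l m : ℕ} (v : Fin (m + 1) → Simp n) (f : Fin (l + 1) → Fin (m + 1)) :
    InHull (fun j => v (f j)) v := fun j => subset_convexHull ℝ _ ⟨f j, rfl⟩

lemma aff_mem_hull {m : ℕ} (v : Fin (m + 1) → Simp n) (t : Simp m) :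
    (aff v t).1 ∈ convexHull ℝ (Set.range fun i => (v i).1) :=
  (convex_convexHull ℝ _).sum_mem (fun j _ => t.2.1 j) t.2.2
    fun j _ => subset_convexHull ℝ _ ⟨j, rfl⟩

lemma InHull.cons_bary {l m : ℕ} {w : Fin (l + 1) → Simp n} {v : Fin (m + 1) → Simp n}
    (h : InHull w v) : InHull (Fin.cons (bary v) w : Fin (l + 2) → Simp n) v := by
  intro j
  refine Fin.cases ?_ (fun j => ?_) j
  · exact aff_mem_hull v _
  · simpa using h j

lemma dist_le_of_mem_hull {m : ℕ} {v : Fin (m + 1) → Simp n} {r : ℝ} {x : Simp n}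
    (h : ∀ i, dist (v i) x ≤ r) {y : Simp n} (hy : y.1 ∈ convexHull ℝ (Set.range fun i => (v i).1)) :
    dist y x ≤ r := by
  have : convexHull ℝ (Set.range fun i => (v i).1) ⊆ Metric.closedBall x.1 r :=
    convexHull_min (by rintro _ ⟨i, rfl⟩; exact h i) (convex_closedBall _ _)
  exact this hy

/-- The vertices of `v` are at mutual distances at most `r`. -/
def DiamLE {m : ℕ} (v : Fin (m + 1) → Simp n) (r : ℝ) : Prop := ∀ i j, dist (v i) (v j) ≤ r

lemma DiamLE.dist_aff_le {m : ℕ} {v : Fin (m + 1) → Simp n} {r : ℝ} (hv : DiamLE v r)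
    (s t : Simp m) : dist (aff v s) (aff v t) ≤ r := by
  refine dist_le_of_mem_hull (fun k => ?_) (aff_mem_hull v s)
  rw [dist_comm]
  exact dist_le_of_mem_hull (fun l => hv l k) (aff_mem_hull v t)

/-- `v j - bary v` is the mean of the `m + 1` differences `v j - v i`, one of which is zero. This is
the contraction factor of the subdivision. -/
lemma dist_bary_le {m : ℕ} {v : Fin (m + 1) → Simp n} {r : ℝ} (hv : DiamLE v r) (j : Fin (m + 1)) :
    dist (v j) (bary v) ≤ m / (m + 1) * r := by
  have hb : (bary v).1 = ∑ i, (1 / (m + 1 : ℝ)) • (v i).1 := by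
    rw [bary, aff_coe]
    refine Finset.sum_congr rfl fun i _ => ?_
    congr 1
    exact (stdSimplex.barycenter_apply i).trans (by simp)
  have hj : (v j).1 = ∑ i : Fin (m + 1), (1 / (m + 1 : ℝ)) • (v j).1 := by
    rw [← Finset.sum_smul]
    have : (m + 1 : ℝ) ≠ 0 := by positivity
    simp [this]
  have hd : dist (v j) (bary v) = ‖∑ i, (1 / (m + 1 : ℝ)) • ((v j).1 - (v i).1)‖ := by
    rw [Subtype.dist_eq, dist_eq_norm, hb]
    conv_lhs => rw [hj]
    rw [← Finset.sum_sub_distrib]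
    simp only [smul_sub]
  rw [hd, ← Finset.sum_sdiff (Finset.subset_univ {j}), Finset.sum_singleton]
  simp only [sub_self, smul_zero, add_zero]
  calc _ ≤ ∑ i ∈ Finset.univ \ {j}, (1 / (m + 1 : ℝ)) * r := by
        refine norm_sum_le_of_le _ fun i _ => ?_
        rw [norm_smul, Real.norm_of_nonneg (by positivity)]
        gcongr
        rw [← dist_eq_norm]
        exact hv j i
    _ = m / (m + 1) * r := by
        rw [Finset.sum_const, Finset.card_sdiff_of_subset (by simp)]
        simp
        ring

/-- A cochain on tuples that vanishes on small tuples in the hull of `v` has a subdivision that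
vanishes at `v`. -/
lemma sdC_eq_zero : ∀ {m : ℕ} {φ : TupleCochain n m} {v : Fin (m + 1) → Simp n} {r : ℝ},
    DiamLE v r → (∀ w, InHull w v → DiamLE w (m / (m + 1) * r) → φ w = 0) → sdC m φ v = 0
  | 0, φ, v, r, hv, h => by
    refine h v (inHull_refl v) fun i j => ?_
    rw [Fin.fin_one_eq_zero i, Fin.fin_one_eq_zero j]
    simp
  | m + 1, φ, v, r, hv, h => by
    refine Finset.sum_eq_zero fun i _ => ?_
    have hr : 0 ≤ r := dist_nonneg.trans (hv 0 0)
    refine sdC_eq_zero (r := r) (fun k l => hv _ _) fun w hw hd => ?_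
    have hw' : InHull w v := hw.trans (inHull_comp v _)
    -- Distances to the apex are bounded by the factor of `v` itself; those inside the base come
    -- from the induction over the face.
    have hb : ∀ k, dist (w k) (bary v) ≤ ((m + 1 : ℕ) : ℝ) / ((m + 1 : ℕ) + 1) * r := fun k =>
      dist_le_of_mem_hull (dist_bary_le hv) (hw' k)
    refine h _ hw'.cons_bary fun k l => ?_
    refine Fin.cases ?_ (fun k => ?_) k <;> refine Fin.cases ?_ (fun l => ?_) l
    · simp only [Fin.cons_zero, dist_self]
      positivity
    · simp only [Fin.cons_zero, Fin.cons_succ]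
      rw [dist_comm]
      exact hb l
    · simp only [Fin.cons_zero, Fin.cons_succ]
      exact hb k
    · simp only [Fin.cons_succ]
      refine (hd k l).trans ?_
      -- The factor `m/(m+1)` of the face is at most the factor `(m+1)/(m+2)` of the whole simplex.
      refine mul_le_mul_of_nonneg_right ?_ hr
      rw [div_le_div_iff₀ (by positivity) (by positivity)]
      push_cast
      nlinarith

lemma htC_eq_zero : ∀ {m : ℕ} {φ : TupleCochain n (m + 1)} {v : Fin (m + 1) → Simp n},
    (∀ w, InHull w v → φ w = 0) → htC m φ v = 0
  | 0, φ, v, h => h _ (inHull_refl v).cons_bary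
  | m + 1, φ, v, h => by
    have h1 : φ (Fin.cons (bary v) v) = 0 := h _ (inHull_refl v).cons_bary
    refine (congrArg (· + _) h1).trans ((zero_add _).trans ?_)
    refine Finset.sum_eq_zero fun i _ => htC_eq_zero fun w hw => ?_
    exact h _ (hw.trans (inHull_comp v _)).cons_bary

/-- Affine maps preserve barycenters, so the subdivision of tuples is natural and passes to singular
simplices. -/
lemma sdC_comp_aff {k : ℕ} (u : Fin (k + 1) → Simp n) : ∀ {m : ℕ} (φ : TupleCochain n m)
    (v : Fin (m + 1) → Simp k),
    sdC m (fun w => φ fun j => aff u (w j)) v = sdC m φ fun j => aff u (v j)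
  | 0, _, _ => rfl
  | m + 1, φ, v => by
    refine Finset.sum_congr rfl fun i _ => ?_
    rw [← sdC_comp_aff u (tupleCone _ φ)]
    congr 1
    funext w
    refine congrArg φ (funext fun j => ?_)
    refine Fin.cases ?_ (fun j => ?_) j
    · simp [aff_bary]
    · simp

lemma htC_comp_aff {k : ℕ} (u : Fin (k + 1) → Simp n) : ∀ {m : ℕ} (φ : TupleCochain n (m + 1))
    (v : Fin (m + 1) → Simp k),
    htC m (fun w => φ fun j => aff u (w j)) v = htC m φ fun j => aff u (v j) := by
  have hc : ∀ {m : ℕ} (v : Fin (m + 1) → Simp k) {l : ℕ} (w : Fin (l + 1) → Simp k),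
      (fun j => aff u ((Fin.cons (bary v) w : Fin (l + 2) → Simp k) j)) =
        Fin.cons (bary fun j => aff u (v j)) fun j => aff u (w j) := by
    intro m v l w
    funext j
    refine Fin.cases ?_ (fun j => ?_) j
    · simp [aff_bary]
    · simp
  intro m
  induction m with
  | zero => intro φ v; exact congrArg φ (hc v v)
  | succ m ih =>
    intro φ v
    refine congrArg₂ (· + ·) (congrArg φ (hc v v)) (Finset.sum_congr rfl fun i _ => ?_)
    rw [← ih (tupleCone _ φ)]
    congr 1
    funext w
    exact congrArg φ (hc v w)

end ModTwo

end

noncomputable section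

/-! ### Small simplices -/

namespace ModTwo

open CategoryTheory Simplicial

section Pull

variable {X : Type} [TopologicalSpace X]

/-- The singular simplex that is given by a continuous map. -/
def ofMap {n : ℕ} (f : C(Simp n, X)) : (sing X) _⦋n⦌ :=
  (TopCat.toSSetObjEquiv (TopCat.of X) (.op ⦋n⦌)).symm f

lemma toMap_ofMap {n : ℕ} (f : C(Simp n, X)) : toMap (ofMap f) = f :=
  (TopCat.toSSetObjEquiv (TopCat.of X) (.op ⦋n⦌)).apply_symm_apply f

lemma toMap_injective {n : ℕ} : Function.Injective (toMap (X := X) (n := n)) :=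
  (TopCat.toSSetObjEquiv (TopCat.of X) (.op ⦋n⦌)).injective

lemma toMap_map {m n : ℕ} (f : ⦋m⦌ ⟶ ⦋n⦌) (σ : (sing X) _⦋n⦌) (t : Simp m) :
    toMap ((sing X).map f.op σ) t = toMap σ (stdSimplex.map f.toOrderHom t) := rfl

/-- The restriction of a singular simplex to an affine simplex in its domain. -/
def pull {m n : ℕ} (σ : (sing X) _⦋n⦌) (v : Fin (m + 1) → Simp n) : (sing X) _⦋m⦌ :=
  ofMap ((toMap σ).comp (aff v))

lemma toMap_pull {m n : ℕ} (σ : (sing X) _⦋n⦌) (v : Fin (m + 1) → Simp n) (t : Simp m) :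
    toMap (pull σ v) t = toMap σ (aff v t) := by
  rw [pull, toMap_ofMap]
  rfl

lemma pull_vertex {n : ℕ} (σ : (sing X) _⦋n⦌) : pull σ stdSimplex.vertex = σ := by
  refine toMap_injective (ContinuousMap.ext fun t => ?_)
  rw [toMap_pull, aff_vertex_eq]

lemma pull_pull {l m n : ℕ} (σ : (sing X) _⦋n⦌) (v : Fin (m + 1) → Simp n)
    (w : Fin (l + 1) → Simp m) : pull (pull σ v) w = pull σ fun j => aff v (w j) := by
  refine toMap_injective (ContinuousMap.ext fun t => ?_)
  rw [toMap_pull, toMap_pull, toMap_pull, aff_aff]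

lemma map_eq_pull {m n : ℕ} (f : ⦋m⦌ ⟶ ⦋n⦌) (σ : (sing X) _⦋n⦌) :
    (sing X).map f.op σ = pull σ fun j => stdSimplex.vertex (f.toOrderHom j) := by
  refine toMap_injective (ContinuousMap.ext fun t => ?_)
  rw [toMap_pull, toMap_map, aff_vertex_comp (fun j => f.toOrderHom j)]

lemma δ_eq_pull {n : ℕ} (i : Fin (n + 2)) (σ : (sing X) _⦋n + 1⦌) :
    (sing X).δ i σ = pull σ fun j => stdSimplex.vertex (i.succAbove j) := map_eq_pull _ σ

lemma δ_pull {m n : ℕ} (σ : (sing X) _⦋n⦌) (v : Fin (m + 2) → Simp n) (i : Fin (m + 2)) :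
    (sing X).δ i (pull σ v) = pull σ fun j => v (i.succAbove j) := by
  rw [δ_eq_pull, pull_pull]
  simp only [aff_vertex]

/-- The simplex `σ` lies in `A`. -/
def InSet (A : Set X) {n : ℕ} (σ : (sing X) _⦋n⦌) : Prop := ∀ t, toMap σ t ∈ A

lemma InSet.pull {A : Set X} {m n : ℕ} {σ : (sing X) _⦋n⦌} (h : InSet A σ)
    (v : Fin (m + 1) → Simp n) : InSet A (pull σ v) := fun t => by
  rw [toMap_pull]
  exact h _

lemma InSet.δ {A : Set X} {n : ℕ} {σ : (sing X) _⦋n + 1⦌} (h : InSet A σ)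
    (i : Fin (n + 2)) : InSet A ((sing X).δ i σ) := by
  rw [δ_eq_pull]
  exact h.pull _

lemma InSet.mono {A B : Set X} {n : ℕ} {σ : (sing X) _⦋n⦌} (h : InSet A σ) (hAB : A ⊆ B) :
    InSet B σ := fun t => hAB (h t)

lemma coboundary_apply {n : ℕ} (φ : Cochain (sing X) n) (σ : (sing X) _⦋n + 1⦌) :
    coboundary (sing X) n φ σ = ∑ i : Fin (n + 2), φ ((sing X).δ i σ) := rfl

lemma coboundary_congr {A : Set X} {n : ℕ} {φ ψ : Cochain (sing X) n}
    (h : ∀ σ, InSet A σ → φ σ = ψ σ) {σ : (sing X) _⦋n + 1⦌} (hσ : InSet A σ) :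
    coboundary (sing X) n φ σ = coboundary (sing X) n ψ σ := by
  rw [coboundary_apply, coboundary_apply]
  exact Finset.sum_congr rfl fun i _ => h _ (hσ.δ i)

/-- The cochain on tuples of points of the domain of `σ` that is induced by a singular cochain. -/
def onTuples {m n : ℕ} (σ : (sing X) _⦋n⦌) (φ : Cochain (sing X) m) : TupleCochain n m :=
  fun v => φ (pull σ v)

lemma onTuples_vertex {n : ℕ} (σ : (sing X) _⦋n⦌) (φ : Cochain (sing X) n) :
    onTuples σ φ stdSimplex.vertex = φ σ := by
  rw [onTuples, pull_vertex]

lemma onTuples_pull {k m n : ℕ} (σ : (sing X) _⦋n⦌) (v : Fin (k + 1) → Simp n)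
    (φ : Cochain (sing X) m) :
    onTuples (pull σ v) φ = fun w => onTuples σ φ fun j => aff v (w j) := by
  funext w
  rw [onTuples, pull_pull, onTuples]

lemma onTuples_coboundary {m n : ℕ} (σ : (sing X) _⦋n⦌) (φ : Cochain (sing X) m) :
    onTuples σ (coboundary (sing X) m φ) = tupleδ (onTuples σ φ) := by
  funext v
  simp only [onTuples, coboundary_apply, tupleδ_apply, δ_pull]

/-- The dual of the barycentric subdivision of singular chains. -/
def sdCochain {m : ℕ} (φ : Cochain (sing X) m) : Cochain (sing X) m :=
  fun σ => sdC m (onTuples σ φ) stdSimplex.vertex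

/-- The dual of the chain homotopy between the barycentric subdivision and the identity. -/
def htCochain {m : ℕ} (φ : Cochain (sing X) (m + 1)) : Cochain (sing X) m :=
  fun σ => htC m (onTuples σ φ) stdSimplex.vertex

/-- Iterated subdivision of a singular cochain can thereby be studied on tuples inside one fixed
simplex, where diameters are under control. -/
lemma onTuples_sdCochain {m n : ℕ} (σ : (sing X) _⦋n⦌) (φ : Cochain (sing X) m) :
    onTuples σ (sdCochain φ) = sdC m (onTuples σ φ) := by
  funext v
  rw [onTuples, sdCochain, onTuples_pull, sdC_comp_aff]
  simp only [aff_vertex]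

lemma onTuples_htCochain {m n : ℕ} (σ : (sing X) _⦋n⦌) (φ : Cochain (sing X) (m + 1)) :
    onTuples σ (htCochain φ) = htC m (onTuples σ φ) := by
  funext v
  rw [onTuples, htCochain, onTuples_pull, htC_comp_aff]
  simp only [aff_vertex]

lemma onTuples_iterate {m n : ℕ} (σ : (sing X) _⦋n⦌) (φ : Cochain (sing X) m) (k : ℕ) :
    onTuples σ (sdCochain^[k] φ) = (sdC m)^[k] (onTuples σ φ) := by
  induction k with
  | zero => rfl
  | succ k ih => rw [Function.iterate_succ_apply', Function.iterate_succ_apply', ← ih,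
      onTuples_sdCochain]

lemma coboundary_sdCochain {m : ℕ} (φ : Cochain (sing X) m) :
    coboundary (sing X) m (sdCochain φ) = sdCochain (coboundary (sing X) m φ) := by
  funext σ
  rw [← onTuples_vertex σ (coboundary _ _ _), ← onTuples_vertex σ (sdCochain _),
    onTuples_coboundary, onTuples_sdCochain, onTuples_sdCochain, onTuples_coboundary, sdC_tupleδ]

lemma coboundary_iterate {m : ℕ} (φ : Cochain (sing X) m) (k : ℕ) :
    coboundary (sing X) m (sdCochain^[k] φ) = sdCochain^[k] (coboundary (sing X) m φ) := by
  induction k with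
  | zero => rfl
  | succ k ih => rw [Function.iterate_succ_apply', Function.iterate_succ_apply',
      coboundary_sdCochain, ih]

lemma sdCochain_add {m : ℕ} (φ ψ : Cochain (sing X) m) :
    sdCochain (φ + ψ) = sdCochain φ + sdCochain ψ := by
  funext σ
  exact congrFun (sdC_add (onTuples σ φ) (onTuples σ ψ)) _

lemma iterate_sdCochain_add {m : ℕ} (φ ψ : Cochain (sing X) m) (k : ℕ) :
    sdCochain^[k] (φ + ψ) = sdCochain^[k] φ + sdCochain^[k] ψ := by
  induction k with
  | zero => rfl
  | succ k ih => simp only [Function.iterate_succ_apply', ih, sdCochain_add]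

lemma coboundary_htCochain {m : ℕ} (φ : Cochain (sing X) (m + 1)) :
    coboundary (sing X) m (htCochain φ) =
      φ + sdCochain φ + htCochain (coboundary (sing X) (m + 1) φ) := by
  funext σ
  have h := congrFun (htC_tupleδ (onTuples σ φ)) stdSimplex.vertex
  rw [← onTuples_coboundary, ← onTuples_htCochain, ← onTuples_htCochain, ← onTuples_sdCochain,
    ← onTuples_coboundary, onTuples_vertex] at h
  simp only [Pi.add_apply, onTuples_vertex] at h ⊢
  rw [h]
  exact (by decide : ∀ a b c : ZMod 2, c = a + b + (a + b + c)) _ _ _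

lemma dist_simp_le_one {n : ℕ} (x y : Simp n) : dist x y ≤ 1 := by
  refine (dist_pi_le_iff zero_le_one).mpr fun i => ?_
  exact (Real.dist_le_of_mem_Icc_01 (mem_Icc_of_mem_stdSimplex x.2 i)
    (mem_Icc_of_mem_stdSimplex y.2 i))

lemma iterate_sdCochain_eq_zero {A : Set X} {m : ℕ} {φ : Cochain (sing X) m}
    (h : ∀ σ, InSet A σ → φ σ = 0) (k : ℕ) {σ : (sing X) _⦋m⦌} (hσ : InSet A σ) :
    sdCochain^[k] φ σ = 0 := by
  induction k generalizing σ with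
  | zero => exact h σ hσ
  | succ k ih =>
    rw [Function.iterate_succ_apply']
    exact sdC_eq_zero (r := 1) (fun i j => dist_simp_le_one _ _) fun w _ _ => ih (hσ.pull w)

lemma htCochain_eq_zero {A : Set X} {m : ℕ} {φ : Cochain (sing X) (m + 1)}
    (h : ∀ σ, InSet A σ → φ σ = 0) {σ : (sing X) _⦋m⦌} (hσ : InSet A σ) :
    htCochain φ σ = 0 := htC_eq_zero fun w _ => h _ (hσ.pull w)

lemma iterate_sdC_eq_zero {m n : ℕ} {φ : TupleCochain n m} {r : ℝ}
    (h : ∀ w, DiamLE w r → φ w = 0) (k : ℕ) {R : ℝ} (hR : (m / (m + 1) : ℝ) ^ k * R ≤ r)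
    {v : Fin (m + 1) → Simp n} (hv : DiamLE v R) : (sdC m)^[k] φ v = 0 := by
  induction k generalizing R v with
  | zero => exact h v fun i j => (hv i j).trans (by simpa using hR)
  | succ k ih =>
    rw [Function.iterate_succ_apply']
    refine sdC_eq_zero hv fun w _ hw => ih ?_ hw
    rwa [← mul_assoc, ← pow_succ]

/-- A cochain that vanishes on the small simplices vanishes on a sufficiently fine subdivision. -/
lemma exists_iterate_sdCochain_eq_zero {A : Set X} {ι : Type} {U : ι → Set X}
    (hU : ∀ i, IsOpen (U i)) (hA : A ⊆ ⋃ i, U i) {m : ℕ} {φ : Cochain (sing X) m}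
    (hs : ∀ σ i, InSet (A ∩ U i) σ → φ σ = 0) {σ : (sing X) _⦋m⦌} (hσ : InSet A σ) :
    ∃ N : ℕ, ∀ k ≥ N, sdCochain^[k] φ σ = 0 := by
  obtain ⟨δ, hδ, hL⟩ := lebesgue_number_lemma_of_metric (s := (Set.univ : Set (Simp m)))
    isCompact_univ (fun i => (hU i).preimage (toMap σ).continuous) fun t _ => by
      obtain ⟨i, hi⟩ := Set.mem_iUnion.mp (hA (hσ t))
      exact Set.mem_iUnion.mpr ⟨i, hi⟩
  have hq : (m / (m + 1) : ℝ) < 1 := by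
    rw [div_lt_one (by positivity)]
    exact lt_add_one _
  obtain ⟨N, hN⟩ := exists_pow_lt_of_lt_one (half_pos hδ) hq
  refine ⟨N, fun k hk => ?_⟩
  rw [← onTuples_vertex σ (sdCochain^[k] φ), onTuples_iterate]
  -- With `δ` a Lebesgue number of the pulled back cover, diameter `δ / 2` puts the whole affine
  -- simplex in the open `δ`-ball about its first vertex.
  refine iterate_sdC_eq_zero (r := δ / 2) (fun w hw => ?_) k (R := 1) ?_
    fun i j => dist_simp_le_one _ _
  · obtain ⟨i, hi⟩ := hL (w 0) trivial
    refine hs _ i fun t => ⟨hσ.pull w t, ?_⟩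
    rw [toMap_pull]
    refine hi ?_
    have := hw.dist_aff_le t (stdSimplex.vertex 0)
    rw [aff_vertex] at this
    exact lt_of_le_of_lt this (half_lt_self hδ)
  · rw [mul_one]
    exact (pow_le_pow_of_le_one (by positivity) hq.le hk).trans hN.le

/-- A cocycle that vanishes on the small simplices is a coboundary. -/
lemma exists_coboundary_of_small {A : Set X} {ι : Type} {U : ι → Set X} (hU : ∀ i, IsOpen (U i))
    (hA : A ⊆ ⋃ i, U i) {m : ℕ} {φ : Cochain (sing X) (m + 1)}
    (hφ : ∀ σ, InSet A σ → coboundary (sing X) (m + 1) φ σ = 0)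
    (hs : ∀ σ i, InSet (A ∩ U i) σ → φ σ = 0) :
    ∃ ψ, ∀ σ, InSet A σ → coboundary (sing X) m ψ σ = φ σ := by
  classical
  have hN : ∀ σ : (sing X) _⦋m⦌, ∃ N : ℕ, InSet A σ →
      ∀ k ≥ N, sdCochain^[k] (htCochain φ) σ = 0 := by
    intro σ
    by_cases hσ : InSet A σ
    · obtain ⟨N, hN⟩ := exists_iterate_sdCochain_eq_zero hU hA
        (fun τ i hτ => htCochain_eq_zero (fun σ => hs σ i) hτ) hσ
      exact ⟨N, fun _ => hN⟩
    · exact ⟨0, fun h => absurd h hσ⟩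
  choose N hN using hN
  -- Formally the primitive is `∑ₖ Sdᵏ T φ` over all `k`; on each simplex of `A` the terms vanish
  -- from `N σ` on. Since `δ T φ = φ + Sd φ` on `A`, its coboundary telescopes to `φ`.
  refine ⟨fun σ => ∑ k ∈ Finset.range (N σ), sdCochain^[k] (htCochain φ) σ, fun τ hτ => ?_⟩
  obtain ⟨K, hK⟩ := exists_iterate_sdCochain_eq_zero hU hA hs hτ
  -- One cutoff that serves `τ` and all its faces.
  set L := K + ∑ i, N ((sing X).δ i τ) with hL
  have h1 : ∀ i, ∑ k ∈ Finset.range (N ((sing X).δ i τ)),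
      sdCochain^[k] (htCochain φ) ((sing X).δ i τ) =
      ∑ k ∈ Finset.range L, sdCochain^[k] (htCochain φ) ((sing X).δ i τ) := by
    intro i
    refine Finset.sum_subset (Finset.range_mono ?_) fun k _ hk => ?_
    · exact (Finset.single_le_sum (f := fun i => N ((sing X).δ i τ)) (fun _ _ => Nat.zero_le _)
        (Finset.mem_univ i)).trans (Nat.le_add_left _ _)
    · exact hN _ (hτ.δ i) k (by simpa using hk)
  rw [coboundary_apply, Finset.sum_congr rfl fun i _ => h1 i, Finset.sum_comm]
  have h2 : ∀ k, ∑ i, sdCochain^[k] (htCochain φ) ((sing X).δ i τ) =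
      sdCochain^[k] φ τ + sdCochain^[k + 1] φ τ := by
    intro k
    rw [← coboundary_apply, coboundary_iterate, coboundary_htCochain, iterate_sdCochain_add,
      iterate_sdCochain_add, Function.iterate_succ_apply]
    simp only [Pi.add_apply]
    rw [iterate_sdCochain_eq_zero (φ := htCochain _) (fun σ hσ => htCochain_eq_zero hφ hσ) k hτ,
      add_zero]
  have h3 : ∀ M : ℕ, ∑ k ∈ Finset.range M, (sdCochain^[k] φ τ + sdCochain^[k + 1] φ τ) =
      φ τ + sdCochain^[M] φ τ := by
    intro M
    induction M with
    | zero => exact (zmodTwo_add_self _).symm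
    | succ M ih =>
      rw [Finset.sum_range_succ, ih]
      exact (by decide : ∀ a b c : ZMod 2, a + b + (b + c) = a + c) _ _ _
  rw [Finset.sum_congr rfl fun k _ => h2 k, h3, hK L (Nat.le_add_right _ _), add_zero]

end Pull

end ModTwo

end

noncomputable section

/-! ### The Čech complex of a cover with values in singular cochains -/

namespace ModTwo

open CategoryTheory Simplicial

section Cech

/-- The intersection of the members `U i`, `i ∈ s`, of a cover. -/
def inter {X ι : Type} (U : ι → Set X) (s : Finset ι) : Set X := {x | ∀ i ∈ s, x ∈ U i}

lemma inter_anti {X ι : Type} (U : ι → Set X) {s t : Finset ι} (h : s ⊆ t) : inter U t ⊆ inter U s :=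
  fun _ hx i hi => hx i (h hi)

variable {X : Type} [TopologicalSpace X] {ι : Type} [DecidableEq ι]

/-- The Čech coboundary (modulo `2`) of a family of cochains that is indexed by finite sets. -/
def cech {q : ℕ} (C : Finset ι → Cochain (sing X) q) (s : Finset ι) : Cochain (sing X) q :=
  ∑ i ∈ s, C (s.erase i)

lemma cech_apply {q : ℕ} (C : Finset ι → Cochain (sing X) q) (s : Finset ι)
    (σ : (sing X) _⦋q⦌) : cech C s σ = ∑ i ∈ s, C (s.erase i) σ := by
  rw [cech, Finset.sum_apply]

lemma cech_add {q : ℕ} (C D : Finset ι → Cochain (sing X) q) (s : Finset ι) :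
    cech (C + D) s = cech C s + cech D s := by
  simp [cech, Finset.sum_add_distrib]

lemma cech_cech {q : ℕ} (C : Finset ι → Cochain (sing X) q) (s : Finset ι) :
    cech (cech C) s = 0 := by
  funext σ
  rw [cech_apply]
  simp only [cech_apply]
  rw [Finset.sum_sigma', Pi.zero_apply]
  refine Finset.sum_involution (fun p _ => ⟨p.2, p.1⟩) ?_ ?_ ?_ ?_
  · rintro ⟨i, j⟩ -
    rw [Finset.erase_right_comm]
    exact zmodTwo_add_self _
  · rintro ⟨i, j⟩ h - he
    have h1 : j ∈ s.erase i := (Finset.mem_sigma.mp h).2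
    have h2 : j = i := congrArg Sigma.fst he
    rw [h2] at h1
    simp at h1
  · rintro ⟨i, j⟩ h
    simp only [Finset.mem_sigma, Finset.mem_erase] at h ⊢
    exact ⟨h.2.2, Ne.symm h.2.1, h.1⟩
  · rintro ⟨i, j⟩ -
    rfl

lemma coboundary_cech {q : ℕ} (C : Finset ι → Cochain (sing X) q) (s : Finset ι) :
    coboundary (sing X) q (cech C s) = cech (fun t => coboundary (sing X) q (C t)) s := by
  rw [cech, cech, map_sum]

lemma cech_congr {q : ℕ} {U : ι → Set X} {C D : Finset ι → Cochain (sing X) q} {p : ℕ}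
    (h : ∀ s : Finset ι, s.card = p → ∀ σ, InSet (inter U s) σ → C s σ = D s σ) {s : Finset ι}
    (hs : s.card = p + 1) {σ : (sing X) _⦋q⦌} (hσ : InSet (inter U s) σ) :
    cech C s σ = cech D s σ := by
  rw [cech_apply, cech_apply]
  refine Finset.sum_congr rfl fun i hi => h _ ?_ σ (hσ.mono (inter_anti U (Finset.erase_subset i s)))
  rw [Finset.card_erase_of_mem hi, hs, Nat.add_sub_cancel]

/-- The rows of the Čech complex are exact. -/
lemma exists_eq_cech {q : ℕ} (U : ι → Set X) {p : ℕ} (hp : p ≠ 0)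
    {C : Finset ι → Cochain (sing X) q}
    (h : ∀ s : Finset ι, s.card = p + 1 → ∀ σ, InSet (inter U s) σ → cech C s σ = 0) :
    ∃ D : Finset ι → Cochain (sing X) q,
      ∀ s : Finset ι, s.card = p → ∀ σ, InSet (inter U s) σ → C s σ = cech D s σ := by
  classical
  -- Contracting homotopy: to each simplex that lies in a member of the cover one such index `k` is
  -- assigned, independently of `s`, and `k` is inserted into `s`. As `p ≠ 0`, a simplex in `inter U
  -- s` does lie in some member.
  refine ⟨fun s σ => if hσ : ∃ i, InSet (U i) σ then
    (if hσ.choose ∈ s then 0 else C (insert hσ.choose s) σ) else 0, fun s hs σ hσ => ?_⟩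
  have hex : ∃ i, InSet (U i) σ := by
    obtain ⟨i, hi⟩ := Finset.card_pos.mp (hs ▸ Nat.pos_of_ne_zero hp)
    exact ⟨i, fun t => hσ t i hi⟩
  rw [cech_apply]
  simp only [dif_pos hex]
  set k := hex.choose with hk
  have hkU : InSet (U k) σ := hex.choose_spec
  by_cases hks : k ∈ s
  · rw [Finset.sum_eq_single_of_mem k hks]
    · simp [Finset.insert_erase hks]
    · intro j _ hjk
      rw [if_pos (Finset.mem_erase.mpr ⟨Ne.symm hjk, hks⟩)]
  · have h1 := h (insert k s) (by rw [Finset.card_insert_of_notMem hks, hs]) σ fun t i hi => by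
      rcases Finset.mem_insert.mp hi with rfl | hi
      · exact hkU t
      · exact hσ t i hi
    rw [cech_apply, Finset.sum_insert hks, Finset.erase_insert hks] at h1
    have h2 : ∀ j ∈ s, (if k ∈ s.erase j then (0 : ZMod 2) else C (insert k (s.erase j)) σ) =
        C ((insert k s).erase j) σ := by
      intro j hj
      rw [if_neg fun hkj => hks (Finset.mem_of_mem_erase hkj),
        Finset.erase_insert_of_ne (ne_of_mem_of_not_mem hj hks).symm]
    rw [Finset.sum_congr rfl h2]
    exact (by decide : ∀ a b : ZMod 2, a + b = 0 → a = b) _ _ h1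

/-- One step upwards in the double complex. -/
lemma exists_coboundary_eq_cech {q p : ℕ} {U : ι → Set X}
    (hU : ∀ s : Finset ι, s.Nonempty → ∀ φ : Cochain (sing X) (q + 1),
      (∀ σ, InSet (inter U s) σ → coboundary (sing X) (q + 1) φ σ = 0) →
      ∃ ψ, ∀ σ, InSet (inter U s) σ → coboundary (sing X) q ψ σ = φ σ)
    {C : Finset ι → Cochain (sing X) (q + 1)} {B : Finset ι → Cochain (sing X) (q + 2)}
    (h : ∀ s : Finset ι, s.card = p → ∀ σ, InSet (inter U s) σ →
      coboundary (sing X) (q + 1) (C s) σ = cech B s σ) :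
    ∃ D : Finset ι → Cochain (sing X) q, ∀ s : Finset ι, s.card = p + 1 →
      ∀ σ, InSet (inter U s) σ → coboundary (sing X) q (D s) σ = cech C s σ := by
  have hex : ∀ s : Finset ι, ∃ ψ : Cochain (sing X) q, s.card = p + 1 →
      ∀ σ, InSet (inter U s) σ → coboundary (sing X) q ψ σ = cech C s σ := by
    intro s
    by_cases hs : s.card = p + 1
    -- The right-hand side is closed because `δ` of the Čech coboundary of `C` is the Čech
    -- coboundary of `δC`, which is twice the Čech coboundary operator applied to `B`.
    · obtain ⟨ψ, hψ⟩ := hU s (Finset.card_pos.mp (by omega)) (cech C s) fun σ hσ => by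
        rw [coboundary_cech, cech_congr h hs hσ, cech_cech, Pi.zero_apply]
      exact ⟨ψ, fun _ => hψ⟩
    · exact ⟨0, fun h => absurd h hs⟩
  choose D hD using hex
  exact ⟨D, hD⟩

/-- One step downwards in the double complex. -/
lemma exists_add_coboundary_eq_cech {q p : ℕ} {U : ι → Set X} (hp : p ≠ 0)
    {C : Finset ι → Cochain (sing X) (q + 1)} {D E : Finset ι → Cochain (sing X) q}
    (h : ∀ s : Finset ι, s.card = p + 1 → ∀ σ, InSet (inter U s) σ →
      coboundary (sing X) q (D s) σ = cech C s σ)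
    (hD : ∀ s : Finset ι, s.card = p + 1 → ∀ σ, InSet (inter U s) σ → D s σ = cech E s σ) :
    ∃ F : Finset ι → Cochain (sing X) (q + 1), ∀ s : Finset ι, s.card = p →
      ∀ σ, InSet (inter U s) σ → C s σ + coboundary (sing X) q (E s) σ = cech F s σ := by
  refine exists_eq_cech U hp (C := fun s => C s + coboundary (sing X) q (E s)) ?_
  intro s hs σ hσ
  change cech (C + fun s => coboundary (sing X) q (E s)) s σ = 0
  rw [cech_add, ← coboundary_cech, Pi.add_apply, ← h s hs σ hσ,
    coboundary_congr (hD s hs) hσ]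
  exact zmodTwo_add_self _

lemma coboundary_coboundary {q : ℕ} (φ : Cochain (sing X) q) :
    coboundary (sing X) (q + 1) (coboundary (sing X) q φ) = 0 := by
  funext σ
  rw [← onTuples_vertex σ (coboundary _ _ _), onTuples_coboundary, onTuples_coboundary,
    tupleδ_tupleδ]
  rfl

/-- A `3`-cocycle that comes from a Čech coboundary is a coboundary. -/
lemma mem_coboundaries_of_cech {U : ι → Set X} (hU : ∀ i, IsOpen (U i)) (hX : ⋃ i, U i = Set.univ)
    {φ : Cochain (sing X) 3} (hφ : φ ∈ cocycles (sing X) 3)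
    {C₁ : Finset ι → Cochain (sing X) 2} {C₂ : Finset ι → Cochain (sing X) 1}
    {C₃ D : Finset ι → Cochain (sing X) 0}
    (h₁ : ∀ s : Finset ι, s.card = 1 → ∀ σ, InSet (inter U s) σ →
      coboundary (sing X) 2 (C₁ s) σ = φ σ)
    (h₂ : ∀ s : Finset ι, s.card = 2 → ∀ σ, InSet (inter U s) σ →
      coboundary (sing X) 1 (C₂ s) σ = cech C₁ s σ)
    (h₃ : ∀ s : Finset ι, s.card = 3 → ∀ σ, InSet (inter U s) σ →
      coboundary (sing X) 0 (C₃ s) σ = cech C₂ s σ)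
    (hD : ∀ s : Finset ι, s.card = 3 → ∀ σ, InSet (inter U s) σ → C₃ s σ = cech D s σ) :
    φ ∈ coboundaries (sing X) 3 := by
  -- The zigzag is run backwards: `C₂ + δD` is a Čech coboundary of `E`, and then `C₁ + δE` is one
  -- of `F`.
  obtain ⟨E, hE⟩ := exists_add_coboundary_eq_cech two_ne_zero h₃ hD
  obtain ⟨F, hF⟩ := exists_add_coboundary_eq_cech one_ne_zero
    (D := C₂ + fun s => coboundary (sing X) 0 (D s)) (C := C₁) (E := E) (fun s hs σ hσ => by
      change coboundary (sing X) 1 (C₂ s + coboundary (sing X) 0 (D s)) σ = _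
      rw [map_add, coboundary_coboundary, add_zero]
      exact h₂ s hs σ hσ) hE
  -- On each `U i` the cochains `φ` and `δ(F ∅)` agree, so their sum vanishes on small simplices.
  obtain ⟨ψ, hψ⟩ := exists_coboundary_of_small (A := Set.univ) hU hX.ge
    (φ := φ + coboundary (sing X) 2 (F ∅)) (fun σ _ => by
      have : coboundary (sing X) 3 φ = 0 := hφ
      rw [map_add, coboundary_coboundary, this]
      rfl) fun σ i hσ => by
    have hσ' : InSet (inter U {i}) σ := fun t j hj => by
      rw [Finset.mem_singleton.mp hj]
      exact (hσ t).2
    have h := coboundary_congr (φ := C₁ {i} + coboundary (sing X) 1 (E {i}))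
      (hF {i} (Finset.card_singleton i)) hσ'
    rw [map_add, coboundary_coboundary, add_zero, h₁ {i} (Finset.card_singleton i) σ hσ'] at h
    rw [Pi.add_apply, h]
    -- The complex is augmented: the empty index set carries one cochain on the whole space.
    have : cech F {i} = F ∅ := by simp [cech]
    rw [this]
    exact zmodTwo_add_self _
  refine ⟨ψ + F ∅, ?_⟩
  funext σ
  rw [map_add, Pi.add_apply, hψ σ fun _ => trivial, Pi.add_apply]
  exact (by decide : ∀ a b : ZMod 2, a + b + b = a) _ _

/-- A cone construction on `A` shows that the cohomology of `A` vanishes in positive degrees. -/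
lemma exists_coboundary_of_cone {A : Set X} (K : ∀ k, (sing X) _⦋k⦌ → (sing X) _⦋k + 1⦌)
    (hK : ∀ k σ, InSet A σ → InSet A (K k σ))
    (h0 : ∀ k σ, InSet A σ → (sing X).δ 0 (K k σ) = σ)
    (hs : ∀ k (σ : (sing X) _⦋k + 1⦌), InSet A σ → ∀ i : Fin (k + 2),
      (sing X).δ i.succ (K (k + 1) σ) = K k ((sing X).δ i σ)) {m : ℕ}
    {φ : Cochain (sing X) (m + 1)}
    (hφ : ∀ σ, InSet A σ → coboundary (sing X) (m + 1) φ σ = 0) :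
    ∃ ψ, ∀ σ, InSet A σ → coboundary (sing X) m ψ σ = φ σ := by
  -- Evaluating `δφ = 0` on the cone `K σ`, the base contributes `φ σ` and the other faces
  -- contribute `φ` on the cones over the faces of `σ`.
  refine ⟨fun σ => φ (K m σ), fun σ hσ => ?_⟩
  have h := hφ _ (hK _ σ hσ)
  rw [coboundary_apply, Fin.sum_univ_succ, h0 _ σ hσ] at h
  rw [coboundary_apply]
  simp only [← hs m σ hσ]
  exact (by decide : ∀ a b : ZMod 2, a + b = 0 → b = a) _ _ h

end Cech

end ModTwo

end

noncomputable section

/-! ### Cones -/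

namespace ModTwo

section Cone

variable {V : Type} [NormedAddCommGroup V] [NormedSpace ℝ V]

/-- The projection of a simplex from its vertex `0` to the opposite face. -/
def coneProj {m : ℕ} (t : Simp (m + 1)) : Simp m :=
  -- The value at the apex is arbitrary: `coneMap` multiplies it by zero.
  if h : t 0 = 1 then stdSimplex.vertex 0 else
    ⟨fun j => t j.succ / (1 - t 0), fun j => div_nonneg (t.2.1 _)
      (sub_nonneg.mpr (stdSimplex.le_one t 0)), by
      have h1 := stdSimplex.sum_eq_one t
      rw [Fin.sum_univ_succ] at h1
      rw [← Finset.sum_div, div_eq_one_iff_eq (sub_ne_zero.mpr (Ne.symm h))]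
      linarith⟩

lemma coneProj_apply {m : ℕ} {t : Simp (m + 1)} (h : t 0 ≠ 1) (j : Fin (m + 1)) :
    coneProj t j = t j.succ / (1 - t 0) := by
  rw [coneProj, dif_neg h]
  rfl

lemma continuous_coord {m : ℕ} (j : Fin (m + 1)) : Continuous fun t : Simp m => t j :=
  (continuous_apply j).comp continuous_subtype_val

lemma continuousAt_coneProj {m : ℕ} {t : Simp (m + 1)} (h : t 0 ≠ 1) :
    ContinuousAt coneProj t := by
  rw [Topology.IsInducing.subtypeVal.continuousAt_iff, continuousAt_pi]
  intro j
  have hc : ContinuousAt (fun s : Simp (m + 1) => s j.succ / (1 - s 0)) t :=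
    (continuous_coord j.succ).continuousAt.div (continuous_const.sub (continuous_coord 0)).continuousAt
      (sub_ne_zero.mpr h.symm)
  refine hc.congr ?_
  filter_upwards [(continuous_coord 0).continuousAt.eventually_ne h] with s hs
  exact (coneProj_apply hs j).symm

/-- The cone with vertex `b` over a map to a vector space. -/
def coneMap {m : ℕ} (b : V) (G : C(Simp m, V)) : C(Simp (m + 1), V) where
  toFun t := t 0 • b + (1 - t 0) • G (coneProj t)
  continuous_toFun := by
    refine continuous_iff_continuousAt.mpr fun t => ?_
    refine ((continuous_coord 0).smul continuous_const).continuousAt.add ?_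
    by_cases h : t 0 = 1
    -- At the apex `coneProj` need not be continuous, but `G` is bounded and its factor `1 - t 0`
    -- tends to zero.
    · obtain ⟨R, hR⟩ := (isCompact_range G.continuous).isBounded.exists_norm_le
      have hz : (1 - t 0) • G (coneProj t) = 0 := by rw [h, sub_self, zero_smul]
      rw [ContinuousAt, hz]
      refine squeeze_zero_norm (a := fun s : Simp (m + 1) => |1 - s 0| * R) (fun s => ?_) ?_
      · rw [norm_smul, Real.norm_eq_abs]
        exact mul_le_mul_of_nonneg_left (hR _ ⟨_, rfl⟩) (abs_nonneg _)
      · have hc : Continuous fun s : Simp (m + 1) => |1 - s 0| * R :=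
          ((continuous_const.sub (continuous_coord 0)).abs).mul continuous_const
        simpa [h] using hc.tendsto t
    · exact (continuous_const.sub (continuous_coord 0)).continuousAt.smul
        (G.continuous.continuousAt.comp (continuousAt_coneProj h))

lemma coneMap_apply {m : ℕ} (b : V) (G : C(Simp m, V)) (t : Simp (m + 1)) :
    coneMap b G t = t 0 • b + (1 - t 0) • G (coneProj t) := rfl

/-- The inclusion of the face opposite to the vertex `i`. -/
abbrev face {m : ℕ} (i : Fin (m + 2)) (t : Simp m) : Simp (m + 1) :=
  aff (fun j => stdSimplex.vertex (i.succAbove j)) t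

lemma face_succAbove {m : ℕ} (i : Fin (m + 2)) (t : Simp m) (j : Fin (m + 1)) :
    face i t (i.succAbove j) = t j := by
  change (face i t).1 _ = _
  rw [aff_coe, Finset.sum_apply, Finset.sum_eq_single j]
  · simp
  · intro k _ hk
    simp [hk.symm]
  · simp

lemma face_self {m : ℕ} (i : Fin (m + 2)) (t : Simp m) : face i t i = 0 := by
  change (face i t).1 _ = _
  rw [aff_coe, Finset.sum_apply]
  refine Finset.sum_eq_zero fun k _ => ?_
  simp

lemma coneMap_face_zero {m : ℕ} (b : V) (G : C(Simp m, V)) (t : Simp m) :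
    coneMap b G (face 0 t) = G t := by
  have h0 : face (0 : Fin (m + 2)) t 0 = 0 := face_self 0 t
  have h1 : coneProj (face 0 t) = t := by
    refine stdSimplex.ext (funext fun j => ?_)
    rw [coneProj_apply (by rw [h0]; exact zero_ne_one), h0, sub_zero, div_one]
    exact face_succAbove 0 t j
  rw [coneMap_apply, h0, h1, zero_smul, sub_zero, one_smul, zero_add]

lemma face_succ_zero {m : ℕ} (i : Fin (m + 2)) (t : Simp (m + 1)) : face i.succ t 0 = t 0 := by
  have := face_succAbove i.succ t 0
  rwa [Fin.succ_succAbove_zero] at this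

lemma coneMap_face_succ {m : ℕ} (b : V) (G : C(Simp (m + 1), V)) (i : Fin (m + 2))
    (H : C(Simp m, V)) (hH : ∀ t, H t = G (face i t)) (t : Simp (m + 1)) :
    coneMap b G (face i.succ t) = coneMap b H t := by
  rw [coneMap_apply, coneMap_apply, face_succ_zero]
  by_cases h : t 0 = 1
  · rw [h, sub_self, zero_smul, zero_smul]
  · have h1 : coneProj (face i.succ t) = face i (coneProj t) := by
      refine stdSimplex.ext (funext fun j => ?_)
      have h' : face i.succ t 0 ≠ 1 := by rwa [face_succ_zero]
      rw [coneProj_apply h', face_succ_zero]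
      rcases Fin.eq_self_or_eq_succAbove i j with rfl | ⟨k, rfl⟩
      · rw [face_self, face_self, zero_div]
      · rw [face_succAbove, coneProj_apply h, ← Fin.succ_succAbove_succ, face_succAbove]
    rw [h1, hH]

lemma coneMap_face_one {b : V} (G : C(Simp 0, V)) (t : Simp 0) : coneMap b G (face 1 t) = b := by
  have h : face (1 : Fin 2) t 0 = 1 := by
    have h1 := face_succAbove (1 : Fin 2) t 0
    rw [show (1 : Fin 2).succAbove (0 : Fin 1) = 0 from rfl] at h1
    rw [h1]
    simp
  rw [coneMap_apply, h, one_smul, sub_self, zero_smul, add_zero]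

end Cone

end ModTwo

/-! ### The affine cover of the real projective space -/

namespace RP

open ModTwo CategoryTheory Simplicial

variable {n : ℕ}

/-- The point of `ℝP^n` with given homogeneous coordinates. -/
abbrev mk (v : Fin (n + 1) → ℝ) (hv : v ≠ 0) : RP n := Projectivization.mk ℝ v hv

lemma continuous_mk {Y : Type} [TopologicalSpace Y] {f : Y → Fin (n + 1) → ℝ} (hf : Continuous f)
    (h0 : ∀ y, f y ≠ 0) : Continuous fun y => mk (f y) (h0 y) :=
  isQuotientMap_mk'.continuous.comp (hf.subtype_mk h0)

lemma ratio_self {i : Fin (n + 1)} {ℓ : RP n} (h : ℓ ∈ affineOpen i) : ratio i i ℓ = 1 :=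
  div_self h

lemma ratio_ne_zero {i j : Fin (n + 1)} {ℓ : RP n} (hi : ℓ ∈ affineOpen i)
    (hj : ℓ ∈ affineOpen j) : ratio i j ℓ ≠ 0 := div_ne_zero hj hi

lemma ratio_vec_ne_zero {i : Fin (n + 1)} {ℓ : RP n} (h : ℓ ∈ affineOpen i) :
    (fun j => ratio i j ℓ) ≠ 0 := fun h0 => by
  have := congrFun h0 i
  rw [ratio_self h] at this
  exact one_ne_zero this

lemma mk_ratio {i : Fin (n + 1)} {ℓ : RP n} (h : ℓ ∈ affineOpen i) :
    mk (fun j => ratio i j ℓ) (ratio_vec_ne_zero h) = ℓ := by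
  conv_rhs => rw [← ℓ.mk_rep]
  rw [Projectivization.mk_eq_mk_iff']
  exact ⟨(ℓ.rep i)⁻¹, funext fun j => by simp [ratio, div_eq_inv_mul]⟩

/-- The sign of the ratio of two homogeneous coordinates. -/
def sgn (i j : Fin (n + 1)) (ℓ : RP n) : SignType := SignType.sign (ratio i j ℓ)

/-- The sign of `v_j / v_i` is constant on a simplex on which `v_i` and `v_j` do not vanish. -/
lemma sgn_eq_of_inSet {i j : Fin (n + 1)} {k : ℕ} {σ : (sing (RP n)) _⦋k⦌}
    (hi : InSet (affineOpen i) σ) (hj : InSet (affineOpen j) σ) (s t : Simp k) :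
    sgn i j (toMap σ s) = sgn i j (toMap σ t) := by
  have hc : Continuous fun t => sgn i j (toMap σ t) := by
    refine continuous_iff_continuousAt.mpr fun t => ?_
    have h1 : ContinuousAt (ratio i j) (toMap σ t) :=
      (continuousOn_ratio i j).continuousAt ((isOpen_affineOpen i).mem_nhds (hi t))
    exact (continuousAt_sign_of_ne_zero (ratio_ne_zero (hi t) (hj t))).comp
      (f := fun t => ratio i j (toMap σ t)) (h1.comp (toMap σ).continuous.continuousAt)
  exact PreconnectedSpace.constant inferInstance hc

/-- The vector of signs of the homogeneous coordinates `v_j / v_i` for `j ∈ s`. -/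
def signVec (s : Finset (Fin (n + 1))) (i : Fin (n + 1)) (ℓ : RP n) : Fin (n + 1) → ℝ :=
  fun j => if j ∈ s then (sgn i j ℓ : ℝ) else 0

lemma signVec_eq_of_inSet {s : Finset (Fin (n + 1))} {i : Fin (n + 1)} (hi : i ∈ s) {k : ℕ}
    {σ : (sing (RP n)) _⦋k⦌} (h : InSet (inter affineOpen s) σ) (x y : Simp k) :
    signVec s i (toMap σ x) = signVec s i (toMap σ y) := by
  funext j
  by_cases hj : j ∈ s
  · rw [signVec, signVec, if_pos hj, if_pos hj,
      sgn_eq_of_inSet (fun t => h t i hi) (fun t => h t j hj) x y]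
  · rw [signVec, signVec, if_neg hj, if_neg hj]

/-- The lift of a simplex in the affine open set `v_i ≠ 0` that is normalized by `v_i = 1`. -/
def affineLift {i : Fin (n + 1)} {k : ℕ} {σ : (sing (RP n)) _⦋k⦌} (h : InSet (affineOpen i) σ) :
    C(Simp k, Fin (n + 1) → ℝ) where
  toFun t := fun j => ratio i j (toMap σ t)
  continuous_toFun := continuous_pi fun j =>
    (continuousOn_ratio i j).comp_continuous (toMap σ).continuous h

/-- The segment from a nonzero real to its sign avoids zero. Coordinatewise, this makes the
components of an intersection of affine open sets star-shaped about their sign vectors. -/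
lemma convex_sign_ne_zero {a r s : ℝ} (hr : r ≠ 0) (hs : SignType.sign r = SignType.sign s)
    (ha : 0 ≤ a) (ha' : a ≤ 1) : a * (SignType.sign s : ℝ) + (1 - a) * r ≠ 0 := by
  rw [← hs]
  rcases hr.lt_or_gt with h | h
  · rw [sign_neg h]
    push_cast
    have : 0 < a + (1 - a) * (-r) := by
      rcases ha.eq_or_lt with rfl | h0
      · simpa using h
      · have := mul_nonneg (sub_nonneg.mpr ha') (neg_nonneg.mpr h.le)
        linarith
    intro h'
    simp only [SignType.coe_one] at h'
    linarith
  · rw [sign_pos h]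
    have : 0 < a + (1 - a) * r := by
      rcases ha.eq_or_lt with rfl | h0
      · simpa using h
      · have := mul_nonneg (sub_nonneg.mpr ha') h.le
        linarith
    intro h'
    simp only [SignType.coe_one] at h'
    linarith

lemma affineCone_ne_zero {s : Finset (Fin (n + 1))} {i : Fin (n + 1)} (hi : i ∈ s) {k : ℕ}
    {σ : (sing (RP n)) _⦋k⦌} (h : InSet (inter affineOpen s) σ) (t : Simp (k + 1))
    {j : Fin (n + 1)} (hj : j ∈ s) :
    coneMap (signVec s i (toMap σ (stdSimplex.vertex 0))) (affineLift fun t => h t i hi) t j ≠ 0 := by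
  rw [coneMap_apply, Pi.add_apply, Pi.smul_apply, Pi.smul_apply, signVec, if_pos hj]
  exact convex_sign_ne_zero (ratio_ne_zero (h _ i hi) (h _ j hj))
    (sgn_eq_of_inSet (fun t => h t i hi) (fun t => h t j hj) _ _) (t.2.1 0)
    (stdSimplex.le_one t 0)

lemma affineCone_ne_zero' {s : Finset (Fin (n + 1))} {i : Fin (n + 1)} (hi : i ∈ s) {k : ℕ}
    {σ : (sing (RP n)) _⦋k⦌} (h : InSet (inter affineOpen s) σ) (t : Simp (k + 1)) :
    coneMap (signVec s i (toMap σ (stdSimplex.vertex 0))) (affineLift fun t => h t i hi) t ≠ 0 :=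
  fun h0 => affineCone_ne_zero hi h t hi (congrFun h0 i)

open Classical in
/-- The cone over a simplex in an intersection of affine open sets. -/
def affineCone {s : Finset (Fin (n + 1))} {i : Fin (n + 1)} (hi : i ∈ s) (k : ℕ)
    (σ : (sing (RP n)) _⦋k⦌) : (sing (RP n)) _⦋k + 1⦌ :=
  if h : InSet (inter affineOpen s) σ then
    ofMap ⟨fun t => mk _ (affineCone_ne_zero' hi h t), continuous_mk (ContinuousMap.continuous _) _⟩
  else (sing (RP n)).σ 0 σ

lemma toMap_affineCone {s : Finset (Fin (n + 1))} {i : Fin (n + 1)} (hi : i ∈ s) {k : ℕ}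
    {σ : (sing (RP n)) _⦋k⦌} (h : InSet (inter affineOpen s) σ) (t : Simp (k + 1)) :
    toMap (affineCone hi k σ) t = mk _ (affineCone_ne_zero' hi h t) := by
  rw [affineCone, dif_pos h, toMap_ofMap]
  rfl

lemma mk_congr {v w : Fin (n + 1) → ℝ} {hv : v ≠ 0} (h : v = w) : mk v hv = mk w (h ▸ hv) := by
  subst h
  rfl

/-- The positive-dimensional cohomology of the intersections of affine open sets vanishes. -/
lemma exists_coboundary_of_inter {s : Finset (Fin (n + 1))} (hs : s.Nonempty) {m : ℕ}
    {φ : Cochain (sing (RP n)) (m + 1)}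
    (hφ : ∀ σ, InSet (inter affineOpen s) σ → coboundary (sing (RP n)) (m + 1) φ σ = 0) :
    ∃ ψ, ∀ σ, InSet (inter affineOpen s) σ → coboundary (sing (RP n)) m ψ σ = φ σ := by
  obtain ⟨i, hi⟩ := hs
  refine exists_coboundary_of_cone (affineCone hi) ?_ ?_ ?_ hφ
  · intro k σ hσ t j hj
    rw [toMap_affineCone hi hσ, mk_mem_affineOpen]
    exact affineCone_ne_zero hi hσ t hj
  · intro k σ hσ
    refine toMap_injective (ContinuousMap.ext fun t => ?_)
    rw [δ_eq_pull, toMap_pull, toMap_affineCone hi hσ, mk_congr (coneMap_face_zero _ _ t)]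
    exact mk_ratio (hσ t i hi)
  · intro k σ hσ j
    refine toMap_injective (ContinuousMap.ext fun t => ?_)
    have hσ' := hσ.δ j
    rw [δ_eq_pull, toMap_pull, toMap_affineCone hi hσ, toMap_affineCone hi hσ']
    -- The apex depends only on the component containing `σ`, so a simplex and its faces are coned
    -- to the same point. This gives compatibility with faces even when vertex `0` is removed.
    have h1 : signVec s i (toMap ((sing (RP n)).δ j σ) (stdSimplex.vertex 0)) =
        signVec s i (toMap σ (stdSimplex.vertex 0)) := by
      rw [δ_eq_pull, toMap_pull]
      exact signVec_eq_of_inSet hi hσ _ _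
    rw [mk_congr (coneMap_face_succ _ _ j (affineLift fun t => hσ' t i hi) (fun t => ?_) t)]
    · congr 2
      rw [h1]
    · funext l
      change ratio i l (toMap ((sing (RP n)).δ j σ) t) = _
      rw [δ_eq_pull, toMap_pull]
      rfl

/-- A point as a singular `0`-simplex. -/
def pt {X : Type} [TopologicalSpace X] (x : X) : (sing X) _⦋0⦌ := ofMap (.const _ x)

lemma pt_toMap {X : Type} [TopologicalSpace X] (σ : (sing X) _⦋0⦌) :
    pt (toMap σ (stdSimplex.vertex 0)) = σ := by
  refine toMap_injective (ContinuousMap.ext fun t => ?_)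
  rw [pt, toMap_ofMap]
  exact congrArg (toMap σ) (Subsingleton.elim (α := stdSimplex ℝ (Fin 1)) _ _)

lemma signVec_ne_zero {s : Finset (Fin (n + 1))} {i : Fin (n + 1)} (hi : i ∈ s) {ℓ : RP n}
    (h : ℓ ∈ affineOpen i) : signVec s i ℓ ≠ 0 := fun h0 => by
  have := congrFun h0 i
  rw [signVec, if_pos hi, sgn, ratio_self h] at this
  simp at this

/-- A closed `0`-cochain on an intersection of affine open sets depends only on the signs of the
homogeneous coordinates. -/
lemma closed_apply_eq {s : Finset (Fin (n + 1))} {i : Fin (n + 1)} (hi : i ∈ s)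
    {f : Cochain (sing (RP n)) 0}
    (hf : ∀ σ, InSet (inter affineOpen s) σ → coboundary (sing (RP n)) 0 f σ = 0)
    {x : RP n} (hx : x ∈ inter affineOpen s) :
    f (pt x) = f (pt (mk _ (signVec_ne_zero hi (hx i hi)))) := by
  have hσ : InSet (inter affineOpen s) (pt x) := fun t => by
    rw [pt, toMap_ofMap]
    exact hx
  -- The cone over the point `x` is a path in the intersection from the sign point to `x`.
  have h := hf (affineCone hi 0 (pt x)) fun t j hj => by
    rw [toMap_affineCone hi hσ, mk_mem_affineOpen]
    exact affineCone_ne_zero hi hσ t hj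
  have h0 : (sing (RP n)).δ 0 (affineCone hi 0 (pt x)) = pt x := by
    refine toMap_injective (ContinuousMap.ext fun t => ?_)
    rw [δ_eq_pull, toMap_pull, toMap_affineCone hi hσ, mk_congr (coneMap_face_zero _ _ t)]
    exact mk_ratio (hσ t i hi)
  have h1 : (sing (RP n)).δ 1 (affineCone hi 0 (pt x)) =
      pt (mk _ (signVec_ne_zero hi (hx i hi))) := by
    refine toMap_injective (ContinuousMap.ext fun t => ?_)
    rw [δ_eq_pull, toMap_pull, toMap_affineCone hi hσ, mk_congr (coneMap_face_one _ t)]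
    simp only [pt, toMap_ofMap]
    rfl
  rw [coboundary_apply, Fin.sum_univ_two, h0, h1] at h
  exact (by decide : ∀ a b : ZMod 2, a + b = 0 → a = b) _ _ h

end RP

end

noncomputable section

/-! ### The third cohomology of `ℝP^3` -/

namespace RP

open ModTwo CategoryTheory Simplicial

/-- The sign `1` or `-1` of a bit. -/
def bitSign (b : Bool) : ℝ := if b then -1 else 1

/-- The point `[1, ±1, ±1, ±1]`. -/
def signPoint (b₁ b₂ b₃ : Bool) : RP 3 :=
  mk ![1, bitSign b₁, bitSign b₂, bitSign b₃] fun h => one_ne_zero (congrFun h 0)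

/-- Whether `v_j / v_0` is negative. -/
def bit (j : Fin 4) (ℓ : RP 3) : Bool := decide (sgn 0 j ℓ = -1)

lemma bitSign_bit {j : Fin 4} {ℓ : RP 3} (h0 : ℓ ∈ affineOpen 0) (hj : ℓ ∈ affineOpen j) :
    bitSign (bit j ℓ) = (sgn 0 j ℓ : ℝ) := by
  rcases (ratio_ne_zero h0 hj).lt_or_gt with h | h
  · simp [bit, sgn, sign_neg h, bitSign]
  · simp [bit, sgn, sign_pos h, bitSign]

lemma closed_apply_eq_signPoint {f : Cochain (sing (RP 3)) 0}
    (hf : ∀ σ, InSet (inter affineOpen Finset.univ) σ → coboundary (sing (RP 3)) 0 f σ = 0)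
    {x : RP 3} (hx : x ∈ inter affineOpen Finset.univ) :
    f (pt x) = f (pt (signPoint (bit 1 x) (bit 2 x) (bit 3 x))) := by
  rw [closed_apply_eq (Finset.mem_univ 0) hf hx]
  congr 2
  refine mk_congr (funext fun j => ?_)
  have h := fun j => hx j (Finset.mem_univ j)
  rw [signVec, if_pos (Finset.mem_univ j)]
  fin_cases j
  · simp [sgn, ratio_self (h 0)]
  · exact (bitSign_bit (h 0) (h 1)).symm
  · exact (bitSign_bit (h 0) (h 2)).symm
  · exact (bitSign_bit (h 0) (h 3)).symm

/-- Primitives of a `3`-cocycle along the Čech complex of the affine cover. -/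
structure Zigzag (φ : Cochain (sing (RP 3)) 3) where
  C₁ : Finset (Fin 4) → Cochain (sing (RP 3)) 2
  C₂ : Finset (Fin 4) → Cochain (sing (RP 3)) 1
  C₃ : Finset (Fin 4) → Cochain (sing (RP 3)) 0
  h₁ : ∀ s : Finset (Fin 4), s.card = 1 → ∀ σ, InSet (inter affineOpen s) σ →
      coboundary (sing (RP 3)) 2 (C₁ s) σ = φ σ
  h₂ : ∀ s : Finset (Fin 4), s.card = 2 → ∀ σ, InSet (inter affineOpen s) σ →
      coboundary (sing (RP 3)) 1 (C₂ s) σ = cech C₁ s σ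
  h₃ : ∀ s : Finset (Fin 4), s.card = 3 → ∀ σ, InSet (inter affineOpen s) σ →
      coboundary (sing (RP 3)) 0 (C₃ s) σ = cech C₂ s σ

lemma Zigzag.nonempty {φ : Cochain (sing (RP 3)) 3} (hφ : φ ∈ cocycles (sing (RP 3)) 3) :
    Nonempty (Zigzag φ) := by
  have hφ' : coboundary (sing (RP 3)) 3 φ = 0 := hφ
  -- The zigzag starts from the constant family `φ`; on a one-element index set its Čech coboundary
  -- is `φ` itself.
  obtain ⟨C₁, h₁⟩ := exists_coboundary_eq_cech (q := 2) (p := 0) (U := affineOpen (n := 3))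
    (C := fun _ => φ) (B := 0) (fun s hs _ => exists_coboundary_of_inter hs) fun s _ σ _ => by
      rw [hφ', cech_apply]
      simp
  have h₁' : ∀ s : Finset (Fin 4), s.card = 1 → ∀ σ, InSet (inter affineOpen s) σ →
      coboundary (sing (RP 3)) 2 (C₁ s) σ = φ σ := by
    intro s hs σ hσ
    rw [h₁ s hs σ hσ, cech_apply, Finset.sum_const, hs, one_smul]
  obtain ⟨C₂, h₂⟩ := exists_coboundary_eq_cech (q := 1) (p := 1) (U := affineOpen (n := 3))
    (fun s hs _ => exists_coboundary_of_inter hs) h₁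
  obtain ⟨C₃, h₃⟩ := exists_coboundary_eq_cech (q := 0) (p := 2) (U := affineOpen (n := 3))
    (fun s hs _ => exists_coboundary_of_inter hs) h₂
  exact ⟨⟨C₁, C₂, C₃, h₁', h₂, h₃⟩⟩

/-- The values of the Čech `3`-cocycle of locally constant functions. -/
def Zigzag.value {φ : Cochain (sing (RP 3)) 3} (z : Zigzag φ) (b₁ b₂ b₃ : Bool) : ZMod 2 :=
  cech z.C₃ Finset.univ (pt (signPoint b₁ b₂ b₃))

/-- The class of the Čech `3`-cocycle of locally constant functions. -/
def Zigzag.total {φ : Cochain (sing (RP 3)) 3} (z : Zigzag φ) : ZMod 2 :=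
  ∑ b₁, ∑ b₂, ∑ b₃, z.value b₁ b₂ b₃

lemma Zigzag.closed {φ : Cochain (sing (RP 3)) 3} (z : Zigzag φ) (σ : (sing (RP 3)) _⦋1⦌)
    (hσ : InSet (inter affineOpen Finset.univ) σ) :
    coboundary (sing (RP 3)) 0 (cech z.C₃ Finset.univ) σ = 0 := by
  rw [coboundary_cech, cech_congr z.h₃ (Finset.card_fin 4) hσ, cech_cech, Pi.zero_apply]

/-- The locally constant functions whose Čech coboundary is a Čech cocycle of total zero. -/
def correction (A : Bool → Bool → Bool → ZMod 2) (k : Fin 4) (ℓ : RP 3) : ZMod 2 :=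
  ![0, A false (bit 2 ℓ) (bit 3 ℓ),
    A (bit 1 ℓ) false (bit 3 ℓ) + A false false (bit 3 ℓ),
    A (bit 1 ℓ) (bit 2 ℓ) false + A false (bit 2 ℓ) false + A (bit 1 ℓ) false false +
      A false false false] k

/-- Inclusion–exclusion: `A` plus the sum of the corrections is the alternating sum of `A` over all
ways of replacing arguments by `false`. If some bit is already `false`, its terms cancel in pairs;
if all bits are `true`, it is the total of `A`, zero by assumption. -/
lemma sum_correction {A : Bool → Bool → Bool → ZMod 2} (hA : ∑ b₁, ∑ b₂, ∑ b₃, A b₁ b₂ b₃ = 0)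
    (ℓ : RP 3) : ∑ k, correction A k ℓ = A (bit 1 ℓ) (bit 2 ℓ) (bit 3 ℓ) := by
  have key : ∀ a b c d e f g h : ZMod 2, a + b + (c + d) + (e + f + (g + h)) = 0 →
      0 + e + (c + g) + (b + f + d + h) = a := by decide
  simp only [Fintype.sum_bool] at hA
  rw [Fin.sum_univ_four]
  change 0 + A false (bit 2 ℓ) (bit 3 ℓ) + (A (bit 1 ℓ) false (bit 3 ℓ) +
    A false false (bit 3 ℓ)) + (A (bit 1 ℓ) (bit 2 ℓ) false + A false (bit 2 ℓ) false +
      A (bit 1 ℓ) false false + A false false false) = _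
  cases bit 1 ℓ <;> cases bit 2 ℓ <;> cases bit 3 ℓ
  case true.true.true => exact key _ _ _ _ _ _ _ _ hA
  all_goals grind

lemma bit_eq_of_inSet {j : Fin 4} {k : ℕ} {σ : (sing (RP 3)) _⦋k⦌} (h0 : InSet (affineOpen 0) σ)
    (hj : InSet (affineOpen j) σ) (s t : Simp k) : bit j (toMap σ s) = bit j (toMap σ t) := by
  rw [bit, bit, sgn_eq_of_inSet h0 hj s t]

/-- The `k`-th correction does not involve bit `k`, so it remains locally constant where `v_k` may
vanish. Bits are relative to `v_0`, which is why the correction for `k = 0` is taken to be zero. -/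
lemma correction_eq_of_inSet {A : Bool → Bool → Bool → ZMod 2} {k : Fin 4} {m : ℕ}
    {σ : (sing (RP 3)) _⦋m⦌} (h : ∀ j ≠ k, InSet (affineOpen j) σ) (s t : Simp m) :
    correction A k (toMap σ s) = correction A k (toMap σ t) := by
  have hb : k ≠ 0 → ∀ j ≠ k, bit j (toMap σ s) = bit j (toMap σ t) := fun h0 j hj =>
    bit_eq_of_inSet (h 0 h0.symm) (h j hj) s t
  fin_cases k
  · rfl
  · change A _ _ _ = A _ _ _
    rw [hb (by decide) 2 (by decide), hb (by decide) 3 (by decide)]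
  · change A _ _ _ + A _ _ _ = A _ _ _ + A _ _ _
    rw [hb (by decide) 1 (by decide), hb (by decide) 3 (by decide)]
  · change A _ _ _ + A _ _ _ + A _ _ _ + A _ _ _ = A _ _ _ + A _ _ _ + A _ _ _ + A _ _ _
    rw [hb (by decide) 1 (by decide), hb (by decide) 2 (by decide)]

/-- The cochain of a function on points. -/
def pointCochain {X : Type} [TopologicalSpace X] (f : X → ZMod 2) : Cochain (sing X) 0 :=
  fun σ => f (toMap σ (stdSimplex.vertex 0))

lemma coboundary_pointCochain {X : Type} [TopologicalSpace X] (f : X → ZMod 2)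
    (σ : (sing X) _⦋1⦌) : coboundary (sing X) 0 (pointCochain f) σ =
      f (toMap σ (stdSimplex.vertex 1)) + f (toMap σ (stdSimplex.vertex 0)) := by
  rw [coboundary_apply, Fin.sum_univ_two]
  simp only [pointCochain, δ_eq_pull, toMap_pull, aff_vertex]
  rfl

/-- A `3`-cocycle on `ℝP^3` is a coboundary if its Čech class is trivial. -/
lemma Zigzag.mem_coboundaries {φ : Cochain (sing (RP 3)) 3} (z : Zigzag φ)
    (hφ : φ ∈ cocycles (sing (RP 3)) 3) (h : z.total = 0) : φ ∈ coboundaries (sing (RP 3)) 3 := by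
  -- For a three-element `s` the complement is one index `k`, and `G s` is the `k`-th correction on
  -- the intersection that omits `k`.
  set G : Finset (Fin 4) → Cochain (sing (RP 3)) 0 :=
    fun s => ∑ k ∈ sᶜ, pointCochain (correction z.value k) with hG
  have hGδ : ∀ s : Finset (Fin 4), s.card = 3 → ∀ σ, InSet (inter affineOpen s) σ →
      coboundary (sing (RP 3)) 0 (G s) σ = 0 := by
    intro s hs σ hσ
    rw [hG, map_sum, Finset.sum_apply]
    refine Finset.sum_eq_zero fun k hk => ?_
    have hj : ∀ j ≠ k, j ∈ s := by
      intro j hj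
      by_contra hjs
      have h2 : ({j, k} : Finset (Fin 4)) ⊆ sᶜ := by
        rw [Finset.insert_subset_iff, Finset.singleton_subset_iff]
        exact ⟨Finset.mem_compl.mpr hjs, hk⟩
      have h3 := Finset.card_le_card h2
      rw [Finset.card_pair hj, Finset.card_compl, hs, Fintype.card_fin] at h3
      omega
    rw [coboundary_pointCochain, correction_eq_of_inSet (fun j hjk t => hσ t j (hj j hjk))]
    exact zmodTwo_add_self _
  have hGsum : ∀ σ, cech G Finset.univ σ = ∑ k, correction z.value k (toMap σ (stdSimplex.vertex 0)) := by
    intro σ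
    rw [cech_apply]
    refine Finset.sum_congr rfl fun k _ => ?_
    have : (Finset.univ.erase k)ᶜ = ({k} : Finset (Fin 4)) := by
      ext j
      simp
    simp only [hG, this, Finset.sum_singleton]
    rfl
  -- Adding `G` kills the Čech coboundary of `C₃` on the fourfold intersection, and leaves `δC₃`
  -- unchanged since `G` is locally constant.
  obtain ⟨D, hD⟩ := exists_eq_cech (affineOpen (n := 3)) three_ne_zero (C := z.C₃ + G) (by
    intro s hs σ hσ
    obtain rfl : s = Finset.univ := Finset.eq_univ_of_card s (by simpa using hs)
    have hx : toMap σ (stdSimplex.vertex 0) ∈ inter affineOpen Finset.univ := hσ _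
    rw [cech_add, Pi.add_apply, hGsum, sum_correction h, Zigzag.value,
      ← closed_apply_eq_signPoint z.closed hx, pt_toMap]
    exact zmodTwo_add_self _)
  refine mem_coboundaries_of_cech (isOpen_affineOpen (n := 3)) ?_ hφ z.h₁ z.h₂ (C₃ := z.C₃ + G)
    (D := D) ?_ hD
  · exact Set.eq_univ_of_forall fun ℓ => Set.mem_iUnion.mpr (exists_mem_affineOpen ℓ)
  · intro s hs σ hσ
    rw [Pi.add_apply, map_add, Pi.add_apply, hGδ s hs σ hσ, add_zero, z.h₃ s hs σ hσ]

/-- The sum of the primitives of two cocycles. -/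
def Zigzag.add {φ ψ : Cochain (sing (RP 3)) 3} (y : Zigzag φ) (z : Zigzag ψ) : Zigzag (φ + ψ) where
  C₁ := y.C₁ + z.C₁
  C₂ := y.C₂ + z.C₂
  C₃ := y.C₃ + z.C₃
  h₁ s hs σ hσ := by
    rw [Pi.add_apply, map_add, Pi.add_apply, Pi.add_apply, y.h₁ s hs σ hσ, z.h₁ s hs σ hσ]
  h₂ s hs σ hσ := by
    rw [Pi.add_apply, map_add, cech_add, Pi.add_apply, Pi.add_apply, y.h₂ s hs σ hσ,
      z.h₂ s hs σ hσ]
  h₃ s hs σ hσ := by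
    rw [Pi.add_apply, map_add, cech_add, Pi.add_apply, Pi.add_apply, y.h₃ s hs σ hσ,
      z.h₃ s hs σ hσ]

lemma Zigzag.total_add {φ ψ : Cochain (sing (RP 3)) 3} (y : Zigzag φ) (z : Zigzag ψ) :
    (y.add z).total = y.total + z.total := by
  simp [Zigzag.total, Zigzag.value, Zigzag.add, cech_add, Finset.sum_add_distrib]

/-- The third cohomology of `ℝP^3` has at most one non-trivial class. -/
lemma add_mem_coboundaries {φ ψ : Cochain (sing (RP 3)) 3} (hφ : φ ∈ cocycles (sing (RP 3)) 3)
    (hψ : ψ ∈ cocycles (sing (RP 3)) 3) (hφ' : φ ∉ coboundaries (sing (RP 3)) 3)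
    (hψ' : ψ ∉ coboundaries (sing (RP 3)) 3) : φ + ψ ∈ coboundaries (sing (RP 3)) 3 := by
  obtain ⟨y⟩ := Zigzag.nonempty hφ
  obtain ⟨z⟩ := Zigzag.nonempty hψ
  -- Totals are attached to chosen zigzags; independence of the choice is not needed, since zigzags
  -- and their totals add.
  have hy : y.total ≠ 0 := fun h => hφ' (y.mem_coboundaries hφ h)
  have hz : z.total ≠ 0 := fun h => hψ' (z.mem_coboundaries hψ h)
  refine (y.add z).mem_coboundaries (add_mem hφ hψ) ?_
  rw [Zigzag.total_add]
  exact (by decide : ∀ a b : ZMod 2, a ≠ 0 → b ≠ 0 → a + b = 0) _ _ hy hz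

end RP

end

noncomputable section

/-! ### Evaluation of cocycles on homology classes -/

namespace ModTwo

open CategoryTheory Simplicial

section Evaluation

variable {S : SSet.{0}}

/-- A cochain with a given extension to a functional on chains. -/
lemma cochainHom_eq {n : ℕ} (f : (S.chainComplex coeff).X n ⟶ coeff) :
    cochainHom (fun σ => (S.ιChainComplex σ ≫ f).hom 1) = f := by
  refine SSet.chainComplex_hom_ext fun σ => ?_
  rw [ι_cochainHom]
  ext
  simp

lemma exists_functional_ne_zero {M : ModuleCat.{0} (ZMod 2)} {x : M} (hx : x ≠ 0) :
    ∃ f : M ⟶ coeff, f.hom x ≠ 0 := by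
  by_contra! h
  exact hx ((Module.forall_dual_apply_eq_zero_iff (ZMod 2) x).mp fun f => h (ModuleCat.ofHom f))

/-- Cocycles separate homology classes. -/
lemma exists_evalCocycle_ne_zero {n : ℕ} {x : Homology S n} (hx : x ≠ 0) :
    ∃ φ : cocycles S n, (evalCocycle φ).hom x ≠ 0 := by
  -- Homology embeds in chains modulo boundaries. A functional there that detects `x` is a
  -- functional on chains killing boundaries, that is, a cocycle.
  have hx' : ((S.chainComplex coeff).homologyι n).hom x ≠ 0 := fun h =>
    hx ((ModuleCat.mono_iff_injective ((S.chainComplex coeff).homologyι n)).mp inferInstance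
      (h.trans (map_zero _).symm))
  obtain ⟨f, hf⟩ := exists_functional_ne_zero hx'
  set g := (S.chainComplex coeff).pOpcycles n ≫ f with hg
  set φ : Cochain S n := fun σ => (S.ιChainComplex σ ≫ g).hom 1 with hφ
  have hφg : cochainHom φ = g := cochainHom_eq g
  have hc : φ ∈ cocycles S n := by
    have h0 : cochainHom (coboundary S n φ) = 0 := by
      rw [← d_cochainHom, hφg, hg, HomologicalComplex.d_pOpcycles_assoc, Limits.zero_comp]
    change coboundary S n φ = 0
    funext σ
    have h1 := congrArg (fun k : (S.chainComplex coeff).X (n + 1) ⟶ coeff =>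
      (S.ιChainComplex σ ≫ k).hom 1) h0
    simpa [ι_cochainHom] using h1
  refine ⟨⟨φ, hc⟩, ?_⟩
  have : evalCocycle ⟨φ, hc⟩ = (S.chainComplex coeff).homologyι n ≫ f := by
    rw [evalCocycle]
    congr 1
    rw [← cancel_epi ((S.chainComplex coeff).pOpcycles n)]
    simp [hφg, hg]
  rw [this]
  exact hf

/-- The homology class of a finite sum of simplices. -/
lemma exists_homology_of_sum {n : ℕ} {J : Type} [Fintype J] (σ : J → S _⦋n + 1⦌)
    (h : ∀ ψ : Cochain S n, ∑ j, coboundary S n ψ (σ j) = 0) :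
    ∃ c : Homology S (n + 1), ∀ φ : cocycles S (n + 1),
      (evalCocycle φ).hom c = ∑ j, φ.1 (σ j) := by
  set z : coeff ⟶ (S.chainComplex coeff).X (n + 1) := ∑ j, S.ιChainComplex (σ j) with hz
  have hzφ : ∀ φ : Cochain S (n + 1), (z ≫ cochainHom φ).hom 1 = ∑ j, φ (σ j) := by
    intro φ
    simp [hz, Preadditive.sum_comp, ι_cochainHom, ModuleCat.hom_sum]
  -- Over the field `ℤ/2` functionals separate chains, and every functional is a cochain; so it
  -- suffices that all coboundaries sum to zero.
  have hzd : z ≫ (S.chainComplex coeff).d (n + 1) n = 0 := by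
    ext
    by_contra hne
    obtain ⟨f, hf⟩ := exists_functional_ne_zero hne
    rw [← cochainHom_eq f] at hf
    refine hf ?_
    change ((z ≫ (S.chainComplex coeff).d (n + 1) n) ≫ cochainHom _).hom 1 = 0
    rw [Category.assoc, d_cochainHom, hzφ, h]
  refine ⟨((S.chainComplex coeff).liftCycles z n (by simp) hzd ≫
    (S.chainComplex coeff).homologyπ (n + 1)).hom 1, fun φ => ?_⟩
  rw [← hzφ]
  change (((S.chainComplex coeff).liftCycles z n (by simp) hzd ≫
    (S.chainComplex coeff).homologyπ (n + 1)) ≫ evalCocycle φ).hom 1 = _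
  congr 2
  rw [evalCocycle]
  simp

end Evaluation

section Local

variable {X : Type} [TopologicalSpace X]

/-- A class on which a cocycle that vanishes on `X ∖ {x}` does not vanish has a non-trivial
restriction to the local homology at `x`. -/
lemma localRestriction_ne_zero {n : ℕ} {x : X} {φ : cocycles (sing X) n}
    (hφ : ∀ σ, InSet {x}ᶜ σ → φ.1 σ = 0) {c : Homology (sing X) n}
    (hc : (evalCocycle φ).hom c ≠ 0) : (localRestriction X x n).hom c ≠ 0 := by
  have hcoc : coboundary (sing X) n φ.1 = 0 := φ.2
  have hz : cochainHom (0 : Cochain (sing X) (n + 1)) = 0 := by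
    refine SSet.chainComplex_hom_ext fun σ => ?_
    rw [ι_cochainHom]
    ext
    simp
  -- The cocycle is viewed as a chain map to `ℤ/2` in degree `n`. It kills the chains of `X ∖ {x}`,
  -- so evaluation on homology factors through the local restriction.
  let g : (sing X).chainComplex coeff ⟶
      (HomologicalComplex.single _ (ComplexShape.down ℕ) n).obj coeff :=
    HomologicalComplex.mkHomToSingle (cochainHom φ.1) (by
      rintro i rfl
      rw [d_cochainHom, hcoc, hz])
  have hi : SSet.chainComplexMap (puncturedIncl X x) coeff ≫ g = 0 := by
    refine HomologicalComplex.hom_ext _ _ fun k => ?_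
    by_cases hk : k = n
    · subst hk
      rw [HomologicalComplex.comp_f, HomologicalComplex.mkHomToSingle_f, ← Category.assoc]
      have : (SSet.chainComplexMap (puncturedIncl X x) coeff).f k ≫ cochainHom φ.1 = 0 := by
        refine SSet.chainComplex_hom_ext fun σ => ?_
        rw [SSet.ι_chainComplexMap_f_assoc, ι_cochainHom, hφ]
        · ext
          simp
        · intro t
          exact (toMap σ t).2
      rw [this]
      simp
    · exact (HomologicalComplex.isZero_single_obj_X _ _ _ _ hk).eq_of_tgt _ _
  have hfac : Limits.cokernel.π (SSet.chainComplexMap (puncturedIncl X x) coeff) ≫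
      Limits.cokernel.desc _ g hi = g := Limits.cokernel.π_desc _ _ _
  have hg : HomologicalComplex.homologyMap g n ≫
      (HomologicalComplex.singleObjHomologySelfIso _ n coeff).hom = evalCocycle φ := by
    rw [← cancel_epi (((sing X).chainComplex coeff).homologyπ n), evalCocycle]
    simp [HomologicalComplex.singleObjCyclesSelfIso_hom, g]
  intro h0
  apply hc
  rw [← hg, ← hfac, HomologicalComplex.homologyMap_comp]
  change _ = (0 : ZMod 2)
  simp only [ModuleCat.hom_comp, LinearMap.comp_apply]
  erw [h0]
  simp

end Local

end ModTwo

end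

noncomputable section

/-! ### Lifts of singular simplices of `ℝP^n` -/

namespace RP

open ModTwo

variable {n : ℕ}

/-- The entries of the orthogonal projection onto a line. -/
def projEntry (i j : Fin (n + 1)) (ℓ : RP n) : ℝ := ℓ.rep i * ℓ.rep j / (ℓ.rep ⬝ᵥ ℓ.rep)

lemma dotProduct_self_ne_zero {v : Fin (n + 1) → ℝ} (hv : v ≠ 0) : v ⬝ᵥ v ≠ 0 := fun h =>
  hv (dotProduct_self_eq_zero.mp h)

lemma projEntry_mk (i j : Fin (n + 1)) (v : Fin (n + 1) → ℝ) (hv : v ≠ 0) :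
    projEntry i j (mk v hv) = v i * v j / (v ⬝ᵥ v) := by
  obtain ⟨a, ha, h⟩ := exists_smul_rep v hv
  have hd := dotProduct_self_ne_zero (mk v hv).rep_nonzero
  rw [projEntry]
  conv_rhs => rw [h]
  simp only [Pi.smul_apply, smul_eq_mul, smul_dotProduct, dotProduct_smul]
  field_simp

lemma continuous_projEntry (i j : Fin (n + 1)) : Continuous (projEntry (n := n) i j) := by
  rw [isQuotientMap_mk'.continuous_iff]
  have : projEntry i j ∘ Projectivization.mk' ℝ =
      fun v : { v : Fin (n + 1) → ℝ // v ≠ 0 } => v.1 i * v.1 j / (v.1 ⬝ᵥ v.1) := by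
    ext v
    exact projEntry_mk i j v.1 v.2
  rw [this]
  have hc : ∀ i, Continuous fun v : { v : Fin (n + 1) → ℝ // v ≠ 0 } => v.1 i := fun i =>
    (continuous_apply i).comp continuous_subtype_val
  refine ((hc i).mul (hc j)).div ?_ fun v => dotProduct_self_ne_zero v.2
  exact continuous_finsetSum _ fun i _ => (hc i).mul (hc i)

/-- The squared cosine of the angle between two lines. -/
def cosSq (ℓ ℓ' : RP n) : ℝ := ∑ i, ∑ j, projEntry i j ℓ * projEntry i j ℓ'

lemma cosSq_mk (v w : Fin (n + 1) → ℝ) (hv : v ≠ 0) (hw : w ≠ 0) :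
    cosSq (mk v hv) (mk w hw) = (v ⬝ᵥ w) ^ 2 / ((v ⬝ᵥ v) * (w ⬝ᵥ w)) := by
  simp only [cosSq, projEntry_mk, div_mul_div_comm]
  simp only [← Finset.sum_div]
  congr 1
  rw [sq, dotProduct, Finset.sum_mul_sum]
  exact Finset.sum_congr rfl fun i _ => Finset.sum_congr rfl fun j _ => by ring

lemma cosSq_self (ℓ : RP n) : cosSq ℓ ℓ = 1 := by
  have hd := dotProduct_self_ne_zero ℓ.rep_nonzero
  conv_lhs => rw [← ℓ.mk_rep]
  rw [cosSq_mk, sq, div_self (mul_ne_zero hd hd)]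

/-- The orthogonal projection of a vector to a line. -/
def projVec (ℓ : RP n) (u : Fin (n + 1) → ℝ) : Fin (n + 1) → ℝ := fun i => ∑ j, projEntry i j ℓ * u j

lemma projVec_mk (v u : Fin (n + 1) → ℝ) (hv : v ≠ 0) :
    projVec (mk v hv) u = ((v ⬝ᵥ u) / (v ⬝ᵥ v)) • v := by
  ext i
  simp only [projVec, projEntry_mk, Pi.smul_apply, smul_eq_mul, dotProduct, Finset.sum_div,
    Finset.sum_mul]
  exact Finset.sum_congr rfl fun j _ => by ring

/-- Projecting onto a line that is not orthogonal to `u` gives a nonzero vector spanning that line.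
This transports a lift from one line to a nearby one. -/
lemma projVec_spec {u : Fin (n + 1) → ℝ} (hu : u ≠ 0) {ℓ : RP n} (h : cosSq (mk u hu) ℓ ≠ 0) :
    ∃ h0 : projVec ℓ u ≠ 0, mk (projVec ℓ u) h0 = ℓ := by
  obtain ⟨v, hv, rfl⟩ : ∃ v, ∃ hv : v ≠ 0, mk v hv = ℓ := ⟨ℓ.rep, ℓ.rep_nonzero, ℓ.mk_rep⟩
  have hvu : v ⬝ᵥ u ≠ 0 := fun h0 => h (by rw [cosSq_mk, dotProduct_comm, h0]; simp)
  have hc : (v ⬝ᵥ u) / (v ⬝ᵥ v) ≠ 0 := div_ne_zero hvu (dotProduct_self_ne_zero hv)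
  have h0 : projVec (mk v hv) u ≠ 0 := by
    rw [projVec_mk]
    exact smul_ne_zero hc hv
  refine ⟨h0, ?_⟩
  rw [Projectivization.mk_eq_mk_iff']
  exact ⟨_, (projVec_mk v u hv).symm⟩

/-- The contraction of a simplex to a vertex. -/
def contraction {k : ℕ} (p : Simp k × unitInterval) : Simp k :=
  ⟨(1 - p.2.1) • (stdSimplex.vertex 0 : Simp k).1 + p.2.1 • p.1.1,
    convex_stdSimplex ℝ _ (stdSimplex.vertex 0 : Simp k).2 p.1.2 (sub_nonneg.mpr p.2.2.2) p.2.2.1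
      (sub_add_cancel _ _)⟩

lemma continuous_contraction {k : ℕ} : Continuous (contraction (k := k)) := by
  refine Continuous.subtype_mk ?_ _
  fun_prop

/-- Every singular simplex of `ℝP^n` lifts to `ℝ^{n+1} ∖ {0}`. -/
theorem exists_lift {k : ℕ} (σ : C(Simp k, RP n)) :
    ∃ G : C(Simp k, Fin (n + 1) → ℝ), ∃ h : ∀ t, G t ≠ 0, ∀ t, mk (G t) (h t) = σ t := by
  -- The simplex is contracted to a vertex. By uniform continuity, lines at nearby times of the
  -- contraction have squared cosine close to `1`, uniformly in `t`, hence are never orthogonal.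
  have hcos : Continuous fun q : Simp k × unitInterval × unitInterval =>
      cosSq (σ (contraction (q.1, q.2.1))) (σ (contraction (q.1, q.2.2))) := by
    have h1 : Continuous fun q : Simp k × unitInterval × unitInterval =>
        σ (contraction (q.1, q.2.1)) := σ.continuous.comp (continuous_contraction.comp (by fun_prop))
    have h2 : Continuous fun q : Simp k × unitInterval × unitInterval =>
        σ (contraction (q.1, q.2.2)) := σ.continuous.comp (continuous_contraction.comp (by fun_prop))
    refine continuous_finsetSum _ fun i _ => continuous_finsetSum _ fun j _ => ?_
    exact ((continuous_projEntry i j).comp h1).mul ((continuous_projEntry i j).comp h2)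
  obtain ⟨δ, hδ, hu⟩ := Metric.uniformContinuous_iff.mp
    (CompactSpace.uniformContinuous_of_continuous hcos) 1 one_pos
  have hne : ∀ t s s', dist s s' < δ →
      cosSq (σ (contraction (t, s))) (σ (contraction (t, s'))) ≠ 0 := by
    intro t s s' hs h0
    have := @hu (t, s, s) (t, s, s') (by simpa [Prod.dist_eq] using hs)
    rw [cosSq_self, h0] at this
    simp at this
  obtain ⟨N, hN⟩ := exists_nat_one_div_lt hδ
  have hN0 : (0 : ℝ) < N + 1 := by positivity
  set s : ℕ → unitInterval := fun j => Set.projIcc 0 1 zero_le_one (j / (N + 1)) with hs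
  have hstep : ∀ j, dist (s j) (s (j + 1)) < δ := by
    intro j
    refine lt_of_le_of_lt ?_ hN
    refine (LipschitzWith.projIcc (zero_le_one (α := ℝ))).dist_le_mul _ _ |>.trans ?_
    rw [NNReal.coe_one, one_mul, Real.dist_eq, ← sub_div, abs_div, abs_of_pos hN0]
    simp
  have hind : ∀ j : ℕ, ∃ G : C(Simp k, Fin (n + 1) → ℝ), ∃ h : ∀ t, G t ≠ 0,
      ∀ t, mk (G t) (h t) = σ (contraction (t, s j)) := by
    intro j
    induction j with
    | zero =>
      refine ⟨.const _ (σ (stdSimplex.vertex 0)).rep, fun t => Projectivization.rep_nonzero _,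
        fun t => ?_⟩
      have : contraction (t, s 0) = stdSimplex.vertex 0 := by
        apply Subtype.ext
        simp [contraction, hs]
      rw [this]
      exact Projectivization.mk_rep _
    | succ j ih =>
      obtain ⟨G, hG, hGσ⟩ := ih
      have hσ : Continuous fun t => σ (contraction (t, s (j + 1))) :=
        σ.continuous.comp (continuous_contraction.comp (by fun_prop))
      have hp : ∀ t, ∃ h0 : projVec (σ (contraction (t, s (j + 1)))) (G t) ≠ 0,
          mk _ h0 = σ (contraction (t, s (j + 1))) := fun t =>
        projVec_spec (hG t) (by rw [hGσ]; exact hne t _ _ (hstep j))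
      -- The lift at the next time is the orthogonal projection of the current lift onto the next
      -- line.
      refine ⟨⟨fun t => projVec (σ (contraction (t, s (j + 1)))) (G t), ?_⟩,
        fun t => (hp t).choose, fun t => (hp t).choose_spec⟩
      refine continuous_pi fun i => continuous_finsetSum _ fun l _ => ?_
      exact ((continuous_projEntry i l).comp hσ).mul
        ((continuous_apply l).comp G.continuous)
  obtain ⟨G, hG, hGσ⟩ := hind (N + 1)
  refine ⟨G, hG, fun t => (hGσ t).trans ?_⟩
  have : contraction (t, s (N + 1)) = t := by
    have h1 : s (N + 1) = 1 := by
      rw [hs]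
      push_cast
      rw [div_self hN0.ne']
      simp
    apply Subtype.ext
    simp [contraction, h1]
  rw [this]

end RP

end

noncomputable section

/-! ### The first Stiefel–Whitney class -/

namespace ModTwo

open CategoryTheory Simplicial Bundle

/-! ### Comparison of orientations of two bases. -/

section Orientation

variable {r : ℕ} {M : Type} [AddCommMonoid M] [Module ℝ M]

lemma det_toMatrix_mul (b b' b'' : Module.Basis (Fin r) ℝ M) :
    (b.toMatrix b').det * (b'.toMatrix b'').det = (b.toMatrix b'').det := by
  rw [← Matrix.det_mul, Module.Basis.toMatrix_mul_toMatrix]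

lemma det_toMatrix_ne_zero (b b' : Module.Basis (Fin r) ℝ M) : (b.toMatrix b').det ≠ 0 := by
  intro h
  have h1 := det_toMatrix_mul b b' b
  rw [h, zero_mul, Module.Basis.toMatrix_self, Matrix.det_one] at h1
  exact zero_ne_one h1

open Classical in
/-- `0` if the bases have the same orientation and `1` otherwise. -/
def orient (b b' : Module.Basis (Fin r) ℝ M) : ZMod 2 := if 0 < (b.toMatrix b').det then 0 else 1

lemma orient_eq_zero_iff (b b' : Module.Basis (Fin r) ℝ M) :
    orient b b' = 0 ↔ 0 < (b.toMatrix b').det := by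
  simp [orient]

lemma orient_add (b b' b'' : Module.Basis (Fin r) ℝ M) :
    orient b b' + orient b' b'' = orient b b'' := by
  rw [orient, orient, orient, ← det_toMatrix_mul b b' b'']
  rcases (det_toMatrix_ne_zero b b').lt_or_gt with h | h <;>
    rcases (det_toMatrix_ne_zero b' b'').lt_or_gt with h' | h'
  · simp [h.not_gt, h'.not_gt, mul_pos_of_neg_of_neg h h', zmodTwo_add_self]
  · simp [h.not_gt, h', (mul_neg_of_neg_of_pos h h').not_gt]
  · simp [h, h'.not_gt, (mul_neg_of_pos_of_neg h h').not_gt]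
  · simp [h, h', mul_pos h h']

lemma orient_self (b : Module.Basis (Fin r) ℝ M) : orient b b = 0 := by
  rw [orient_eq_zero_iff, Module.Basis.toMatrix_self, Matrix.det_one]
  exact one_pos

/-- A basis with one vector reversed. -/
lemma exists_reversed_basis (b : Module.Basis (Fin r) ℝ M) (i₀ : Fin r) :
    ∃ b' : Module.Basis (Fin r) ℝ M, (∀ i, b' i = (if i = i₀ then (-1 : ℝ) else 1) • b i) ∧
      ∀ c : Module.Basis (Fin r) ℝ M, (c.toMatrix b').det = -(c.toMatrix b).det := by
  let b' := b.isUnitSMul (w := fun i => if i = i₀ then (-1 : ℝ) else 1) fun i => by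
    split_ifs <;> simp
  have hb' : ∀ i, b' i = (if i = i₀ then (-1 : ℝ) else 1) • b i := fun i =>
    Module.Basis.isUnitSMul_apply _ i
  refine ⟨b', hb', fun c => ?_⟩
  have h : c.toMatrix b' = Matrix.of fun i j => (if j = i₀ then (-1 : ℝ) else 1) *
      c.toMatrix b i j := by
    ext i j
    rw [Matrix.of_apply, Module.Basis.toMatrix_apply, hb', map_smul, Module.Basis.toMatrix_apply]
    rfl
  rw [h, Matrix.det_mul_row, Finset.prod_ite_eq' Finset.univ i₀ fun _ => (-1 : ℝ)]
  simp

end Orientation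

/-! ### Frames along simplices, and the orientation class. -/

section Frames

variable {X : Type} [TopologicalSpace X] (F : Type) [NormedAddCommGroup F] [NormedSpace ℝ F]
  (E : X → Type) [∀ x, AddCommMonoid (E x)] [∀ x, Module ℝ (E x)]
  [TopologicalSpace (TotalSpace F E)]

/-- A continuous frame of a vector bundle along a map. -/
structure Frame {Y : Type} [TopologicalSpace Y] (σ : Y → X) where
  basis : ∀ t, Module.Basis (Fin (Module.finrank ℝ F)) ℝ (E (σ t))
  continuous_basis : ∀ i, Continuous fun t => (⟨σ t, basis t i⟩ : TotalSpace F E)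

variable {F E}

/-- The restriction of a frame. -/
def Frame.comp {Y Z : Type} [TopologicalSpace Y] [TopologicalSpace Z] {σ : Y → X}
    (e : Frame F E σ) {f : Z → Y} (hf : Continuous f) : Frame F E fun z => σ (f z) where
  basis z := e.basis (f z)
  continuous_basis i := (e.continuous_basis i).comp hf

variable [∀ x, TopologicalSpace (E x)] [FiberBundle F E] [VectorBundle ℝ F E]
  [FiniteDimensional ℝ F]

/-- In a local trivialization the change-of-frame determinant is the quotient of the determinants of
the two frames against a fixed basis of `F`. -/
lemma Frame.continuous_det {Y : Type} [TopologicalSpace Y] {σ : Y → X} (hσ : Continuous σ)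
    (e e' : Frame F E σ) : Continuous fun t => ((e.basis t).toMatrix (e'.basis t)).det := by
  refine continuous_iff_continuousAt.mpr fun t₀ => ?_
  set T := trivializationAt F E (σ t₀) with hT
  set B := Module.finBasis ℝ F
  set m : Frame F E σ → Y → Matrix (Fin (Module.finrank ℝ F)) (Fin (Module.finrank ℝ F)) ℝ :=
    fun e t => Matrix.of fun i j => B.repr (T ⟨σ t, e.basis t j⟩).2 i with hm
  have hbase : ∀ᶠ t in nhds t₀, σ t ∈ T.baseSet :=
    hσ.continuousAt.eventually (T.open_baseSet.mem_nhds (mem_baseSet_trivializationAt F E _))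
  have hmc : ∀ e : Frame F E σ, ContinuousAt (fun t => (m e t).det) t₀ := by
    intro e
    have h1 : ContinuousAt (fun t => m e t) t₀ := by
      refine continuousAt_pi.mpr fun i => continuousAt_pi.mpr fun j => ?_
      have h2 := ((FiberBundle.continuousAt_totalSpace F
        (fun t => (⟨σ t, e.basis t j⟩ : TotalSpace F E)) (x₀ := t₀)).mp
          ((e.continuous_basis j).continuousAt (x := t₀))).2
      exact (LinearMap.continuous_of_finiteDimensional (B.coord i)).continuousAt.comp h2
    exact (continuous_id.matrix_det).continuousAt.comp h1
  have hmd : ∀ e : Frame F E σ, ∀ t (ht : σ t ∈ T.baseSet),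
      m e t = (B.map (T.linearEquivAt ℝ (σ t) ht).symm).toMatrix (e.basis t) := by
    intro e t ht
    ext i j
    simp [hm, Module.Basis.toMatrix_apply]
  have hne : (m e t₀).det ≠ 0 := by
    rw [hmd e t₀ (mem_baseSet_trivializationAt F E _)]
    exact det_toMatrix_ne_zero _ _
  refine ((hmc e').div (hmc e) hne).congr ?_
  filter_upwards [hbase] with t ht
  rw [Pi.div_apply, hmd e t ht, hmd e' t ht, div_eq_iff (det_toMatrix_ne_zero _ _), mul_comm,
    det_toMatrix_mul]

/-- The determinant is continuous and never zero, so its sign is constant on a connected domain. -/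
lemma Frame.orient_eq {Y : Type} [TopologicalSpace Y] [PreconnectedSpace Y] {σ : Y → X}
    (hσ : Continuous σ) (e e' : Frame F E σ) (s t : Y) :
    orient (e.basis s) (e'.basis s) = orient (e.basis t) (e'.basis t) := by
  have hc := e.continuous_det hσ e'
  have h : ∀ s t : Y, 0 < ((e.basis s).toMatrix (e'.basis s)).det →
      0 < ((e.basis t).toMatrix (e'.basis t)).det := by
    intro s t hs
    by_contra ht
    obtain ⟨u, hu⟩ := mem_range_of_exists_le_of_exists_ge hc ⟨t, not_lt.mp ht⟩ ⟨s, hs.le⟩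
    exact det_toMatrix_ne_zero _ _ hu
  rw [orient, orient]
  congr 1
  exact propext ⟨h s t, h t s⟩

/-- The orientation cochain is determined by the orientation of any frame along the path. -/
lemma orientationCochain_eq [Nontrivial F]
    (b : ∀ x, Module.Basis (Fin (Module.finrank ℝ F)) ℝ (E x)) (σ : (sing X) _⦋1⦌)
    (e : Frame F E (toMap σ)) : orientationCochain F E b σ =
      orient (b _) (e.basis (stdSimplex.vertex 0)) + orient (b _) (e.basis (stdSimplex.vertex 1)) := by
  by_cases h : PreservesOrientation F E b (toMap σ)
  · rw [orientationCochain, if_pos h]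
    obtain ⟨e', he', hpos⟩ := h
    have h0 := (orient_eq_zero_iff _ _).mpr (hpos 0)
    have h1 := (orient_eq_zero_iff _ _).mpr (hpos 1)
    rw [← orient_add _ (e' (stdSimplex.vertex 0)), ← orient_add _ (e' (stdSimplex.vertex 1)), h0, h1,
      zero_add, zero_add,
      (Frame.mk e' he').orient_eq (toMap σ).continuous e (stdSimplex.vertex 0) (stdSimplex.vertex 1)]
    exact (zmodTwo_add_self _).symm
  · rw [orientationCochain, if_neg h]
    -- If both ends compare positively, `e` itself preserves the orientation; if both compare
    -- negatively, `e` with one vector reversed does. Nontriviality of `F` provides a vector to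
    -- reverse.
    have key : ∀ c d : ZMod 2, ¬ (c = 0 ∧ d = 0) → ¬ (c = 1 ∧ d = 1) → 1 = c + d := by decide
    refine key _ _ (fun h0 => h ⟨e.basis, e.continuous_basis, ?_⟩) fun h1 => h ?_
    · intro k
      fin_cases k
      · exact (orient_eq_zero_iff _ _).mp h0.1
      · exact (orient_eq_zero_iff _ _).mp h0.2
    · choose e' he' hdet using fun t =>
        exists_reversed_basis (e.basis t) (⟨0, Module.finrank_pos⟩ : Fin (Module.finrank ℝ F))
      have hneg : ∀ k, orient (b _) (e.basis (stdSimplex.vertex k)) = 1 →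
          0 < ((b (toMap σ (stdSimplex.vertex k))).toMatrix (e' (stdSimplex.vertex k))).det := by
        intro k hk
        rw [hdet, neg_pos]
        refine lt_of_le_of_ne (not_lt.mp fun hlt => ?_) (det_toMatrix_ne_zero _ _)
        rw [(orient_eq_zero_iff _ _).mpr hlt] at hk
        exact zero_ne_one hk
      refine ⟨e', fun i => ?_, fun k => ?_⟩
      · simp only [he']
        refine continuous_iff_continuousAt.mpr fun t₀ => ?_
        have hc := (FiberBundle.continuousAt_totalSpace F
          (fun t => (⟨toMap σ t, e.basis t i⟩ : TotalSpace F E)) (x₀ := t₀)).mp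
            ((e.continuous_basis i).continuousAt (x := t₀))
        refine (FiberBundle.continuousAt_totalSpace F _).mpr ⟨hc.1, ?_⟩
        set T := trivializationAt F E (toMap σ t₀) with hT
        refine (hc.2.const_smul (if i = ⟨0, Module.finrank_pos⟩ then (-1 : ℝ) else 1)).congr ?_
        filter_upwards [(toMap σ).continuous.continuousAt.eventually
          (T.open_baseSet.mem_nhds (mem_baseSet_trivializationAt F E _))] with t ht
        exact (map_smul (T.linearEquivAt ℝ _ ht) _ _).symm
      · fin_cases k
        · exact hneg 0 h1.1
        · exact hneg 1 h1.2

/-- The orientation cochain is a cocycle if frames along singular triangles exist. -/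
lemma orientationCochain_mem_cocycles [Nontrivial F]
    (hF : ∀ τ : (sing X) _⦋2⦌, Nonempty (Frame F E (toMap τ)))
    (b : ∀ x, Module.Basis (Fin (Module.finrank ℝ F)) ℝ (E x)) :
    orientationCochain F E b ∈ cocycles (sing X) 1 := by
  change coboundary (sing X) 1 _ = 0
  funext τ
  obtain ⟨e⟩ := hF τ
  set o : Simp 2 → ZMod 2 := fun t => orient (b (toMap τ t)) (e.basis t) with ho
  have h : ∀ i, orientationCochain F E b ((sing X).δ i τ) =
      o (stdSimplex.vertex (i.succAbove 0)) + o (stdSimplex.vertex (i.succAbove 1)) := by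
    intro i
    rw [orientationCochain_eq b _ (e.comp (stdSimplex.continuous_map (SimplexCategory.δ i).toOrderHom))]
    change o (stdSimplex.map (SimplexCategory.δ i).toOrderHom (stdSimplex.vertex 0)) +
      o (stdSimplex.map (SimplexCategory.δ i).toOrderHom (stdSimplex.vertex 1)) = _
    rw [stdSimplex.map_vertex, stdSimplex.map_vertex]
    rfl
  rw [coboundary_apply]
  refine (Fin.sum_univ_three _).trans ?_
  rw [h, h, h]
  -- Each vertex of the triangle lies on two of its edges.
  exact (by decide : ∀ a b c : ZMod 2, b + c + (a + c) + (a + b) = 0) _ _ _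

/-- A change of the orientations of the fibres changes the orientation cochain by a coboundary. -/
lemma orientationCochain_sub_mem [Nontrivial F]
    (hF : ∀ σ : (sing X) _⦋1⦌, Nonempty (Frame F E (toMap σ)))
    (b b' : ∀ x, Module.Basis (Fin (Module.finrank ℝ F)) ℝ (E x)) :
    orientationCochain F E b - orientationCochain F E b' ∈ coboundaries (sing X) 1 := by
  refine ⟨RP.pointCochain fun x => orient (b x) (b' x), ?_⟩
  funext σ
  obtain ⟨e⟩ := hF σ
  rw [RP.coboundary_pointCochain, Pi.sub_apply, orientationCochain_eq b σ e,
    orientationCochain_eq b' σ e, ← orient_add (b _) (b' _) (e.basis (stdSimplex.vertex 0)),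
    ← orient_add (b _) (b' _) (e.basis (stdSimplex.vertex 1))]
  ring

/-- The first Stiefel–Whitney class exists and is unique. -/
lemma existsUnique_isFirstStiefelWhitneyClass [Nontrivial F]
    (hF₁ : ∀ σ : (sing X) _⦋1⦌, Nonempty (Frame F E (toMap σ)))
    (hF₂ : ∀ τ : (sing X) _⦋2⦌, Nonempty (Frame F E (toMap τ)))
    (b : ∀ x, Module.Basis (Fin (Module.finrank ℝ F)) ℝ (E x)) :
    ∃! w, IsFirstStiefelWhitneyClass F E w := by
  refine ⟨cohomologyClass ⟨_, orientationCochain_mem_cocycles hF₂ b⟩, ⟨b, _, rfl⟩, ?_⟩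
  rintro _ ⟨b', h', rfl⟩
  exact (Submodule.Quotient.eq _).mpr (orientationCochain_sub_mem hF₁ b' b)

/-- By uniqueness the class picked out by `epsilon` can be computed from any choice of fibre bases.
-/
lemma w₁_eq [Nontrivial F] (hF₁ : ∀ σ : (sing X) _⦋1⦌, Nonempty (Frame F E (toMap σ)))
    (hF₂ : ∀ τ : (sing X) _⦋2⦌, Nonempty (Frame F E (toMap τ)))
    (b : ∀ x, Module.Basis (Fin (Module.finrank ℝ F)) ℝ (E x)) :
    w₁ F E = cohomologyClass ⟨_, orientationCochain_mem_cocycles hF₂ b⟩ := by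
  have h := existsUnique_isFirstStiefelWhitneyClass hF₁ hF₂ b
  exact h.unique (Classical.epsilon_spec h.exists) ⟨b, _, rfl⟩

end Frames

end ModTwo

end

noncomputable section

/-! ### Frames of the canonical line bundle -/

namespace RP

open ModTwo CategoryTheory Simplicial Bundle

variable {n : ℕ}

instance uniqueFinrankReal : Unique (Fin (Module.finrank ℝ ℝ)) := by
  rw [Module.finrank_self]
  infer_instance

lemma submodule_eq_span {ℓ : RP n} {v : Fin (n + 1) → ℝ} {hv : v ≠ 0} (h : mk v hv = ℓ) :
    Submodule.span ℝ {v} = ℓ.submodule := by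
  rw [← h]
  exact (Projectivization.submodule_mk v hv).symm

/-- The basis of a line that is given by a nonzero vector. -/
def vecBasis {ℓ : RP n} {v : Fin (n + 1) → ℝ} {hv : v ≠ 0} (h : mk v hv = ℓ) :
    Module.Basis (Fin (Module.finrank ℝ ℝ)) ℝ (Taut n ℓ) :=
  (Module.Basis.singleton (Fin (Module.finrank ℝ ℝ)) ℝ).map
    ((LinearEquiv.toSpanNonzeroSingleton ℝ _ v hv).trans (LinearEquiv.ofEq _ _ (submodule_eq_span h)))

lemma vecBasis_coe {ℓ : RP n} {v : Fin (n + 1) → ℝ} {hv : v ≠ 0} (h : mk v hv = ℓ)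
    (i : Fin (Module.finrank ℝ ℝ)) : (show ℓ.submodule from vecBasis h i).1 = v := by
  rw [vecBasis, Module.Basis.map_apply, Module.Basis.singleton_apply]
  exact one_smul ℝ v

lemma orient_vecBasis_neg {ℓ : RP n} {v : Fin (n + 1) → ℝ} {hv : v ≠ 0} (h : mk v hv = ℓ)
    {hv' : -v ≠ 0} (h' : mk (-v) hv' = ℓ) : orient (vecBasis h) (vecBasis h') = 1 := by
  have hneg : ∀ i, vecBasis h' i = -vecBasis h i := fun i => Subtype.ext <| by
    refine (vecBasis_coe h' i).trans ?_
    exact congrArg Neg.neg (vecBasis_coe h i).symm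
  have hm : (vecBasis h).toMatrix (vecBasis h') = -(1 : Matrix _ _ ℝ) := by
    ext i j
    rw [Module.Basis.toMatrix_apply, hneg, map_neg, Finsupp.neg_apply, Module.Basis.repr_self,
      Matrix.neg_apply, Matrix.one_apply, Finsupp.single_apply]
    simp only [eq_comm]
  rw [orient, hm, Matrix.det_unique]
  simp

/-- The frame of the canonical line bundle that is given by a lift of a map. -/
def liftFrame {k : ℕ} {σ : Simp k → RP n} (hσ : Continuous σ) {G : Simp k → Fin (n + 1) → ℝ}
    (hG : Continuous G) {h : ∀ t, G t ≠ 0} (e : ∀ t, mk (G t) (h t) = σ t) : Frame ℝ (Taut n) σ where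
  basis t := vecBasis (e t)
  continuous_basis i := by
    rw [isInducing_tautIncl.continuous_iff]
    refine hσ.prodMk (hG.congr fun t => (vecBasis_coe (e t) i).symm)

lemma nonempty_frame {k : ℕ} (σ : (sing (RP n)) _⦋k⦌) : Nonempty (Frame ℝ (Taut n) (toMap σ)) := by
  obtain ⟨G, h, e⟩ := exists_lift (toMap σ)
  exact ⟨liftFrame (toMap σ).continuous G.continuous e⟩

/-- The orientations of the lines that are given by the representatives. -/
def repBasis (ℓ : RP n) : Module.Basis (Fin (Module.finrank ℝ ℝ)) ℝ (Taut n ℓ) :=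
  vecBasis ℓ.mk_rep

open Classical in
/-- The orientation of a nonzero vector in its line. -/
def side (v : Fin (n + 1) → ℝ) : ZMod 2 :=
  if hv : v ≠ 0 then orient (repBasis (mk v hv)) (vecBasis (hv := hv) rfl) else 0

lemma side_eq {ℓ : RP n} {v : Fin (n + 1) → ℝ} {hv : v ≠ 0} (h : mk v hv = ℓ) :
    orient (repBasis ℓ) (vecBasis h) = side v := by
  subst h
  rw [side, dif_pos hv]

lemma mk_neg {v : Fin (n + 1) → ℝ} (hv : v ≠ 0) : mk (-v) (neg_ne_zero.mpr hv) = mk v hv :=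
  (Projectivization.mk_eq_mk_iff' ℝ _ _ _ _).mpr ⟨-1, by simp⟩

lemma side_neg {v : Fin (n + 1) → ℝ} (hv : v ≠ 0) : side (-v) = side v + 1 := by
  rw [← side_eq (mk_neg hv), ← side_eq (hv := hv) rfl, ← orient_vecBasis_neg rfl (mk_neg hv),
    orient_add]

/-- The orientation cocycle of the canonical line bundle. -/
def tautCocycle (n : ℕ) : cocycles (sing (RP n)) 1 :=
  ⟨orientationCochain ℝ (Taut n) repBasis, orientationCochain_mem_cocycles nonempty_frame repBasis⟩

/-- Any lift of the path computes the cocycle from its two ends; all later computations rest on this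
formula. -/
lemma tautCocycle_apply (σ : (sing (RP n)) _⦋1⦌) {G : Simp 1 → Fin (n + 1) → ℝ} (hG : Continuous G)
    {h : ∀ t, G t ≠ 0} (e : ∀ t, mk (G t) (h t) = toMap σ t) :
    (tautCocycle n).1 σ = side (G (stdSimplex.vertex 0)) + side (G (stdSimplex.vertex 1)) := by
  rw [← side_eq (e _), ← side_eq (e _)]
  exact orientationCochain_eq repBasis σ (liftFrame (toMap σ).continuous hG e)

lemma existsUnique_w₁_taut : ∃! w, IsFirstStiefelWhitneyClass ℝ (Taut n) w :=
  existsUnique_isFirstStiefelWhitneyClass nonempty_frame nonempty_frame repBasis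

lemma w₁_taut : w₁ ℝ (Taut n) = cohomologyClass (tautCocycle n) :=
  w₁_eq nonempty_frame nonempty_frame repBasis

/-! ### The bundle `γ ⊕ ℝ`. -/

section Sum

lemma finrank_prod_eq : Fintype.card (Fin (Module.finrank ℝ ℝ) ⊕ Fin (Module.finrank ℝ ℝ)) =
    Module.finrank ℝ (ℝ × ℝ) := by
  simp

/-- A basis of `M ⊕ ℝ`. -/
def sumBasis {M : Type} [AddCommMonoid M] [Module ℝ M]
    (b : Module.Basis (Fin (Module.finrank ℝ ℝ)) ℝ M) :
    Module.Basis (Fin (Module.finrank ℝ (ℝ × ℝ))) ℝ (M × ℝ) :=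
  (b.prod (Module.Basis.singleton (Fin (Module.finrank ℝ ℝ)) ℝ)).reindex
    (Fintype.equivFinOfCardEq finrank_prod_eq)

lemma sumBasis_inl {M : Type} [AddCommMonoid M] [Module ℝ M]
    (b : Module.Basis (Fin (Module.finrank ℝ ℝ)) ℝ M) (i : Fin (Module.finrank ℝ ℝ)) :
    sumBasis b (Fintype.equivFinOfCardEq finrank_prod_eq (Sum.inl i)) = (b i, 0) := by
  simp [sumBasis]

lemma sumBasis_inr {M : Type} [AddCommMonoid M] [Module ℝ M]
    (b : Module.Basis (Fin (Module.finrank ℝ ℝ)) ℝ M) (i : Fin (Module.finrank ℝ ℝ)) :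
    sumBasis b (Fintype.equivFinOfCardEq finrank_prod_eq (Sum.inr i)) = (0, 1) := by
  simp [sumBasis]

/-- The change-of-basis matrix is block diagonal with an extra block `1`. -/
lemma orient_sumBasis {M : Type} [AddCommMonoid M] [Module ℝ M]
    (b b' : Module.Basis (Fin (Module.finrank ℝ ℝ)) ℝ M) :
    orient (sumBasis b) (sumBasis b') = orient b b' := by
  have h : ((sumBasis b).toMatrix (sumBasis b')).det = (b.toMatrix b').det := by
    set ε := Fintype.equivFinOfCardEq finrank_prod_eq
    have hm : (sumBasis b).toMatrix (sumBasis b') =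
        Matrix.reindex ε ε (Matrix.fromBlocks (b.toMatrix b') 0 0 1) := by
      ext i j
      obtain ⟨i, rfl⟩ := ε.surjective i
      obtain ⟨j, rfl⟩ := ε.surjective j
      rw [Module.Basis.toMatrix_apply, Matrix.reindex_apply, Matrix.submatrix_apply,
        Equiv.symm_apply_apply, Equiv.symm_apply_apply, sumBasis, sumBasis,
        Module.Basis.reindex_apply, Module.Basis.repr_reindex_apply, Equiv.symm_apply_apply,
        Equiv.symm_apply_apply]
      rcases i with i | i <;> rcases j with j | j <;>
        simp [Module.Basis.toMatrix_apply, Subsingleton.elim i j]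
    rw [hm, Matrix.det_reindex_self, Matrix.det_fromBlocks_zero₂₁, Matrix.det_one, mul_one]
  rw [orient, orient, h]

/-- The sum of a frame of the canonical line bundle and the constant frame. -/
def sumFrame {Y : Type} [TopologicalSpace Y] {σ : Y → RP 3} (hσ : Continuous σ)
    (e : Frame ℝ (Taut 3) σ) : Frame (ℝ × ℝ) tautPlusTrivial σ where
  basis t := sumBasis (e.basis t)
  continuous_basis i := by
    obtain ⟨i, rfl⟩ := (Fintype.equivFinOfCardEq finrank_prod_eq).surjective i
    rw [(FiberBundle.Prod.isInducing_diag ℝ (Taut 3) ℝ (Trivial (RP 3) ℝ)).continuous_iff]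
    rcases i with i | i
    · refine Continuous.prodMk ((e.continuous_basis i).congr fun t => ?_) ?_
      · exact congrArg (TotalSpace.mk (σ t)) (congrArg Prod.fst (sumBasis_inl _ _)).symm
      · rw [(Trivial.isInducing_toProd (RP 3) ℝ).continuous_iff]
        refine (hσ.prodMk (continuous_const (y := (0 : ℝ)))).congr fun t => Prod.ext rfl ?_
        change (0 : ℝ) = (sumBasis (e.basis t) _).2
        rw [sumBasis_inl]
    · refine Continuous.prodMk ?_ ?_
      · rw [isInducing_tautIncl.continuous_iff]
        refine (hσ.prodMk (continuous_const (y := (0 : Fin 4 → ℝ)))).congr fun t => Prod.ext rfl ?_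
        change (0 : Fin 4 → ℝ) = (show (σ t).submodule from (sumBasis (e.basis t) _).1).1
        rw [sumBasis_inr]
        rfl
      · rw [(Trivial.isInducing_toProd (RP 3) ℝ).continuous_iff]
        refine (hσ.prodMk (continuous_const (y := (1 : ℝ)))).congr fun t => Prod.ext rfl ?_
        change (1 : ℝ) = (sumBasis (e.basis t) _).2
        rw [sumBasis_inr]

lemma nonempty_sumFrame {k : ℕ} (σ : (sing (RP 3)) _⦋k⦌) :
    Nonempty (Frame (ℝ × ℝ) tautPlusTrivial (toMap σ)) :=
  (nonempty_frame σ).map (sumFrame (toMap σ).continuous)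

lemma existsUnique_w₁_tautPlusTrivial :
    ∃! w, IsFirstStiefelWhitneyClass (ℝ × ℝ) tautPlusTrivial w :=
  existsUnique_isFirstStiefelWhitneyClass nonempty_sumFrame nonempty_sumFrame
    fun ℓ => sumBasis (repBasis ℓ)

/-- With compatible fibre bases the two orientation cochains are equal, not merely cohomologous. -/
lemma w₁_tautPlusTrivial : w₁ (ℝ × ℝ) tautPlusTrivial = w₁ ℝ (Taut 3) := by
  rw [w₁_taut, w₁_eq nonempty_sumFrame nonempty_sumFrame fun ℓ => sumBasis (repBasis ℓ)]
  congr 1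
  refine Subtype.ext (funext fun σ => ?_)
  obtain ⟨e⟩ := nonempty_frame σ
  change orientationCochain _ _ _ σ = orientationCochain _ _ _ σ
  rw [orientationCochain_eq _ σ e, orientationCochain_eq _ σ (sumFrame (toMap σ).continuous e),
    ← orient_sumBasis, ← orient_sumBasis]
  rfl

end Sum

section Trivial

/-- The constant frame. -/
def constFrame {Y : Type} [TopologicalSpace Y] {σ : Y → RP 3} (hσ : Continuous σ) :
    Frame (EuclideanSpace ℝ (Fin 2)) trivialPlane σ where
  basis _ := Module.finBasis ℝ (EuclideanSpace ℝ (Fin 2))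
  continuous_basis i := by
    rw [(Trivial.isInducing_toProd (RP 3) (EuclideanSpace ℝ (Fin 2))).continuous_iff]
    exact hσ.prodMk continuous_const

lemma existsUnique_w₁_trivialPlane :
    ∃! w, IsFirstStiefelWhitneyClass (EuclideanSpace ℝ (Fin 2)) trivialPlane w :=
  existsUnique_isFirstStiefelWhitneyClass (fun σ => ⟨constFrame (toMap σ).continuous⟩)
    (fun σ => ⟨constFrame (toMap σ).continuous⟩) fun _ => Module.finBasis ℝ (EuclideanSpace ℝ (Fin 2))

lemma w₁_trivialPlane : w₁ (EuclideanSpace ℝ (Fin 2)) trivialPlane = 0 := by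
  rw [w₁_eq (fun σ => ⟨constFrame (toMap σ).continuous⟩) (fun σ => ⟨constFrame (toMap σ).continuous⟩)
    fun _ => Module.finBasis ℝ (EuclideanSpace ℝ (Fin 2))]
  refine (Submodule.Quotient.mk_eq_zero _).mpr ?_
  have h : orientationCochain (EuclideanSpace ℝ (Fin 2)) trivialPlane
      (fun _ => Module.finBasis ℝ (EuclideanSpace ℝ (Fin 2))) = 0 := funext fun σ => by
    rw [orientationCochain_eq _ σ (constFrame (toMap σ).continuous)]
    exact (congrArg₂ (· + ·) (orient_self _) (orient_self _)).trans (add_zero 0)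
  change orientationCochain _ _ _ ∈ coboundaries _ 1
  rw [h]
  exact zero_mem _

end Trivial

end RP

end

noncomputable section

/-! ### The cube of the orientation class and the fundamental class -/

namespace ModTwo

open CategoryTheory Simplicial

variable {X : Type} [TopologicalSpace X]

/-- The edge of a singular simplex between two points. -/
def edge {n : ℕ} (σ : (sing X) _⦋n⦌) (i j : Fin (n + 1)) : (sing X) _⦋1⦌ :=
  pull σ ![stdSimplex.vertex i, stdSimplex.vertex j]

lemma segment_one {n : ℕ} (j : ℕ) (h : j + 1 ≤ n) (σ : (sing X) _⦋n⦌) :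
    segment (sing X) j 1 h σ = edge σ ⟨j, by omega⟩ ⟨j + 1, by omega⟩ := by
  rw [segment, map_eq_pull, edge]
  congr 1
  funext k
  fin_cases k
  · refine congrArg stdSimplex.vertex (Fin.ext ?_)
    exact (subinterval_val h 0).trans (zero_add j)
  · refine congrArg stdSimplex.vertex (Fin.ext ?_)
    exact (subinterval_val h 1).trans (add_comm 1 j)

/-- The cup product of three `1`-cocycles. -/
def cupThree {S : SSet.{0}} (a b c : cocycles S 1) : cocycles S 3 :=
  ⟨cupCochain (p := 2) (q := 1) rfl (cupCochain (p := 1) (q := 1) rfl a.1 b.1) c.1,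
    cupCochain_mem_cocycles rfl (cupCochain_mem_cocycles rfl a.2 b.2) c.2⟩

lemma cohomologyClass_cupThree {S : SSet.{0}} (a b c : cocycles S 1) :
    cohomologyClass (cupThree a b c) = cup (p := 2) (q := 1) rfl
      (cup (p := 1) (q := 1) rfl (cohomologyClass a) (cohomologyClass b)) (cohomologyClass c) := rfl

lemma cupThree_apply (a b c : cocycles (sing X) 1) (σ : (sing X) _⦋3⦌) :
    (cupThree a b c).1 σ = a.1 (edge σ 0 1) * b.1 (edge σ 1 2) * c.1 (edge σ 2 3) := by
  change a.1 (segment _ 0 1 _ (segment _ 0 2 _ σ)) * b.1 (segment _ 1 1 _ (segment _ 0 2 _ σ)) *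
    c.1 (segment _ 2 1 _ σ) = _
  have h : ∀ (j : ℕ) (hj : j + 1 ≤ 2) (h' : 0 + 2 ≤ 3), segment (sing X) j 1 hj (segment _ 0 2 h' σ) =
      segment _ j 1 (by omega) σ := by
    intro j hj h'
    rw [segment, segment, segment, ← Functor.map_comp_apply, ← op_comp]
    congr 1
  rw [h, h, segment_one, segment_one, segment_one]
  rfl

lemma cohomologyClass_eq_iff {S : SSet.{0}} {n : ℕ} {φ ψ : cocycles S n} :
    cohomologyClass φ = cohomologyClass ψ ↔ φ.1 - ψ.1 ∈ coboundaries S n :=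
  Submodule.Quotient.eq _

end ModTwo

namespace RP

open ModTwo CategoryTheory Simplicial

variable {n : ℕ}

lemma tautCocycle_edge {k : ℕ} (σ : (sing (RP n)) _⦋k⦌) {G : Simp k → Fin (n + 1) → ℝ}
    (hG : Continuous G) {h : ∀ t, G t ≠ 0} (e : ∀ t, mk (G t) (h t) = toMap σ t)
    (i j : Fin (k + 1)) : (tautCocycle n).1 (edge σ i j) =
      side (G (stdSimplex.vertex i)) + side (G (stdSimplex.vertex j)) := by
  rw [edge, tautCocycle_apply (pull σ _)
    (hG.comp (aff ![stdSimplex.vertex i, stdSimplex.vertex j]).continuous) (h := fun t => h _)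
    fun t => (e _).trans (toMap_pull σ _ t).symm]
  simp only [Function.comp, aff_vertex]
  rfl

/-! #### The fundamental cycle -/

/-- The map that multiplies the coordinates of a point of the simplex by signs. -/
def diag (b : Fin 4 → Bool) (t : Simp 3) : Fin 4 → ℝ := fun i => bitSign (b i) * t i

lemma bitSign_ne_zero (b : Bool) : bitSign b ≠ 0 := by
  cases b <;> simp [bitSign]

lemma bitSign_not (b : Bool) : bitSign (!b) = -bitSign b := by
  cases b <;> simp [bitSign]

lemma diag_ne_zero (b : Fin 4 → Bool) (t : Simp 3) : diag b t ≠ 0 := by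
  intro h
  have h1 : ∀ i, t i = 0 := fun i =>
    (mul_eq_zero.mp (congrFun h i)).resolve_left (bitSign_ne_zero _)
  have h2 : ∑ i, t i = 1 := t.2.2
  simp [h1] at h2

lemma continuous_diag (b : Fin 4 → Bool) : Continuous (diag b) :=
  continuous_pi fun i => continuous_const.mul (continuous_coord i)

/-- A simplex of the triangulated fundamental cycle. -/
def diagSimplex (b : Fin 4 → Bool) : (sing (RP 3)) _⦋3⦌ :=
  ofMap ⟨fun t => mk (diag b t) (diag_ne_zero b t), continuous_mk (continuous_diag b) _⟩

lemma toMap_diagSimplex (b : Fin 4 → Bool) (t : Simp 3) :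
    toMap (diagSimplex b) t = mk (diag b t) (diag_ne_zero b t) := by
  rw [diagSimplex, toMap_ofMap]
  rfl

lemma diagSimplex_not (b : Fin 4 → Bool) : diagSimplex (fun i => !b i) = diagSimplex b := by
  refine toMap_injective (ContinuousMap.ext fun t => ?_)
  rw [toMap_diagSimplex, toMap_diagSimplex, ← mk_neg (diag_ne_zero b t)]
  refine mk_congr (funext fun i => ?_)
  simp [diag, bitSign_not]

/-- On the face opposite to vertex `i` the coordinate `t i` is zero, so its sign is immaterial. -/
lemma δ_diagSimplex {b b' : Fin 4 → Bool} (i : Fin 4) (h : ∀ j, j ≠ i → b j = b' j) :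
    (sing (RP 3)).δ i (diagSimplex b) = (sing (RP 3)).δ i (diagSimplex b') := by
  rw [δ_eq_pull, δ_eq_pull]
  refine toMap_injective (ContinuousMap.ext fun t => ?_)
  rw [toMap_pull, toMap_pull, toMap_diagSimplex, toMap_diagSimplex]
  refine mk_congr (funext fun j => ?_)
  rw [diag, diag]
  by_cases hj : j = i
  · subst hj
    rw [face_self, mul_zero, mul_zero]
  · rw [h j hj]

lemma side_diag (b : Fin 4 → Bool) (i : Fin 4) : side (diag b (stdSimplex.vertex i)) =
    side (Pi.single i (1 : ℝ)) + if b i then 1 else 0 := by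
  have h : diag b (stdSimplex.vertex i) = bitSign (b i) • Pi.single i (1 : ℝ) := by
    funext j
    simp only [diag, Pi.smul_apply, smul_eq_mul]
    by_cases hj : j = i
    · subst hj
      simp
    · simp [hj]
  rw [h]
  cases hb : b i
  · simp [bitSign]
  · simpa [bitSign] using side_neg (v := Pi.single i (1 : ℝ)) (by simp)

/-- The third power of the orientation cocycle. -/
def tautCube : cocycles (sing (RP 3)) 3 := cupThree (tautCocycle 3) (tautCocycle 3) (tautCocycle 3)

lemma tautCube_diagSimplex (b : Fin 4 → Bool) : tautCube.1 (diagSimplex b) =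
    ∏ i : Fin 3, (side (Pi.single i.castSucc (1 : ℝ)) + (if b i.castSucc then 1 else 0) +
      (side (Pi.single i.succ (1 : ℝ)) + if b i.succ then 1 else 0)) := by
  have h := tautCocycle_edge (diagSimplex b) (continuous_diag b) (h := diag_ne_zero b)
    fun t => (toMap_diagSimplex b t).symm
  rw [tautCube, cupThree_apply, h, h, h, Fin.prod_univ_three]
  simp only [side_diag]
  rfl

/-- The signs `(1, ±1, ±1, ±1)`. -/
def signs (b : Bool × Bool × Bool) : Fin 4 → Bool := ![false, b.1, b.2.1, b.2.2]

lemma exists_cycle : ∃ c : Homology (sing (RP 3)) 3, (evalCocycle tautCube).hom c = 1 := by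
  obtain ⟨c, hc⟩ := exists_homology_of_sum (fun b => diagSimplex (signs b)) fun ψ => by
    simp only [coboundary_apply]
    rw [Finset.sum_comm]
    refine Finset.sum_eq_zero fun i _ => ?_
    have key : ∀ g : Bool × Bool × Bool → Bool × Bool × Bool, (∀ b, g b ≠ b) →
        (∀ b, g (g b) = b) → (∀ b, (sing (RP 3)).δ i (diagSimplex (signs (g b))) =
          (sing (RP 3)).δ i (diagSimplex (signs b))) →
        ∑ b, ψ ((sing (RP 3)).δ i (diagSimplex (signs b))) = 0 := by
      intro g h1 h2 h3
      refine Finset.sum_involution (fun b _ => g b) (fun b _ => ?_) (fun b _ _ => h1 b)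
        (fun b _ => Finset.mem_univ _) fun b _ => h2 b
      rw [h3, zmodTwo_add_self]
    fin_cases i
    -- The sign of coordinate `0` is normalized. Reversing it amounts, up to the antipode, to
    -- reversing the other three, which pairs the faces opposite to vertex `0`.
    · refine key (fun b => (!b.1, !b.2.1, !b.2.2)) (by decide) (by decide) fun b => ?_
      rw [← diagSimplex_not]
      refine δ_diagSimplex _ fun j hj => ?_
      revert b
      fin_cases j
      · exact absurd rfl hj
      all_goals decide
    · refine key (fun b => (!b.1, b.2.1, b.2.2)) (by decide) (by decide) fun b =>
        δ_diagSimplex _ fun j hj => ?_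
      fin_cases j
      exacts [rfl, absurd rfl hj, rfl, rfl]
    · refine key (fun b => (b.1, !b.2.1, b.2.2)) (by decide) (by decide) fun b =>
        δ_diagSimplex _ fun j hj => ?_
      fin_cases j
      exacts [rfl, rfl, absurd rfl hj, rfl]
    · refine key (fun b => (b.1, b.2.1, !b.2.2)) (by decide) (by decide) fun b =>
        δ_diagSimplex _ fun j hj => ?_
      fin_cases j
      exacts [rfl, rfl, rfl, absurd rfl hj]
  refine ⟨c, (hc tautCube).trans ?_⟩
  simp only [tautCube_diagSimplex]
  set s : Fin 4 → ZMod 2 := fun i => side (Pi.single i (1 : ℝ))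
  -- Up to constants the factors are `b₁`, `b₁ + b₂`, `b₂ + b₃`. They range bijectively over
  -- `(ℤ/2)³`, so exactly one of the eight products is `1`.
  have h : ∀ s₀ s₁ s₂ s₃ : ZMod 2, ∑ b : Bool × Bool × Bool,
      (s₀ + 0 + (s₁ + if b.1 then 1 else 0)) *
      (s₁ + (if b.1 then 1 else 0) + (s₂ + if b.2.1 then 1 else 0)) *
      (s₂ + (if b.2.1 then 1 else 0) + (s₃ + if b.2.2 then 1 else 0)) = 1 := by decide
  refine (Finset.sum_congr rfl fun b _ => ?_).trans (h (s 0) (s 1) (s 2) (s 3))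
  rw [Fin.prod_univ_three]
  rfl

/-! #### Local restrictions -/

/-- The complement of a hyperplane. -/
def hyperplaneCompl (l : (Fin (n + 1) → ℝ) →ₗ[ℝ] ℝ) : Set (RP n) := {ℓ | l ℓ.rep ≠ 0}

lemma mk_mem_hyperplaneCompl (l : (Fin (n + 1) → ℝ) →ₗ[ℝ] ℝ) {v : Fin (n + 1) → ℝ} (hv : v ≠ 0) :
    mk v hv ∈ hyperplaneCompl l ↔ l v ≠ 0 := by
  obtain ⟨a, ha, h⟩ := exists_smul_rep v hv
  rw [hyperplaneCompl, Set.mem_ofPred_eq]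
  conv_rhs => rw [h, map_smul, smul_eq_mul]
  simp [ha]

lemma isOpen_hyperplaneCompl (l : (Fin (n + 1) → ℝ) →ₗ[ℝ] ℝ) :
    IsOpen (hyperplaneCompl l) := by
  rw [← isQuotientMap_mk'.isOpen_preimage]
  have : (Projectivization.mk' ℝ) ⁻¹' hyperplaneCompl l =
      Set.ofPred fun v : { v : Fin (n + 1) → ℝ // v ≠ 0 } => l v.1 ≠ 0 := by
    ext v
    exact mk_mem_hyperplaneCompl l v.2
  rw [this]
  exact isOpen_ne_fun (l.continuous_of_finiteDimensional.comp continuous_subtype_val)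
    continuous_const

/-- The section `v / l(v)` of `γ` off the hyperplane `l = 0` does not depend on the representative.
-/
lemma normalized_mk (l : (Fin (n + 1) → ℝ) →ₗ[ℝ] ℝ) {v : Fin (n + 1) → ℝ} (hv : v ≠ 0) :
    (l (mk v hv).rep)⁻¹ • (mk v hv).rep = (l v)⁻¹ • v := by
  obtain ⟨a, ha, h⟩ := exists_smul_rep v hv
  conv_rhs => rw [h, map_smul, smul_eq_mul, mul_inv_rev, smul_smul, mul_assoc, inv_mul_cancel₀ ha,
    mul_one]

/-- The canonical line bundle is oriented over the complement of a hyperplane. -/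
lemma tautCocycle_eq_of_inSet {l : (Fin (n + 1) → ℝ) →ₗ[ℝ] ℝ} {σ : (sing (RP n)) _⦋1⦌}
    (hσ : InSet (hyperplaneCompl l) σ) : (tautCocycle n).1 σ =
      coboundary _ 0 (pointCochain fun ℓ => side ((l ℓ.rep)⁻¹ • ℓ.rep)) σ := by
  obtain ⟨G, h, e⟩ := exists_lift (toMap σ)
  have hl : ∀ t, l (G t) ≠ 0 := fun t => (mk_mem_hyperplaneCompl l (h t)).mp (e t ▸ hσ t)
  have hG : Continuous fun t => (l (G t))⁻¹ • G t :=
    ((l.continuous_of_finiteDimensional.comp G.continuous).inv₀ hl).smul G.continuous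
  rw [tautCocycle_apply σ hG (h := fun t => smul_ne_zero (inv_ne_zero (hl t)) (h t)),
    coboundary_pointCochain, ← e, ← e, normalized_mk, normalized_mk, add_comm]
  intro t
  rw [← e t]
  exact (Projectivization.mk_eq_mk_iff' ℝ _ _ _ _).mpr ⟨(l (G t))⁻¹, rfl⟩

/-- The orientation cocycle, normalized to vanish in the complement of a hyperplane. -/
def normalizedCocycle (l : (Fin (n + 1) → ℝ) →ₗ[ℝ] ℝ) : cocycles (sing (RP n)) 1 :=
  ⟨(tautCocycle n).1 - coboundary _ 0 (pointCochain fun ℓ => side ((l ℓ.rep)⁻¹ • ℓ.rep)),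
    sub_mem (tautCocycle n).2 (coboundary_coboundary _)⟩

lemma normalizedCocycle_apply {l : (Fin (n + 1) → ℝ) →ₗ[ℝ] ℝ} {σ : (sing (RP n)) _⦋1⦌}
    (hσ : InSet (hyperplaneCompl l) σ) : (normalizedCocycle l).1 σ = 0 := by
  change (tautCocycle n).1 σ - _ = 0
  rw [tautCocycle_eq_of_inSet hσ, sub_self]

lemma cohomologyClass_normalizedCocycle (l : (Fin (n + 1) → ℝ) →ₗ[ℝ] ℝ) :
    cohomologyClass (normalizedCocycle l) = cohomologyClass (tautCocycle n) := by
  refine cohomologyClass_eq_iff.mpr ?_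
  rw [normalizedCocycle, sub_sub_cancel_left]
  exact neg_mem ⟨_, rfl⟩

/-- A point is the intersection of `n` hyperplanes. -/
lemma exists_hyperplanes (x : RP n) : ∃ l : Fin n → (Fin (n + 1) → ℝ) →ₗ[ℝ] ℝ,
    ({x}ᶜ : Set (RP n)) ⊆ ⋃ i, hyperplaneCompl (l i) := by
  obtain ⟨j, hj⟩ := exists_mem_affineOpen x
  have hj' : x.rep j ≠ 0 := hj
  -- With `x_j ≠ 0`, the line of `x` is cut out by the equations `x_j v_k = x_k v_j` for `k ≠ j`.
  refine ⟨fun i => x.rep j • LinearMap.proj (j.succAbove i) - x.rep (j.succAbove i) •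
    LinearMap.proj j, fun ℓ hℓ => ?_⟩
  by_contra h
  simp only [Set.mem_iUnion, not_exists] at h
  refine hℓ ?_
  have h1 : ∀ k, x.rep j * ℓ.rep k - x.rep k * ℓ.rep j = 0 := by
    intro k
    refine Fin.succAboveCases j ?_ (fun i => ?_) k
    · ring
    · by_contra hi
      exact h i hi
  rw [Set.mem_singleton_iff, ← ℓ.mk_rep, ← x.mk_rep]
  refine (Projectivization.mk_eq_mk_iff' ℝ _ _ _ _).mpr ⟨ℓ.rep j / x.rep j, funext fun k => ?_⟩
  rw [Pi.smul_apply, smul_eq_mul, div_mul_eq_mul_div, div_eq_iff hj']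
  linarith [h1 k]

/-- Near any `x` the cube is represented by a cocycle that vanishes on `ℝP³ ∖ {x}`, so its nonzero
value on `c` is already visible in the local homology at `x`. -/
lemma isFundamentalClass_of_tautCube {c : Homology (sing (RP 3)) 3}
    (hc : (evalCocycle tautCube).hom c ≠ 0) : IsFundamentalClass (RP 3) 3 c := by
  intro x
  obtain ⟨l, hl⟩ := exists_hyperplanes x
  set φ := cupThree (normalizedCocycle (l 0)) (normalizedCocycle (l 1)) (normalizedCocycle (l 2))
    with hφ
  have hclass : cohomologyClass φ = cohomologyClass tautCube := by
    rw [hφ, tautCube, cohomologyClass_cupThree, cohomologyClass_cupThree,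
      cohomologyClass_normalizedCocycle, cohomologyClass_normalizedCocycle,
      cohomologyClass_normalizedCocycle]
  have hcoc : coboundary (sing (RP 3)) 3 φ.1 = 0 := φ.2
  -- A simplex off the `i`-th hyperplane has all its edges there, and the `i`-th factor vanishes on
  -- them.
  obtain ⟨ψ, hψ⟩ := exists_coboundary_of_small (m := 2) (fun i => isOpen_hyperplaneCompl (l i)) hl
    (φ := φ.1) (fun σ _ => congrFun hcoc σ) fun σ i hσ => by
      have hE : ∀ j k, InSet (hyperplaneCompl (l i)) (edge σ j k) := fun j k =>
        (hσ.mono Set.inter_subset_right).pull _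
      rw [hφ, cupThree_apply]
      obtain rfl | rfl | rfl : i = 0 ∨ i = 1 ∨ i = 2 := by omega
      · rw [normalizedCocycle_apply (hE 0 1), zero_mul, zero_mul]
      · rw [normalizedCocycle_apply (hE 1 2), mul_zero, zero_mul]
      · rw [normalizedCocycle_apply (hE 2 3), mul_zero]
  have hmem : φ.1 - coboundary _ 2 ψ ∈ cocycles (sing (RP 3)) 3 :=
    sub_mem φ.2 (coboundary_coboundary ψ)
  refine localRestriction_ne_zero (φ := ⟨_, hmem⟩) (fun σ hσ => ?_) ?_
  · exact sub_eq_zero.mpr (hψ σ hσ).symm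
  · rwa [evalCocycle_congr ⟨_, hmem⟩ tautCube]
    have h1 : φ.1 - tautCube.1 ∈ coboundaries (sing (RP 3)) 3 := cohomologyClass_eq_iff.mp hclass
    have h2 : coboundary (sing (RP 3)) 2 ψ ∈ coboundaries (sing (RP 3)) 3 := ⟨ψ, rfl⟩
    have h3 := sub_mem h1 h2
    rwa [sub_right_comm] at h3

lemma evalCocycle_eq_zero {S : SSet.{0}} {m : ℕ} {φ : cocycles S m} (h : φ.1 ∈ coboundaries S m)
    (c : Homology S m) : (evalCocycle φ).hom c = 0 := by
  have h0 : cochainHom (0 : Cochain S m) = 0 := by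
    refine SSet.chainComplex_hom_ext fun σ => ?_
    rw [ι_cochainHom]
    ext
    simp
  have h1 : evalCocycle (0 : cocycles S m) = 0 := by
    rw [evalCocycle, ← cancel_epi ((S.chainComplex coeff).homologyπ m)]
    simp [h0]
  rw [evalCocycle_congr φ 0 (by simpa using h), h1]
  rfl

lemma tautCube_notMem : tautCube.1 ∉ coboundaries (sing (RP 3)) 3 := by
  intro h
  obtain ⟨c, hc⟩ := exists_cycle
  rw [evalCocycle_eq_zero h] at hc
  exact zero_ne_one hc

/-- The third power of the orientation class detects `H_3`. -/
lemma evalCocycle_tautCube {c : Homology (sing (RP 3)) 3} (hc : c ≠ 0) :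
    (evalCocycle tautCube).hom c = 1 := by
  obtain ⟨φ, hφ⟩ := exists_evalCocycle_ne_zero hc
  have h1 : φ.1 ∉ coboundaries (sing (RP 3)) 3 := fun h => hφ (evalCocycle_eq_zero h c)
  have h2 := add_mem_coboundaries φ.2 tautCube.2 h1 tautCube_notMem
  have h3 : φ.1 - tautCube.1 = φ.1 + tautCube.1 := by
    funext σ
    exact (by decide : ∀ a b : ZMod 2, a - b = a + b) _ _
  rw [← evalCocycle_congr φ tautCube (h3 ▸ h2)]
  exact (by decide : ∀ a : ZMod 2, a ≠ 0 → a = 1) _ hφ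

lemma ne_zero_of_isFundamentalClass {c : Homology (sing (RP 3)) 3}
    (hc : IsFundamentalClass (RP 3) 3 c) : c ≠ 0 := by
  rintro rfl
  exact hc (signPoint true true true) (map_zero _)

/-- Two fundamental classes both pair to `1` with the cube; their difference pairs to `0`, which no
nonzero class does. -/
lemma existsUnique_isFundamentalClass : ∃! c, IsFundamentalClass (RP 3) 3 c := by
  obtain ⟨c, hc⟩ := exists_cycle
  refine ⟨c, isFundamentalClass_of_tautCube (hc ▸ one_ne_zero), fun c' hc' => ?_⟩
  by_contra hne
  have h1 := evalCocycle_tautCube (sub_ne_zero.mpr hne)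
  rw [map_sub, hc, evalCocycle_tautCube (ne_zero_of_isFundamentalClass hc'), sub_self] at h1
  exact zero_ne_one h1

lemma cube_w₁_taut : cube (w₁ ℝ (Taut 3)) = cohomologyClass tautCube := by
  rw [w₁_taut]
  rfl

lemma cube_w₁_taut_ne_zero : cube (w₁ ℝ (Taut 3)) ≠ 0 := by
  rw [cube_w₁_taut]
  intro h
  have h1 := cohomologyClass_eq_iff.mp (h.trans (rfl : (0 : Cohomology _ 3) = cohomologyClass 0))
  rw [ZeroMemClass.coe_zero, sub_zero] at h1
  exact tautCube_notMem h1

lemma integral_cube_w₁_taut : integral (cube (w₁ ℝ (Taut 3))) = 1 := by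
  rw [cube_w₁_taut]
  exact evalCocycle_tautCube (ne_zero_of_isFundamentalClass
    (Classical.epsilon_spec existsUnique_isFundamentalClass.exists))

lemma integral_cube_w₁_trivialPlane :
    integral (cube (w₁ (EuclideanSpace ℝ (Fin 2)) trivialPlane)) = 0 := by
  rw [w₁_trivialPlane]
  refine evalCocycle_eq_zero (φ := cupThree 0 0 0) ?_ _
  have h : (cupThree (0 : cocycles (sing (RP 3)) 1) 0 0).1 = 0 := funext fun σ => mul_zero _
  rw [h]
  exact zero_mem _

end RP

end

noncomputable section

/-! ### Continuity of the representations of the structure group -/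

namespace CliffordAlgebra

open Submodule

/-- An anticommuting generator moves past a factor of the ordered product. -/
lemma span_mul_span_one_le {A : Type} [Ring A] [Algebra ℝ A] {x y : A} (h : y * x = -(x * y)) :
    span ℝ {y} * span ℝ {1, x} ≤ span ℝ {1, x} * span ℝ {y} := by
  rw [span_mul_span, span_le]
  have hy := mem_span_singleton_self (R := ℝ) y
  rintro _ ⟨_, rfl, z, rfl | rfl, rfl⟩
  · simpa using mul_mem_mul (subset_span (Set.mem_insert 1 {x}) : (1 : A) ∈ span ℝ {1, x}) hy
  · have h1 := neg_mem (mul_mem_mul (subset_span (by simp) : z ∈ span ℝ {1, z}) hy)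
    rwa [← h] at h1

lemma span_mul_span_one_le_self {A : Type} [Ring A] [Algebra ℝ A] {x : A} (h : x * x = 1) :
    span ℝ {x} * span ℝ {1, x} ≤ span ℝ {1, x} := by
  rw [span_mul_span, span_le]
  rintro _ ⟨_, rfl, z, rfl | rfl, rfl⟩
  · exact subset_span (by simp)
  · exact subset_span (by simp [h])

/-- The basis vectors of `ℝ³` in the Clifford algebra. -/
def gen (i : Fin 3) : CliffordAlgebra (normSqForm 3) :=
  ι (normSqForm 3) (EuclideanSpace.single i 1)

lemma gen_mul_self (i : Fin 3) : gen i * gen i = 1 := by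
  rw [gen, ι_sq_scalar, normSqForm_apply]
  simp

lemma gen_mul_gen {i j : Fin 3} (h : i ≠ j) : gen i * gen j = -(gen j * gen i) := by
  have h1 := ι_mul_ι_add_swap (Q := normSqForm 3) (EuclideanSpace.single i 1)
    (EuclideanSpace.single j 1)
  have h2 : QuadraticMap.polar (normSqForm 3) (EuclideanSpace.single i 1)
      (EuclideanSpace.single j 1) = 0 := by
    rw [QuadraticMap.polar, normSqForm_apply, normSqForm_apply, normSqForm_apply,
      norm_add_sq_real]
    simp [EuclideanSpace.inner_single_left, h]
  rw [h2, map_zero] at h1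
  exact eq_neg_of_add_eq_zero_left h1

/-- The span of the ordered products of the basis vectors. -/
def orderedSpan : Submodule ℝ (CliffordAlgebra (normSqForm 3)) :=
  span ℝ {1, gen 0} * span ℝ {1, gen 1} * span ℝ {1, gen 2}

/-- A generator is moved rightwards to the factor that contains it and absorbed there, since its
square is `1`. -/
lemma gen_mul_mem (i : Fin 3) {x : CliffordAlgebra (normSqForm 3)} (hx : x ∈ orderedSpan) :
    gen i * x ∈ orderedSpan := by
  suffices h : span ℝ {gen i} * orderedSpan ≤ orderedSpan from
    h (mul_mem_mul (mem_span_singleton_self _) hx)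
  rw [orderedSpan, mul_assoc]
  have hs := fun j => span_mul_span_one_le_self (gen_mul_self j)
  have hc := fun {j k : Fin 3} (h : j ≠ k) => span_mul_span_one_le (gen_mul_gen h)
  obtain rfl | rfl | rfl : i = 0 ∨ i = 1 ∨ i = 2 := by omega
  · rw [← mul_assoc]
    exact mul_le_mul' (hs 0) le_rfl
  · calc _ ≤ span ℝ {1, gen 0} * (span ℝ {gen 1} * (span ℝ {1, gen 1} * span ℝ {1, gen 2})) := by
          rw [← mul_assoc, ← mul_assoc (span ℝ {1, gen 0})]
          exact mul_le_mul' (hc (by decide)) le_rfl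
      _ ≤ _ := by
          rw [← mul_assoc (span ℝ {gen 1})]
          exact mul_le_mul' le_rfl (mul_le_mul' (hs 1) le_rfl)
  · calc _ ≤ span ℝ {1, gen 0} * (span ℝ {gen 2} * (span ℝ {1, gen 1} * span ℝ {1, gen 2})) := by
          rw [← mul_assoc, ← mul_assoc (span ℝ {1, gen 0})]
          exact mul_le_mul' (hc (by decide)) le_rfl
      _ ≤ span ℝ {1, gen 0} * (span ℝ {1, gen 1} * (span ℝ {gen 2} * span ℝ {1, gen 2})) := by
          rw [← mul_assoc (span ℝ {gen 2}), ← mul_assoc (span ℝ {1, gen 1})]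
          exact mul_le_mul' le_rfl (mul_le_mul' (hc (by decide)) le_rfl)
      _ ≤ _ := mul_le_mul' le_rfl (mul_le_mul' le_rfl (hs 2))

lemma orderedSpan_eq_top : orderedSpan = ⊤ := by
  refine eq_top_iff.mpr fun x _ => ?_
  induction x using CliffordAlgebra.left_induction with
  | algebraMap r =>
    rw [Algebra.algebraMap_eq_smul_one]
    refine smul_mem _ _ ?_
    have h : ∀ i : Fin 3, (1 : CliffordAlgebra (normSqForm 3)) ∈ span ℝ {1, gen i} := fun i =>
      subset_span (Set.mem_insert _ _)
    have h1 := mul_mem_mul (mul_mem_mul (h 0) (h 1)) (h 2)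
    rwa [mul_one, mul_one] at h1
  | add x y hx hy => exact add_mem (hx trivial) (hy trivial)
  | ι_mul x v hx =>
    have hv : v = ∑ i : Fin 3, v i • EuclideanSpace.single i (1 : ℝ) := by
      ext j
      simp [Pi.single_apply]
    rw [hv, map_sum, Finset.sum_mul]
    refine sum_mem fun i _ => ?_
    rw [map_smul, smul_mul_assoc]
    exact smul_mem _ _ (gen_mul_mem i (hx trivial))

/-- Finiteness makes multiplication continuous for the module topology, and with it the action of
`Spin 3`. -/
instance finite_normSqForm_three : Module.Finite ℝ (CliffordAlgebra (normSqForm 3)) := by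
  rw [Module.finite_def, ← orderedSpan_eq_top, orderedSpan]
  have h : ∀ i : Fin 3, (span ℝ {1, gen i}).FG := fun i => fg_span (Set.toFinite _)
  exact ((h 0).mul (h 1)).mul (h 2)

instance isModuleTopology_normSqForm (d : ℕ) :
    IsModuleTopology ℝ (CliffordAlgebra (normSqForm d)) := ⟨rfl⟩

end CliffordAlgebra

section StructureGroup

open CliffordAlgebra

/-- `spinAct` is defined by a choice; a linear left inverse `L` of `ι` turns it into the explicit
continuous expression `L (x v x*)`. -/
lemma continuous_spinAct (v : EuclideanSpace ℝ (Fin 3)) :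
    Continuous fun x : Spin 3 => spinAct x v := by
  obtain ⟨L, hL⟩ := (ι (normSqForm 3)).exists_leftInverse_of_injective
    (LinearMap.ker_eq_bot.mpr (ι_normSqForm_injective 3))
  have h : ∀ x : Spin 3, spinAct x v = L (x.1 * ι (normSqForm 3) v * star x.1) := by
    intro x
    have h1 := congrArg L (ι_spinAct x v)
    exact (LinearMap.congr_fun hL _).symm.trans h1
  simp only [h]
  have := IsModuleTopology.toContinuousAdd ℝ (CliffordAlgebra (normSqForm 3))
  have hmul := IsModuleTopology.continuous_mul_of_finite ℝ (CliffordAlgebra (normSqForm 3))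
  have hstar : Continuous fun x : CliffordAlgebra (normSqForm 3) => star x := by
    simp only [star_def]
    exact IsModuleTopology.continuous_of_linearMap (reverse.comp involute.toLinearMap)
  refine (IsModuleTopology.continuous_of_linearMap L).comp ?_
  exact hmul.comp ((hmul.comp (continuous_subtype_val.prodMk continuous_const)).prodMk
    (hstar.comp continuous_subtype_val))

lemma chargeRep_apply (g : ChargeGroup) (z : ℂ) : chargeRep g z =
    (g.left : ℂ) ^ 2 * if g.right = 1 then z else (starRingEnd ℂ) z := by
  change rotation (g.left ^ 2) ((if g.right = 1 then (1 : ℂ ≃ₗᵢ[ℝ] ℂ) else Complex.conjLIE) z) = _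
  rw [rotation_apply, Circle.coe_pow]
  split_ifs <;> rfl

lemma continuous_chargeRep (z : ℂ) : Continuous fun g : ChargeGroup => chargeRep g z := by
  simp only [chargeRep_apply]
  have h : Continuous (SemidirectProduct.equivProd : ChargeGroup → _) := continuous_induced_dom
  have hl : Continuous fun g : ChargeGroup => (g.left : ℂ) :=
    continuous_subtype_val.comp (continuous_fst.comp h)
  have hr : Continuous fun g : ChargeGroup => g.right := continuous_snd.comp h
  refine (hl.pow 2).mul ?_
  exact (continuous_of_discreteTopology (f := fun y : Multiplicative (ZMod 2) =>
    if y = 1 then z else (starRingEnd ℂ) z)).comp hr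

lemma HGroup.continuous_rho_apply (v : EuclideanSpace ℝ (Fin 3)) :
    Continuous fun h : HGroup 3 => HGroup.rho 3 h v :=
  (QuotientGroup.isQuotientMap_mk (parity 3)).continuous_iff.mpr ((continuous_spinAct v).comp continuous_fst)

lemma HGroup.continuous_tau_apply (z : ℂ) : Continuous fun h : HGroup 3 => HGroup.tau 3 h z :=
  (QuotientGroup.isQuotientMap_mk (parity 3)).continuous_iff.mpr ((continuous_chargeRep z).comp continuous_snd)

/-- Joint continuity follows from continuity in the group element by expanding the vector in a
basis. -/
lemma HGroup.continuous_rho :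
    Continuous fun q : HGroup 3 × EuclideanSpace ℝ (Fin 3) => HGroup.rho 3 q.1 q.2 := by
  have h : ∀ q : HGroup 3 × EuclideanSpace ℝ (Fin 3), HGroup.rho 3 q.1 q.2 =
      ∑ i, q.2 i • HGroup.rho 3 q.1 (EuclideanSpace.single i 1) := by
    intro q
    have hv : q.2 = ∑ i : Fin 3, q.2 i • EuclideanSpace.single i (1 : ℝ) := by
      ext j
      simp [Pi.single_apply]
    conv_lhs => rw [hv, map_sum]
    exact Finset.sum_congr rfl fun i _ => map_smul _ _ _
  simp only [h]
  refine continuous_finsetSum _ fun i _ => Continuous.smul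
    (f := fun q : HGroup 3 × EuclideanSpace ℝ (Fin 3) => q.2 i) (by fun_prop) ?_
  exact (continuous_rho_apply _).comp continuous_fst

lemma HGroup.continuous_tau : Continuous fun q : HGroup 3 × ℂ => HGroup.tau 3 q.1 q.2 := by
  have h : ∀ q : HGroup 3 × ℂ, HGroup.tau 3 q.1 q.2 =
      q.2.re • HGroup.tau 3 q.1 1 + q.2.im • HGroup.tau 3 q.1 Complex.I := by
    intro q
    rw [← map_smul, ← map_smul, ← map_add]
    congr 1
    simp
  simp only [h]
  exact ((Complex.continuous_re.comp continuous_snd).smul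
    ((continuous_tau_apply _).comp continuous_fst)).add
      ((Complex.continuous_im.comp continuous_snd).smul ((continuous_tau_apply _).comp continuous_fst))

lemma involutionHom_ofAdd {A : Type} [Group A] (a : A) (ha : a * a = 1) :
    involutionHom a ha (Multiplicative.ofAdd 1) = a :=
  if_neg (t := 1) (by decide : (Multiplicative.ofAdd 1 : Multiplicative (ZMod 2)) ≠ 1)

/-- The element `(i, C)` of the internal symmetry group. -/
def chargeReflection : ChargeGroup :=
  ⟨⟨Complex.I, by simp [Submonoid.unitSphere]⟩, Multiplicative.ofAdd 1⟩

/-- The class of `(1, (i, C))`. -/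
def HGroup.reflection : HGroup 3 := QuotientGroup.mk (1, chargeReflection)

/-- Moving `C` past the second factor conjugates it, and `i · ī = 1`. -/
lemma chargeReflection_mul_self : chargeReflection * chargeReflection = 1 := by
  refine SemidirectProduct.ext ?_ rfl
  change chargeReflection.left * involutionHom conjAut _ (Multiplicative.ofAdd 1)
    chargeReflection.left = 1
  rw [involutionHom_ofAdd]
  exact mul_inv_cancel _

lemma HGroup.reflection_mul_self : reflection * reflection = 1 := by
  rw [reflection, ← QuotientGroup.mk_mul, Prod.mk_mul_mk, chargeReflection_mul_self, mul_one]
  rfl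

lemma HGroup.rho_reflection : HGroup.rho 3 reflection = 1 := map_one (spinRep 3)

/-- The factor `i² = -1` makes this the reflection that reverses the real axis and fixes the
imaginary one: the transition function of `γ ⊕ ℝ` with `γ` as real coordinate. -/
lemma HGroup.tau_reflection (z : ℂ) : HGroup.tau 3 reflection z = -(starRingEnd ℂ) z := by
  refine (chargeRep_apply chargeReflection z).trans ?_
  have h : (Multiplicative.ofAdd 1 : Multiplicative (ZMod 2)) ≠ 1 := by decide
  simp [chargeReflection, h]

lemma HGroup.continuous_reflection_mul : Continuous fun h : HGroup 3 => reflection * h := by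
  refine (QuotientGroup.isQuotientMap_mk (parity 3)).continuous_iff.mpr ?_
  change Continuous fun p : Spin 3 × ChargeGroup =>
    (QuotientGroup.mk (1 * p.1, chargeReflection * p.2) : HGroup 3)
  simp only [one_mul]
  refine (QuotientGroup.isQuotientMap_mk (parity 3)).continuous.comp
    (continuous_fst.prodMk (Continuous.comp ?_ continuous_snd))
  have hi : Topology.IsInducing (SemidirectProduct.equivProd : ChargeGroup → _) := ⟨rfl⟩
  rw [hi.continuous_iff]
  change Continuous fun g : ChargeGroup => (chargeReflection.left *
    involutionHom conjAut _ (Multiplicative.ofAdd 1) g.left, Multiplicative.ofAdd 1 * g.right)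
  rw [involutionHom_ofAdd]
  refine (continuous_const.mul (continuous_inv.comp (continuous_fst.comp hi.continuous))).prodMk ?_
  exact (continuous_of_discreteTopology (f := fun y : Multiplicative (ZMod 2) =>
    Multiplicative.ofAdd 1 * y)).comp (continuous_snd.comp hi.continuous)

end StructureGroup

end

noncomputable section

/-! ### The parallelization of `ℝP³` -/

namespace RP

open Bundle Manifold
open scoped ContDiff

variable {n : ℕ}

/-- The affine coordinates of `[v]`, as a function of `v`. -/
def affineCoord (i : Fin (n + 1)) (v : Fin (n + 1) → ℝ) : EuclideanSpace ℝ (Fin n) :=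
  WithLp.toLp 2 fun k => v (i.succAbove k) / v i

lemma chart_mk (i : Fin (n + 1)) {v : Fin (n + 1) → ℝ} (hv : v ≠ 0) :
    chart i (mk v hv) = affineCoord i v := by
  ext k
  exact ratio_mk i _ v hv

/-- The derivative of the affine coordinates. -/
def affineCoordDeriv (i : Fin (n + 1)) (v w : Fin (n + 1) → ℝ) : EuclideanSpace ℝ (Fin n) :=
  WithLp.toLp 2 fun k => (w (i.succAbove k) * v i - v (i.succAbove k) * w i) / v i ^ 2

/-- Homogeneity lets a vector field on `ℝ⁴ ∖ {0}` that is linear in the base point descend to `ℝP³`.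
-/
lemma affineCoordDeriv_smul (i : Fin (n + 1)) (v w : Fin (n + 1) → ℝ) {a : ℝ} (ha : a ≠ 0) :
    affineCoordDeriv i (a • v) (a • w) = affineCoordDeriv i v w := by
  ext k
  simp only [affineCoordDeriv, Pi.smul_apply, smul_eq_mul]
  rw [show a * w (i.succAbove k) * (a * v i) - a * v (i.succAbove k) * (a * w i) =
    a ^ 2 * (w (i.succAbove k) * v i - v (i.succAbove k) * w i) by ring, mul_pow,
    mul_div_mul_left _ _ (pow_ne_zero 2 ha)]

lemma hasDerivAt_affineCoord {i : Fin (n + 1)} {v : Fin (n + 1) → ℝ} (hv : v i ≠ 0)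
    (w : Fin (n + 1) → ℝ) :
    HasDerivAt (fun t : ℝ => affineCoord i (v + t • w)) (affineCoordDeriv i v w) 0 := by
  have h : ∀ j, HasDerivAt (fun t : ℝ => (v + t • w) j) (w j) 0 := fun j => by
    simpa using ((hasDerivAt_id (0 : ℝ)).mul_const (w j)).const_add (v j)
  have h1 : HasDerivAt (fun (t : ℝ) (k : Fin n) => (v + t • w) (i.succAbove k) / (v + t • w) i)
      (fun k => (w (i.succAbove k) * v i - v (i.succAbove k) * w i) / v i ^ 2) 0 :=
    hasDerivAt_pi.mpr fun k => by
      have h2 := (h (i.succAbove k)).div (h i) (by simpa using hv)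
      simp only [zero_smul, add_zero] at h2
      exact h2
  exact (PiLp.continuousLinearEquiv 2 ℝ
    (fun _ : Fin n => ℝ)).symm.toContinuousLinearMap.hasFDerivAt.comp_hasDerivAt 0 h1

/-- The coordinates of the chart at a point. -/
def chartIndex (x : RP n) : Fin (n + 1) := (exists_mem_affineOpen x).choose

lemma mem_affineOpen_chartIndex (x : RP n) : x ∈ affineOpen (chartIndex x) :=
  (exists_mem_affineOpen x).choose_spec

/-- Both sides are the velocity at `0` of the curve `[x.rep + t w]` read in the second chart. -/
lemma tangentCoordChange_affineCoordDeriv {x y : RP n} (h : x ∈ affineOpen (chartIndex y))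
    (w : Fin (n + 1) → ℝ) :
    tangentCoordChange (𝓡 n) x y x (affineCoordDeriv (chartIndex x) x.rep w) =
      affineCoordDeriv (chartIndex y) x.rep w := by
  have hx : x.rep (chartIndex x) ≠ 0 := mem_affineOpen_chartIndex x
  have h1 : HasFDerivAt ((extChartAt (𝓡 n) y) ∘ (extChartAt (𝓡 n) x).symm)
      (tangentCoordChange (𝓡 n) x y x) (extChartAt (𝓡 n) x x) := by
    have := hasFDerivWithinAt_tangentCoordChange (I := 𝓡 n) (x := x) (y := y) (z := x)
      ⟨by simp, by rw [extChartAt_source]; exact h⟩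
    simpa using this
  have e0 : extChartAt (𝓡 n) x x = affineCoord (chartIndex x) (x.rep + (0 : ℝ) • w) := by
    rw [zero_smul, add_zero, ← chart_mk _ x.rep_nonzero]
    exact congrArg (chart (chartIndex x)) x.mk_rep.symm
  rw [e0] at h1
  have h2 := h1.comp_hasDerivAt (0 : ℝ) (hasDerivAt_affineCoord hx w)
  refine h2.unique ((hasDerivAt_affineCoord h w).congr_of_eventuallyEq ?_)
  have hc : Continuous fun t : ℝ => x.rep + t • w := by fun_prop
  have ha : ∀ᶠ t : ℝ in nhds 0, (x.rep + t • w) (chartIndex x) ≠ 0 :=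
    ((continuous_apply (chartIndex x)).comp hc).continuousAt.eventually_ne (by simpa using hx)
  filter_upwards [ha] with t ht
  have hv : x.rep + t • w ≠ 0 := fun h0 => ht (congrFun h0 _)
  rw [Function.comp, ← chart_mk _ hv, ← chart_mk _ hv]
  exact congrArg (chart (chartIndex y))
    ((chart (chartIndex x)).left_inv ((mk_mem_affineOpen _ _ hv).mpr ht))

/-- The product of the quaternion `v` and the imaginary quaternion `u`. -/
def quatMul (v : Fin 4 → ℝ) (u : EuclideanSpace ℝ (Fin 3)) : Fin 4 → ℝ :=
  ![-(v 1 * u 0) - v 2 * u 1 - v 3 * u 2, v 0 * u 0 - v 3 * u 1 + v 2 * u 2,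
    v 3 * u 0 + v 0 * u 1 - v 1 * u 2, -(v 2 * u 0) + v 1 * u 1 + v 0 * u 2]

lemma quatMul_smul (a : ℝ) (v : Fin 4 → ℝ) (u : EuclideanSpace ℝ (Fin 3)) :
    quatMul (a • v) u = a • quatMul v u := by
  ext j
  fin_cases j <;> simp [quatMul] <;> ring

lemma continuous_quatMul :
    Continuous fun q : (Fin 4 → ℝ) × EuclideanSpace ℝ (Fin 3) => quatMul q.1 q.2 := by
  refine continuous_pi fun j => ?_
  fin_cases j <;> simp [quatMul] <;> fun_prop

lemma quatMul_eq_smul {v : Fin 4 → ℝ} (hv : v ≠ 0) {u : EuclideanSpace ℝ (Fin 3)} {c : ℝ}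
    (h : quatMul v u = c • v) : u = 0 := by
  have h0 := congrFun h 0
  have h1 := congrFun h 1
  have h2 := congrFun h 2
  have h3 := congrFun h 3
  simp [quatMul] at h0 h1 h2 h3
  set N := v 0 ^ 2 + v 1 ^ 2 + v 2 ^ 2 + v 3 ^ 2 with hN
  have hpos : 0 < N := by
    obtain ⟨j, hj⟩ := Function.ne_iff.mp hv
    have hj' := sq_pos_of_ne_zero hj
    fin_cases j <;> simp at hj' <;> nlinarith [sq_nonneg (v 0), sq_nonneg (v 1), sq_nonneg (v 2), sq_nonneg (v 3)]
  -- `v u` is orthogonal to `v` because `u` is imaginary. Once `c = 0`, multiplication by the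
  -- conjugate of `v` gives `N u = 0`.
  have hc : c * N = 0 := by
    linear_combination -(v 0) * h0 - v 1 * h1 - v 2 * h2 - v 3 * h3
  have hc0 : c = 0 := (mul_eq_zero.mp hc).resolve_right hpos.ne'
  subst hc0
  have e0 : N * u 0 = 0 := by linear_combination -(v 1) * h0 + v 0 * h1 + v 3 * h2 - v 2 * h3
  have e1 : N * u 1 = 0 := by linear_combination -(v 2) * h0 - v 3 * h1 + v 0 * h2 + v 1 * h3
  have e2 : N * u 2 = 0 := by linear_combination -(v 3) * h0 + v 2 * h1 - v 1 * h2 + v 0 * h3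
  ext j
  fin_cases j
  · exact (mul_eq_zero.mp e0).resolve_left hpos.ne'
  · exact (mul_eq_zero.mp e1).resolve_left hpos.ne'
  · exact (mul_eq_zero.mp e2).resolve_left hpos.ne.symm

/-- The vector fields that are given by the imaginary quaternions, in an affine chart. -/
def parallelCoord (i : Fin 4) (x : RP 3) :
    EuclideanSpace ℝ (Fin 3) →ₗ[ℝ] EuclideanSpace ℝ (Fin 3) where
  toFun u := affineCoordDeriv i x.rep (quatMul x.rep u)
  map_add' u u' := by
    ext k
    have h : quatMul x.rep (u + u') = quatMul x.rep u + quatMul x.rep u' := by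
      ext j
      fin_cases j <;> simp [quatMul] <;> ring
    simp [affineCoordDeriv, h]
    ring
  map_smul' a u := by
    ext k
    have h : quatMul x.rep (a • u) = a • quatMul x.rep u := by
      ext j
      fin_cases j <;> simp [quatMul] <;> ring
    simp [affineCoordDeriv, h]
    ring

/-- The derivative of the affine coordinates kills only multiples of `x.rep`, and `v u` is such a
multiple only for `u = 0`. -/
lemma parallelCoord_injective {i : Fin 4} {x : RP 3} (h : x ∈ affineOpen i) :
    Function.Injective (parallelCoord i x) := by
  rw [← LinearMap.ker_eq_bot, LinearMap.ker_eq_bot']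
  intro u hu
  have hi : x.rep i ≠ 0 := h
  refine quatMul_eq_smul x.rep_nonzero (c := quatMul x.rep u i / x.rep i) (funext fun j => ?_)
  refine Fin.succAboveCases i ?_ (fun k => ?_) j
  · simp [hi]
  · have h1 : affineCoordDeriv i x.rep (quatMul x.rep u) k = 0 := congrArg (fun y => y k) hu
    have h2 := (div_eq_zero_iff.mp h1).resolve_right (pow_ne_zero 2 hi)
    rw [Pi.smul_apply, smul_eq_mul, div_mul_eq_mul_div, eq_div_iff hi]
    linarith

/-- The parallelization of `ℝP³`. -/
def parallel (x : RP 3) : EuclideanSpace ℝ (Fin 3) ≃ₗ[ℝ] TangentSpace (𝓡 3) x :=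
  LinearEquiv.ofInjectiveEndo (parallelCoord (chartIndex x) x)
    (parallelCoord_injective (mem_affineOpen_chartIndex x))

/-- No continuity of `x.rep` in `x` is available; by homogeneity it can be replaced by the
continuous representative `(v_j / v_i)_j`. -/
lemma continuousOn_parallelCoord (i : Fin 4) :
    ContinuousOn (fun q : RP 3 × EuclideanSpace ℝ (Fin 3) => parallelCoord i q.1 q.2)
      (affineOpen i ×ˢ Set.univ) := by
  have h : ∀ q ∈ affineOpen i ×ˢ (Set.univ : Set (EuclideanSpace ℝ (Fin 3))),
      parallelCoord i q.1 q.2 =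
        affineCoordDeriv i (fun j => ratio i j q.1) (quatMul (fun j => ratio i j q.1) q.2) := by
    rintro ⟨x, u⟩ ⟨hx, -⟩
    have hi : x.rep i ≠ 0 := hx
    have hr : (fun j => ratio i j x) = (x.rep i)⁻¹ • x.rep := by
      ext j
      simp [ratio, div_eq_inv_mul]
    change affineCoordDeriv i x.rep (quatMul x.rep u) = _
    rw [hr, quatMul_smul, affineCoordDeriv_smul _ _ _ (inv_ne_zero hi)]
  refine ContinuousOn.congr ?_ h
  have hr : ContinuousOn (fun q : RP 3 × EuclideanSpace ℝ (Fin 3) => fun j => ratio i j q.1)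
      (affineOpen i ×ˢ Set.univ) :=
    continuousOn_pi.mpr fun j => (continuousOn_ratio i j).comp continuousOn_fst fun q hq => hq.1
  have hq := continuous_quatMul.comp_continuousOn (hr.prodMk continuousOn_snd)
  refine (PiLp.continuous_toLp 2 _).comp_continuousOn (continuousOn_pi.mpr fun k => ?_)
  have hr' := continuousOn_pi.mp hr
  have hq' := continuousOn_pi.mp hq
  refine (((hq' _).mul (hr' i)).sub ((hr' _).mul (hq' i))).div ((hr' i).pow 2) fun q hq => ?_
  exact pow_ne_zero 2 ((ratio_self hq.1).trans_ne one_ne_zero)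

/-- `chartIndex x` may jump with `x`. The fields are therefore read in the chart of one fixed point,
where they become `parallelCoord` for a fixed index. -/
lemma continuous_parallel : Continuous fun q : RP 3 × EuclideanSpace ℝ (Fin 3) =>
    (⟨q.1, parallel q.1 q.2⟩ : TangentBundle (𝓡 3) (RP 3)) := by
  refine continuous_iff_continuousAt.mpr fun q₀ => ?_
  refine (FiberBundle.continuousAt_totalSpace _ _).mpr ⟨continuousAt_fst, ?_⟩
  have hmem := ((isOpen_affineOpen (chartIndex q₀.1)).prod (isOpen_univ
    (X := EuclideanSpace ℝ (Fin 3)))).mem_nhds ⟨mem_affineOpen_chartIndex q₀.1, trivial⟩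
  refine ((continuousOn_parallelCoord (chartIndex q₀.1)).continuousAt hmem).congr ?_
  filter_upwards [hmem] with q hq
  exact (tangentCoordChange_affineCoordDeriv hq.1 _).symm

end RP

end

noncomputable section

/-! ### `H`-structures on `ℝP³` -/

namespace RP

open Bundle Manifold
open scoped ContDiff

variable {n : ℕ}

lemma ratio_mul_ratio {i j k : Fin (n + 1)} {x : RP n} (hj : x ∈ affineOpen j) :
    ratio i j x * ratio j k x = ratio i k x := by
  have hj' : x.rep j ≠ 0 := hj
  rw [ratio, ratio, ratio]
  field_simp

open Classical in
/-- The principal bundle with the transition functions `1` and `a` that is associated with the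
double covering `S³ → ℝP³`. -/
def twistedCore (a : HGroup 3) (ha : a * a = 1) (hc : Continuous fun h : HGroup 3 => a * h) :
    FiberBundleCore (Fin 4) (RP 3) (HGroup 3) where
  baseSet := affineOpen
  isOpen_baseSet := isOpen_affineOpen
  indexAt := chartIndex
  mem_baseSet_at := mem_affineOpen_chartIndex
  coordChange i j x h := if ratio i j x < 0 then a * h else h
  coordChange_self i x hx h := by
    rw [ratio_self hx, if_neg (by norm_num)]
  continuousOn_coordChange i j := by
    rintro ⟨x, h⟩ ⟨⟨hi, hj⟩, -⟩
    refine ContinuousAt.continuousWithinAt ?_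
    have hr : ContinuousAt (fun p : RP 3 × HGroup 3 => ratio i j p.1) (x, h) :=
      ContinuousAt.comp (f := Prod.fst) (g := ratio i j) (((continuousOn_ratio i j).continuousAt
        ((isOpen_affineOpen i).mem_nhds hi))) continuousAt_fst
    rcases (ratio_ne_zero hi hj).lt_or_gt with hlt | hgt
    · refine (hc.comp continuous_snd).continuousAt.congr ?_
      filter_upwards [hr.eventually_lt_const hlt] with p hp
      rw [if_pos hp]
      rfl
    · refine continuous_snd.continuousAt.congr ?_
      filter_upwards [hr.eventually_const_lt hgt] with p hp
      rw [if_neg hp.not_gt]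
  -- The cocycle condition is multiplicativity of signs together with `a² = 1`.
  coordChange_comp i j k x hx h := by
    obtain ⟨⟨hi, hj⟩, hk⟩ := hx
    rw [← ratio_mul_ratio (i := i) (k := k) hj]
    rcases (ratio_ne_zero hi hj).lt_or_gt with h1 | h1 <;>
      rcases (ratio_ne_zero hj hk).lt_or_gt with h2 | h2
    · rw [if_pos h1, if_pos h2, if_neg (mul_pos_of_neg_of_neg h1 h2).not_gt, ← mul_assoc, ha, one_mul]
    · rw [if_pos h1, if_neg h2.not_gt, if_pos (mul_neg_of_neg_of_pos h1 h2)]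
    · rw [if_neg h1.not_gt, if_pos h2, if_pos (mul_neg_of_pos_of_neg h1 h2)]
    · rw [if_neg h1.not_gt, if_neg h2.not_gt, if_neg (mul_pos h1 h2).not_gt]

section Twisted

variable {a : HGroup 3} {ha : a * a = 1} {hc : Continuous fun h : HGroup 3 => a * h}

lemma twistedCore_coordChange_of_neg {i j : Fin 4} {x : RP 3} (hr : ratio i j x < 0) (h : HGroup 3) :
    (twistedCore a ha hc).coordChange i j x h = a * h := if_pos hr

lemma twistedCore_coordChange_of_not_neg {i j : Fin 4} {x : RP 3} (hr : ¬ ratio i j x < 0)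
    (h : HGroup 3) : (twistedCore a ha hc).coordChange i j x h = h := if_neg hr

lemma twistedCore_coordChange_mul (i j : Fin 4) (x : RP 3) (h k : HGroup 3) :
    (twistedCore a ha hc).coordChange i j x (h * k) =
      (twistedCore a ha hc).coordChange i j x h * k := by
  by_cases hr : ratio i j x < 0
  · simp only [twistedCore_coordChange_of_neg hr, mul_assoc]
  · simp only [twistedCore_coordChange_of_not_neg hr]

lemma rho_twistedCore_coordChange (hρ : HGroup.rho 3 a = 1) (i j : Fin 4) (x : RP 3)
    (h : HGroup 3) : HGroup.rho 3 ((twistedCore a ha hc).coordChange i j x h) = HGroup.rho 3 h := by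
  by_cases hr : ratio i j x < 0
  · rw [twistedCore_coordChange_of_neg hr, map_mul, hρ, one_mul]
  · rw [twistedCore_coordChange_of_not_neg hr]

/-- A point of the fibre as an element of the structure group. -/
def fibreCoord (p : (twistedCore a ha hc).TotalSpace) : HGroup 3 := p.2

instance twistedAction : MulAction (HGroup 3)ᵐᵒᵖ (twistedCore a ha hc).TotalSpace where
  smul k p := ⟨p.1, fibreCoord p * k.unop⟩
  one_smul p := congrArg (TotalSpace.mk p.1) (mul_one (fibreCoord p))
  mul_smul k l p := congrArg (TotalSpace.mk p.1)
    (mul_assoc (fibreCoord p) l.unop k.unop).symm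

lemma twistedCore_locally_trivial (x : RP 3) : ∃ U : Set (RP 3), IsOpen U ∧ x ∈ U ∧
    ∃ φ : U × HGroup 3 ≃ₜ (twistedCore a ha hc).proj ⁻¹' U,
      (∀ u h, (twistedCore a ha hc).proj (φ (u, h)) = u) ∧
      ∀ u h k, (φ (u, h * k) : (twistedCore a ha hc).TotalSpace) =
        MulOpposite.op k • (φ (u, h) : (twistedCore a ha hc).TotalSpace) := by
  refine ⟨affineOpen (chartIndex x), isOpen_affineOpen _, mem_affineOpen_chartIndex x,
    (((twistedCore a ha hc).localTriv (chartIndex x)).preimageHomeomorph subset_rfl).symm,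
    fun u h => rfl, fun u h k => ?_⟩
  exact congrArg (TotalSpace.mk u.1) (twistedCore_coordChange_mul _ _ _ _ _)

lemma continuousOn_twistedCoord (i : Fin 4) :
    ContinuousOn (fun p : (twistedCore a ha hc).TotalSpace =>
      ((twistedCore a ha hc).coordChange (chartIndex p.1) i p.1 (fibreCoord p) : HGroup 3))
      ((twistedCore a ha hc).proj ⁻¹' affineOpen i) :=
  continuous_snd.comp_continuousOn ((twistedCore a ha hc).localTriv i).continuousOn

/-- The `H`-structure on `ℝP³` with the double covering `S³ → ℝP³` as twist of the charges. -/
def twistedStructure {F : Type} [NormedAddCommGroup F] [NormedSpace ℝ F] {E : RP 3 → Type}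
    [∀ x, AddCommMonoid (E x)] [∀ x, Module ℝ (E x)] [TopologicalSpace (TotalSpace F E)]
    [∀ x, TopologicalSpace (E x)] [FiberBundle F E] [VectorBundle ℝ F E]
    (ha : a * a = 1) (hc : Continuous fun h : HGroup 3 => a * h) (hρ : HGroup.rho 3 a = 1)
    (C : ∀ i, ∀ x ∈ affineOpen i, ℂ ≃ₗ[ℝ] E x)
    (hC : ∀ i, Continuous fun q : affineOpen i × ℂ => (⟨q.1, C i q.1 q.1.2 q.2⟩ : TotalSpace F E))
    (hneg : ∀ i j x hi hj, ratio i j x < 0 → ∀ z, C j x hj (HGroup.tau 3 a z) = C i x hi z)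
    (hpos : ∀ i j x hi hj, 0 < ratio i j x → ∀ z, C j x hj z = C i x hi z) :
    HStructure 3 (RP 3) F E where
  P := (twistedCore a ha hc).TotalSpace
  proj := (twistedCore a ha hc).proj
  continuous_proj := (twistedCore a ha hc).continuous_proj
  locally_trivial := twistedCore_locally_trivial
  tangentFrame p := (HGroup.rho 3 (fibreCoord p)).toLinearEquiv.trans (parallel p.1)
  continuous_tangentFrame := by
    -- As `ρ(a) = 1`, the value of `ρ` on the fibre coordinate is the same in every trivialization.
    have h : Continuous fun q : (twistedCore a ha hc).TotalSpace × EuclideanSpace ℝ (Fin 3) =>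
        HGroup.rho 3 (fibreCoord q.1) q.2 := by
      refine continuous_iff_continuousAt.mpr fun q₀ => ?_
      have hmem := ((isOpen_affineOpen (chartIndex q₀.1.1)).preimage
        ((twistedCore a ha hc).continuous_proj.comp continuous_fst)).mem_nhds
          (x := q₀) (mem_affineOpen_chartIndex q₀.1.1)
      have h1 := (((continuousOn_twistedCoord (chartIndex q₀.1.1)).comp continuousOn_fst
        fun q hq => hq).prodMk continuousOn_snd).continuousAt hmem
      refine (HGroup.continuous_rho.continuousAt.comp h1).congr ?_
      filter_upwards with q
      exact congrArg (fun A : EuclideanSpace ℝ (Fin 3) ≃ₗᵢ[ℝ] EuclideanSpace ℝ (Fin 3) => A q.2)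
        (rho_twistedCore_coordChange (ha := ha) (hc := hc) hρ _ _ _ _)
    exact continuous_parallel.comp
      (((twistedCore a ha hc).continuous_proj.comp continuous_fst).prodMk h)
  tangentFrame_smul p h v := by
    change (⟨p.1, parallel p.1 (HGroup.rho 3 (fibreCoord p * h) v)⟩ : TangentBundle (𝓡 3) (RP 3)) = _
    rw [map_mul]
    rfl
  chargeFrame p := (HGroup.tau 3 (fibreCoord p)).toLinearEquiv.trans
    (C (chartIndex p.1) p.1 (mem_affineOpen_chartIndex p.1))
  continuous_chargeFrame := by
    -- The compatibility of the local frames `C` with `τ(a)` makes the charge frame independent of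
    -- the trivialization in which it is computed.
    have key : ∀ i j x hi hj (h : HGroup 3) z,
        C j x hj (HGroup.tau 3 ((twistedCore a ha hc).coordChange i j x h) z) =
          C i x hi (HGroup.tau 3 h z) := by
      intro i j x hi hj h z
      by_cases hr : ratio i j x < 0
      · rw [twistedCore_coordChange_of_neg hr, map_mul]
        exact hneg _ _ _ _ _ hr _
      · rw [twistedCore_coordChange_of_not_neg hr]
        exact hpos _ _ _ _ _ (lt_of_le_of_ne (not_lt.mp hr) (ratio_ne_zero hi hj).symm) _
    refine continuous_iff_continuousAt.mpr fun q₀ => ?_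
    have hopen := (isOpen_affineOpen (chartIndex q₀.1.1)).preimage
        ((twistedCore a ha hc).continuous_proj.comp (continuous_fst (Y := ℂ)))
    have hmem := hopen.mem_nhds (x := q₀) (mem_affineOpen_chartIndex q₀.1.1)
    refine ContinuousOn.continuousAt ?_ hmem
    rw [continuousOn_iff_continuous_domRestrict]
    have h1 := ((continuousOn_twistedCoord (ha := ha) (hc := hc) (chartIndex q₀.1.1)).comp
      (continuousOn_fst (s := ((twistedCore a ha hc).proj ∘ Prod.fst (β := ℂ)) ⁻¹'
        affineOpen (chartIndex q₀.1.1))) fun q hq => hq).prodMk continuousOn_snd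
    have h2 := HGroup.continuous_tau.comp (continuousOn_iff_continuous_domRestrict.mp h1)
    have h3 := (hC (chartIndex q₀.1.1)).comp (Continuous.prodMk (Continuous.subtype_mk
      (((twistedCore a ha hc).continuous_proj.comp continuous_fst).comp continuous_subtype_val)
        fun q => q.2) h2)
    refine h3.congr fun q => ?_
    exact congrArg (TotalSpace.mk q.1.1.1) (key _ _ _ (mem_affineOpen_chartIndex _) q.2 _ _)
  chargeFrame_smul p h v := by
    change (⟨p.1, C _ p.1 _ (HGroup.tau 3 (fibreCoord p * h) v)⟩ : TotalSpace F E) = _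
    rw [map_mul]
    rfl

end Twisted

/-! #### The trivial plane bundle -/

lemma nonempty_hStructure_trivialPlane :
    Nonempty (HStructure 3 (RP 3) (EuclideanSpace ℝ (Fin 2)) trivialPlane) := by
  -- With `a = 1` the principal bundle is untwisted and one constant frame serves for all charts.
  refine ⟨twistedStructure (a := 1) (one_mul 1) (continuous_id.congr fun h => (one_mul h).symm) (map_one _)
    (fun _ _ _ => Complex.orthonormalBasisOneI.repr.toLinearEquiv) (fun i => ?_)
    (fun i j x _ _ _ z => ?_) fun _ _ _ _ _ _ _ => rfl⟩
  · rw [(Trivial.isInducing_toProd (RP 3) (EuclideanSpace ℝ (Fin 2))).continuous_iff]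
    exact (continuous_subtype_val.comp continuous_fst).prodMk
      (Complex.orthonormalBasisOneI.repr.continuous.comp continuous_snd)
  · rw [map_one]
    rfl

/-! #### The plane bundle `γ ⊕ ℝ` -/

/-- The normalized vector in a line with positive `i`-th coordinate. -/
def unitVec (i : Fin (n + 1)) (x : RP n) : Fin (n + 1) → ℝ :=
  ‖fun j => ratio i j x‖⁻¹ • fun j => ratio i j x

lemma unitVec_ne_zero {i : Fin (n + 1)} {x : RP n} (h : x ∈ affineOpen i) : unitVec i x ≠ 0 :=
  smul_ne_zero (inv_ne_zero (norm_ne_zero_iff.mpr (ratio_vec_ne_zero h))) (ratio_vec_ne_zero h)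

lemma mk_unitVec {i : Fin (n + 1)} {x : RP n} (h : x ∈ affineOpen i) :
    mk (unitVec i x) (unitVec_ne_zero h) = x := by
  conv_rhs => rw [← mk_ratio h]
  exact (Projectivization.mk_eq_mk_iff' ℝ _ _ _ _).mpr ⟨_, rfl⟩

/-- Normalization reduces the transition factor `v_j / v_i` of `γ` to its sign, so that an
involution suffices as transition function of the principal bundle. -/
lemma unitVec_eq {i j : Fin (n + 1)} {x : RP n} (hj : x ∈ affineOpen j) :
    unitVec i x = (ratio i j x / |ratio i j x|) • unitVec j x := by
  have h : (fun k => ratio i k x) = ratio i j x • fun k => ratio j k x :=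
    funext fun k => (ratio_mul_ratio hj).symm
  rw [unitVec, unitVec, h, norm_smul, smul_smul, smul_smul, Real.norm_eq_abs, mul_inv]
  congr 1
  ring

/-- The frame `z ↦ (Re(z) s, Im(z))` of `γ ⊕ ℝ`, where `s` is a normalized section of `γ`. -/
def sumEquiv (i : Fin 4) (x : RP 3) (h : x ∈ affineOpen i) : ℂ ≃ₗ[ℝ] tautPlusTrivial x :=
  Complex.equivRealProdLm.trans (LinearEquiv.prodCongr
    ((LinearEquiv.toSpanNonzeroSingleton ℝ _ _ (unitVec_ne_zero h)).trans
      (LinearEquiv.ofEq _ _ (submodule_eq_span (mk_unitVec h))) : ℝ ≃ₗ[ℝ] Taut 3 x)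
    (LinearEquiv.refl ℝ ℝ))

lemma sumEquiv_ext {i j : Fin 4} {x : RP 3} (hi : x ∈ affineOpen i) (hj : x ∈ affineOpen j) {z w : ℂ}
    (hre : z.re • unitVec i x = w.re • unitVec j x) (him : z.im = w.im) :
    sumEquiv i x hi z = sumEquiv j x hj w :=
  Prod.ext (Subtype.ext hre) him

lemma nonempty_hStructure_tautPlusTrivial :
    Nonempty (HStructure 3 (RP 3) (ℝ × ℝ) tautPlusTrivial) := by
  refine ⟨twistedStructure HGroup.reflection_mul_self HGroup.continuous_reflection_mul
    HGroup.rho_reflection sumEquiv (fun i => ?_) (fun i j x hi hj hr z => ?_)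
    fun i j x hi hj hr z => ?_⟩
  · rw [(FiberBundle.Prod.isInducing_diag ℝ (Taut 3) ℝ (Trivial (RP 3) ℝ)).continuous_iff]
    have hr : Continuous fun q : affineOpen (n := 3) i × ℂ => fun j => ratio i j q.1.1 :=
      continuous_pi fun j => (continuousOn_iff_continuous_domRestrict.mp
        (continuousOn_ratio i j)).comp continuous_fst
    refine Continuous.prodMk ?_ ?_
    · rw [isInducing_tautIncl.continuous_iff]
      refine (continuous_subtype_val.comp continuous_fst).prodMk
        ((Complex.continuous_re.comp continuous_snd).smul ((hr.norm.inv₀ fun q => ?_).smul hr))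
      exact norm_ne_zero_iff.mpr (ratio_vec_ne_zero q.1.2)
    · rw [(Trivial.isInducing_toProd (RP 3) ℝ).continuous_iff]
      exact (continuous_subtype_val.comp continuous_fst).prodMk
        (Complex.continuous_im.comp continuous_snd)
  -- Where `v_j / v_i` is negative, `unitVec` changes sign between the charts; `τ(a)` reverses the
  -- real part and compensates this.
  · rw [HGroup.tau_reflection]
    refine sumEquiv_ext hj hi ?_ (by simp)
    rw [unitVec_eq (i := i) hj, abs_of_neg hr, div_neg, div_self hr.ne]
    simp
  · refine sumEquiv_ext hj hi ?_ rfl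
    rw [unitVec_eq (i := i) hj, abs_of_pos hr, div_self hr.ne', one_smul]

end RP

end

theorem mainTheorem4 :
    -- `γ`, `γ ⊕ ℝ` and the trivial plane bundle have well-defined first Stiefel–Whitney classes
    (∃! w, ModTwo.IsFirstStiefelWhitneyClass ℝ (RP.Taut 3) w) ∧
    (∃! w, ModTwo.IsFirstStiefelWhitneyClass (ℝ × ℝ) tautPlusTrivial w) ∧
    (∃! w, ModTwo.IsFirstStiefelWhitneyClass (EuclideanSpace ℝ (Fin 2)) trivialPlane w) ∧
    -- `ℝP^3` has a unique mod `2` fundamental class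
    (∃! c, ModTwo.IsFundamentalClass (RP 3) 3 c) ∧
    -- `w₁(γ)³ ≠ 0` in `H^3(ℝP^3; ℤ/2)`, and `w₁(γ ⊕ ℝ) = w₁(γ)`
    ModTwo.cube (ModTwo.w₁ ℝ (RP.Taut 3)) ≠ 0 ∧
    ModTwo.w₁ (ℝ × ℝ) tautPlusTrivial = ModTwo.w₁ ℝ (RP.Taut 3) ∧
    -- `ℝP^3` admits an `H`-structure with bundle `γ ⊕ ℝ`, and `Z = -1` for all of them
    Nonempty (HStructure 3 (RP 3) (ℝ × ℝ) tautPlusTrivial) ∧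
    (∀ s : HStructure 3 (RP 3) (ℝ × ℝ) tautPlusTrivial, s.partitionFunction = -1) ∧
    -- `ℝP^3` admits an `H`-structure with trivial plane bundle, and `Z = 1` for all of them
    Nonempty (HStructure 3 (RP 3) (EuclideanSpace ℝ (Fin 2)) trivialPlane) ∧
    ∀ s : HStructure 3 (RP 3) (EuclideanSpace ℝ (Fin 2)) trivialPlane,
      s.partitionFunction = 1 := by
  refine ⟨RP.existsUnique_w₁_taut, RP.existsUnique_w₁_tautPlusTrivial,
    RP.existsUnique_w₁_trivialPlane, RP.existsUnique_isFundamentalClass, RP.cube_w₁_taut_ne_zero,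
    RP.w₁_tautPlusTrivial, RP.nonempty_hStructure_tautPlusTrivial, fun s => ?_,
    RP.nonempty_hStructure_trivialPlane, fun s => ?_⟩
  · rw [HStructure.partitionFunction, RP.w₁_tautPlusTrivial, RP.integral_cube_w₁_taut]
    simp [ZMod.val_one]
  · rw [HStructure.partitionFunction, RP.integral_cube_w₁_trivialPlane]
    simp
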